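/- Let $(M,L)$ be a $4$-dimensional Finsler spacetime: $M$ is a connected smooth $4$-manifold, $A\subset TM\setminus\mathbf 0$ is a connected open conic set with smooth boundary and nonempty fibres $A_p$, $\bar A$ is its closure in $TM\setminus\mathbf 0$, and $L\colon\bar A\to[0,\infty)$ is smooth, positively homogeneous of degree $2$ on fibres, with fundamental tensor $g_v(u,w)=\frac12\frac{\partial^2}{\partial s\,\partial t}L(v+tu+sw)|_{t=s=0}$ of signature $(+,-,-,-)$ for every $v\in\bar A$, and with $\partial\bar A=L^{-1}(0)$. Let $\nabla$ be its Levi-Civita--Chern connection and $R$ its Chern curvature, $R(X,Y)=[\nabla_X,\nabla_Y]-\nabla_{[X,Y]}$. Let $f$ be a smooth function on an open set $\mathscr U\subseteq M$ whose gradient $N=\nabla f$ (that is, $g_N(N,\cdot)=df$) is lightlike ($N\in\bar A$, $L(N)=0$), and let $(x^0,x^1,x^2,x^3)$ be lightlike coordinates on $\mathscr U$: $N=\partial_0$ and $$(g_{ij}(N))=\begin{pmatrix}0&1&0&0\\1&g_{11}&g_{12}&g_{13}\\0&g_{21}&h_{22}&h_{23}\\0&g_{31}&h_{32}&h_{33}\end{pmatrix}.$$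 (The block $(h_{ij})$ is then definite.) Let $\Lambda_{b,c}=\{q\in\mathscr U: x^0(q)=b,\ x^1(q)=c\}$. Suppose that the inverse $\Phi$ of the coordinate map is continued to a smooth map $\Phi\colon W\to M$ on an open set $W\subseteq\mathbb R^4$ containing the range of the coordinates, such that at the points of $W$ outside this range the $x^0$-lines $s\mapsto\Phi(s,x^1,x^2,x^3)$ satisfy the geodesic equation with velocity in $\bar A$; no nondegeneracy of $\Phi$ is required there, and the case where $W$ is the range of the coordinates is included. On $W$ put $\partial_i=\partial\Phi/\partial x^i$, $N=\partial_0$, $h_{ij}=g_N(\partial_i,\partial_j)$ for $i,j\in\{2,3\}$, and $$\Delta=\sqrt{h_{22}h_{33}-h_{23}h_{32}}.$$ Let $I$ be an open interval and $\gamma(s)=\Phi(s,c,y^2,y^3)$, $s\in I$, an integral curve of $N$ with $(s,c,y^2,y^3)\in W$ for all $s\in I$, where $b\in I$ and $(b,c,y^2,y^3)$ lies in the range of the coordinates. Then for every $t\in I$, the point $p=\gamma(t)$ is a focal point of $\Lambda_{b,c}$ along the geodesic $\gamma$ if and only if $\Delta(t,c,y^2,y^3)=0$. Here $\gamma(t)$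 is a focal point of $\Lambda=\Lambda_{b,c}$ along $\gamma$ if $\gamma$ is a geodesic on $I$ which meets $\Lambda$ orthogonally at time $b$ with velocity $N$, $t\neq b$, and there is a smooth vector field $J\not\equiv0$ along $\gamma$ on $I$ with $J''=-R_{\gamma'}(J,\gamma')\gamma'$, $J(b)\in T_{\gamma(b)}\Lambda$, $\tan_\Lambda J'(b)=\tan_\Lambda(\nabla^N_{J(b)}N)$, and $J(t)=0$; primes on $J$ denote the covariant derivative along $\gamma$ with reference vector $\gamma'$. -/

import Mathlib

open scoped Manifold ContDiff Topology

noncomputable section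

/-- The model space of a four-dimensional manifold. -/
abbrev E4 : Type := EuclideanSpace ℝ (Fin 4)

/-- The `i`-th coordinate vector of `ℝ⁴`. -/
def basisVec (i : Fin 4) : E4 := EuclideanSpace.single i 1

/-! ### Fundamental tensor and Cartan tensor of a function on a vector space -/

section Fibre

variable {V : Type*} [AddCommGroup V] [Module ℝ V]

/-- `g_v(u,w) = (1/2) ∂²/∂s∂t F(v + t u + s w)` at `t = s = 0`. -/
def fundTensor (F : V → ℝ) (v u w : V) : ℝ :=
  (1 / 2) * deriv (fun s : ℝ => deriv (fun t : ℝ => F (v + t • u + s • w)) 0) 0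

/-- `C_v(u,w,z) = (1/4) ∂³/∂r∂s∂t F(v + t u + s w + r z)` at `t = s = r = 0`. -/
def cartanTensor (F : V → ℝ) (v u w z : V) : ℝ :=
  (1 / 4) * deriv (fun r : ℝ => deriv (fun s : ℝ =>
    deriv (fun t : ℝ => F (v + t • u + s • w + r • z)) 0) 0) 0

end Fibre

/-! ### The Levi-Civita--Chern connection and its curvature in coordinates

`ℓ x v` is the expression of the Finsler function in a chart: `x` is the position, `v` the
direction. -/

namespace LocalFinsler

/-- The matrix `g_ij(x,v)`. -/
def metric (ℓ : E4 → E4 → ℝ) (x v : E4) : Matrix (Fin 4) (Fin 4) ℝ :=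
  Matrix.of fun i j => fundTensor (ℓ x) v (basisVec i) (basisVec j)

/-- The components `C_ijk(x,v)` of the Cartan tensor. -/
def cartan (ℓ : E4 → E4 → ℝ) (x v : E4) (i j k : Fin 4) : ℝ :=
  cartanTensor (ℓ x) v (basisVec i) (basisVec j) (basisVec k)

/-- Partial derivative `∂F/∂xʲ` in the position. -/
def dPos (F : E4 → E4 → ℝ) (x v : E4) (j : Fin 4) : ℝ :=
  lineDeriv ℝ (fun y => F y v) x (basisVec j)

/-- Partial derivative `∂F/∂vʲ` in the direction. -/
def dDir (F : E4 → E4 → ℝ) (x v : E4) (j : Fin 4) : ℝ :=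
  lineDeriv ℝ (fun y => F x y) v (basisVec j)

/-- The formal Christoffel symbols
`γ^i_jk = (1/2) g^il (∂_j g_lk + ∂_k g_jl - ∂_l g_jk)`. -/
def formalChristoffel (ℓ : E4 → E4 → ℝ) (x v : E4) (i j k : Fin 4) : ℝ :=
  (1 / 2) * ∑ l, (metric ℓ x v)⁻¹ i l *
    (dPos (fun y u => metric ℓ y u l k) x v j + dPos (fun y u => metric ℓ y u j l) x v k
      - dPos (fun y u => metric ℓ y u j k) x v l)

/-- The nonlinear connection `N^i_j = γ^i_jk v^k - g^il C_ljk γ^k_rs v^r v^s`. -/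
def nonlinearConn (ℓ : E4 → E4 → ℝ) (x v : E4) (i j : Fin 4) : ℝ :=
  (∑ k, formalChristoffel ℓ x v i j k * v k)
    - ∑ l, ∑ k, ∑ r, ∑ s, (metric ℓ x v)⁻¹ i l * cartan ℓ x v l j k
        * formalChristoffel ℓ x v k r s * v r * v s

/-- The horizontal derivative `δ_j F = ∂F/∂x^j - N^m_j ∂F/∂v^m`, that is, the derivative in the
direction `∂_j` of `F` evaluated on a pointwise parallel extension of `v`. -/
def dHor (ℓ : E4 → E4 → ℝ) (F : E4 → E4 → ℝ) (x v : E4) (j : Fin 4) : ℝ :=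
  dPos F x v j - ∑ m, nonlinearConn ℓ x v m j * dDir F x v m

/-- The Christoffel symbols of the Levi-Civita--Chern anisotropic connection,
`Γ^i_jk = (1/2) g^il (δ_j g_lk + δ_k g_jl - δ_l g_jk)`: the solution of the Koszul formula of the
torsion-free, almost `g`-compatible anisotropic connection. One has `Γ^i_jk v^k = N^i_j`. -/
def christoffel (ℓ : E4 → E4 → ℝ) (x v : E4) (i j k : Fin 4) : ℝ :=
  (1 / 2) * ∑ l, (metric ℓ x v)⁻¹ i l *
    (dHor ℓ (fun y u => metric ℓ y u l k) x v j + dHor ℓ (fun y u => metric ℓ y u j l) x v k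
      - dHor ℓ (fun y u => metric ℓ y u j k) x v l)

/-- The Chern curvature tensor: `R_v(∂_k, ∂_l) ∂_j = chernCurvature ℓ x v i j k l • ∂_i`
(sum over `i`), with the convention `R(X,Y) = [∇_X, ∇_Y] - ∇_[X,Y]`. -/
def chernCurvature (ℓ : E4 → E4 → ℝ) (x v : E4) (i j k l : Fin 4) : ℝ :=
  dHor ℓ (fun y u => christoffel ℓ y u i l j) x v k
    - dHor ℓ (fun y u => christoffel ℓ y u i k j) x v l
    + ∑ m, (christoffel ℓ x v i k m * christoffel ℓ x v m l j
        - christoffel ℓ x v i l m * christoffel ℓ x v m k j)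

/-- The vector `R_v(X,Y)Z`. -/
def curvVec (ℓ : E4 → E4 → ℝ) (x v X Y Z : E4) : E4 :=
  WithLp.toLp 2 fun i => ∑ j, ∑ k, ∑ l, chernCurvature ℓ x v i j k l * Z j * X k * Y l

/-- Covariant derivative at time `s` of the vector field `X` along the curve `x`, with reference
vector field `V` along `x`:
`(D X)^i = dX^i/ds + Γ^i_jk(x,V) (dx^j/ds) X^k`. -/
def covDeriv (ℓ : E4 → E4 → ℝ) (x V X : ℝ → E4) (s : ℝ) : E4 :=
  WithLp.toLp 2 fun i => deriv X s i
    + ∑ j, ∑ k, christoffel ℓ (x s) (V s) i j k * deriv x s j * X s k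

end LocalFinsler

/-! ### Finsler spacetimes -/

section Manifold

variable {M : Type*} [TopologicalSpace M] [ChartedSpace E4 M]

/-- The velocity of a curve in `M`. -/
def velocity (γ : ℝ → M) (s : ℝ) : TangentSpace (𝓡 4) (γ s) :=
  mfderiv 𝓘(ℝ, ℝ) (𝓡 4) γ s (1 : ℝ)

variable (M) in
/-- A four-dimensional Finsler spacetime `(M, L)`, with cone domain `A`. -/
structure FinslerSpacetime [IsManifold (𝓡 4) ∞ M] where
  /-- the conic domain of timelike vectors -/
  A : Set (TangentBundle (𝓡 4) M)
  /-- The Finsler function; only its restriction to the closure of `A` in `TM ∖ 0` matters. -/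
  L : TangentBundle (𝓡 4) M → ℝ
  isOpen_A : IsOpen A
  isConnected_A : IsConnected A
  ne_zero : ∀ (p : M) (v : TangentSpace (𝓡 4) p), (⟨p, v⟩ : TangentBundle (𝓡 4) M) ∈ A → v ≠ 0
  conic : ∀ (p : M) (v : TangentSpace (𝓡 4) p), (⟨p, v⟩ : TangentBundle (𝓡 4) M) ∈ A →
    ∀ r : ℝ, 0 < r → (⟨p, r • v⟩ : TangentBundle (𝓡 4) M) ∈ A
  nonempty_fibre : ∀ p : M, ∃ v : TangentSpace (𝓡 4) p, (⟨p, v⟩ : TangentBundle (𝓡 4) M) ∈ A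
  /-- `L` is smooth on the closure of `A` in `TM ∖ 0`, as a function on a closed set: it is the
  restriction of a smooth function on an open neighbourhood. All derivatives of `L` at points of
  this closure are determined by `L` on `A`. -/
  smooth_L : ∃ O : Set (TangentBundle (𝓡 4) M), IsOpen O ∧ closure A ∩ {z | z.2 ≠ 0} ⊆ O ∧
    ContMDiffOn (𝓡 4).tangent 𝓘(ℝ, ℝ) ∞ L O
  nonneg : ∀ z ∈ closure A ∩ {z | z.2 ≠ 0}, 0 ≤ L z
  homogeneous : ∀ (p : M) (v : TangentSpace (𝓡 4) p),
    (⟨p, v⟩ : TangentBundle (𝓡 4) M) ∈ closure A ∩ {z | z.2 ≠ 0} →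
    ∀ r : ℝ, 0 < r → L ⟨p, r • v⟩ = r ^ 2 * L ⟨p, v⟩
  /-- the fundamental tensor has signature `(+,-,-,-)` -/
  signature : ∀ (p : M) (v : TangentSpace (𝓡 4) p),
    (⟨p, v⟩ : TangentBundle (𝓡 4) M) ∈ closure A ∩ {z | z.2 ≠ 0} →
    ∃ B : Module.Basis (Fin 4) ℝ (TangentSpace (𝓡 4) p), ∀ i j,
      fundTensor (fun u : TangentSpace (𝓡 4) p => L ⟨p, u⟩) v (B i) (B j)
        = if i = j then (if i = 0 then 1 else -1) else 0
  /-- The boundary of `A` in `TM ∖ 0` is the light cone `L⁻¹(0)`. It is then a smooth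
  hypersurface, because `dL(u) = 2 g_v(v,u)` on vertical vectors `u` and `g_v` is nondegenerate. -/
  boundary : (closure A ∩ {z | z.2 ≠ 0}) \ A = {z ∈ closure A ∩ {z | z.2 ≠ 0} | L z = 0}

namespace FinslerSpacetime

variable [IsManifold (𝓡 4) ∞ M] (S : FinslerSpacetime M)

/-- The closure of `A` in `TM ∖ 0`. -/
def Abar : Set (TangentBundle (𝓡 4) M) := closure S.A ∩ {z | z.2 ≠ 0}

/-- The fundamental tensor `g_v(u,w)` of the spacetime. -/
def g {p : M} (v u w : TangentSpace (𝓡 4) p) : ℝ :=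
  fundTensor (fun y : TangentSpace (𝓡 4) p => S.L ⟨p, y⟩) v u w

/-- The expression of `L` in the chart `e`. -/
def coordL (e : OpenPartialHomeomorph M E4) (x v : E4) : ℝ :=
  S.L ⟨e.symm x, mfderiv (𝓡 4) (𝓡 4) e.symm x v⟩

/-- The curve `γ` is an (admissible) geodesic at time `s`: its velocity lies in the closure of `A`
in `TM ∖ 0`, and the covariant derivative of `γ'` along `γ`, with reference `γ'`, vanishes at `s`
(as read in any chart). -/
def IsGeodesicAt (γ : ℝ → M) (s : ℝ) : Prop :=
  (⟨γ s, velocity γ s⟩ : TangentBundle (𝓡 4) M) ∈ S.Abar ∧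
  ∀ e ∈ IsManifold.maximalAtlas (𝓡 4) ∞ M, γ s ∈ e.source →
    LocalFinsler.covDeriv (S.coordL e) (fun r => e (γ r)) (deriv fun r => e (γ r))
      (deriv fun r => e (γ r)) s = 0

/-- `J` is a Jacobi field along `γ` on `I`: a smooth vector field along `γ` with
`J'' = - R_{γ'}(J, γ') γ'` (as read in any chart). -/
def IsJacobiField (γ : ℝ → M) (I : Set ℝ) (J : ∀ s, TangentSpace (𝓡 4) (γ s)) : Prop :=
  ContMDiffOn 𝓘(ℝ, ℝ) (𝓡 4).tangent ∞ (fun s => (⟨γ s, J s⟩ : TangentBundle (𝓡 4) M)) I ∧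
  ∀ e ∈ IsManifold.maximalAtlas (𝓡 4) ∞ M, ∀ s ∈ I, γ s ∈ e.source →
    LocalFinsler.covDeriv (S.coordL e) (fun r => e (γ r)) (deriv fun r => e (γ r))
      (LocalFinsler.covDeriv (S.coordL e) (fun r => e (γ r)) (deriv fun r => e (γ r))
        (fun r => mfderiv (𝓡 4) (𝓡 4) e (γ r) (J r))) s
    = - LocalFinsler.curvVec (S.coordL e) (e (γ s)) (deriv (fun r => e (γ r)) s)
        (mfderiv (𝓡 4) (𝓡 4) e (γ s) (J s)) (deriv (fun r => e (γ r)) s)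
        (deriv (fun r => e (γ r)) s)

/-- `α` is (near time `0`) a smooth curve in `P` which starts at `q` with velocity `u`. -/
def IsCurveIn (P : Set M) (q : M) (u : TangentSpace (𝓡 4) q) (α : ℝ → M) : Prop :=
  ContMDiffAt 𝓘(ℝ, ℝ) (𝓡 4) ∞ α 0 ∧ (∀ᶠ r in 𝓝 (0 : ℝ), α r ∈ P) ∧
  (⟨α 0, velocity α 0⟩ : TangentBundle (𝓡 4) M) = ⟨q, u⟩

/-- The tangent space at `q` of a submanifold `P` of `M`. -/
def tangentTo (P : Set M) (q : M) : Set (TangentSpace (𝓡 4) q) :=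
  {u | ∃ α : ℝ → M, IsCurveIn P q u α}

/-- `J` is a `P`-Jacobi field along `γ`, where `γ` starts at time `b` at a point of `P` with velocity
`ν (γ b)`, and `ν` is a normal vector field of `P`: `J` is a Jacobi field, `J(b)` is tangent to `P`,
and `J'(b)` and `∇^ν_{J(b)} ν` have the same tangential part. The latter says
`g_ν(J'(b), w) = g_ν(∇^ν_{J(b)} ν, w)` for all `w` tangent to `P`. -/
def IsSubmanifoldJacobiField (P : Set M) (ν : ∀ q : M, TangentSpace (𝓡 4) q) (γ : ℝ → M)
    (I : Set ℝ) (b : ℝ) (J : ∀ s, TangentSpace (𝓡 4) (γ s)) : Prop :=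
  S.IsJacobiField γ I J ∧ J b ∈ tangentTo P (γ b) ∧
  ∀ e ∈ IsManifold.maximalAtlas (𝓡 4) ∞ M, γ b ∈ e.source →
    ∀ α : ℝ → M, IsCurveIn P (γ b) (J b) α →
    ∀ w ∈ tangentTo P (γ b),
      fundTensor (S.coordL e (e (γ b))) (deriv (fun r => e (γ r)) b)
        (LocalFinsler.covDeriv (S.coordL e) (fun r => e (γ r)) (deriv fun r => e (γ r))
          (fun r => mfderiv (𝓡 4) (𝓡 4) e (γ r) (J r)) b)
        (mfderiv (𝓡 4) (𝓡 4) e (γ b) w)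
      = fundTensor (S.coordL e (e (γ b))) (deriv (fun r => e (γ r)) b)
        (LocalFinsler.covDeriv (S.coordL e) (fun r => e (α r))
          (fun r => mfderiv (𝓡 4) (𝓡 4) e (α r) (ν (α r)))
          (fun r => mfderiv (𝓡 4) (𝓡 4) e (α r) (ν (α r))) 0)
        (mfderiv (𝓡 4) (𝓡 4) e (γ b) w)

/-- `γ(t)` is a focal point of the submanifold `P` along `γ`: on `I` the curve `γ` is a geodesic,
it starts at time `b` in `P`, orthogonally to `P` and with velocity the value of the normal field
`ν`, and there is a nontrivial `P`-Jacobi field along it which vanishes at the time `t ≠ b`. -/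
def IsFocalPoint (P : Set M) (ν : ∀ q : M, TangentSpace (𝓡 4) q) (γ : ℝ → M)
    (I : Set ℝ) (b t : ℝ) : Prop :=
  (∀ s ∈ I, S.IsGeodesicAt γ s) ∧ γ b ∈ P ∧ velocity γ b = ν (γ b) ∧
  (∀ q ∈ P, ∀ w ∈ tangentTo P q, S.g (ν q) (ν q) w = 0) ∧ t ≠ b ∧
  ∃ J : ∀ s, TangentSpace (𝓡 4) (γ s),
    S.IsSubmanifoldJacobiField P ν γ I b J ∧ (∃ s ∈ I, J s ≠ 0) ∧ J t = 0

/-! ### Lightlike coordinates -/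

/-- The vector `∂_i` at the point of `M` with (possibly degenerate) coordinates `x`. -/
def coordVec (Φ : E4 → M) (x : E4) (i : Fin 4) : TangentSpace (𝓡 4) (Φ x) :=
  mfderiv (𝓡 4) (𝓡 4) Φ x (basisVec i)

/-- The components `g_ij(∂_0)`, i.e. `g_ij(N)` for `N = ∂_0`. -/
def gram (Φ : E4 → M) (x : E4) (i j : Fin 4) : ℝ :=
  S.g (coordVec Φ x 0) (coordVec Φ x i) (coordVec Φ x j)

/-- `Δ = (h_22 h_33 - h_23 h_32)^(1/2)`, with `h_ij = g_ij(N)`. -/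
def Delta (Φ : E4 → M) (x : E4) : ℝ :=
  Real.sqrt (!![S.gram Φ x 2 2, S.gram Φ x 2 3; S.gram Φ x 3 2, S.gram Φ x 3 3] :
    Matrix (Fin 2) (Fin 2) ℝ).det

/-- `φ` is a system of lightlike coordinates on its domain, for the lightlike gradient field
`N = ∇f`: in these coordinates `N = ∂_0` and the matrix `g_ij(N)` has first row `(0,1,0,0)`. The
block `h_ij`, `i,j = 2,3`, is then definite because of the signature of `g_N`. -/
structure IsLightlikeChart (f : M → ℝ) (N : ∀ q : M, TangentSpace (𝓡 4) q)
    (φ : OpenPartialHomeomorph M E4) : Prop where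
  mem_atlas : φ ∈ IsManifold.maximalAtlas (𝓡 4) ∞ M
  smooth_f : ContMDiffOn (𝓡 4) 𝓘(ℝ, ℝ) ∞ f φ.source
  admissible : ∀ q ∈ φ.source, (⟨q, N q⟩ : TangentBundle (𝓡 4) M) ∈ S.Abar
  lightlike : ∀ q ∈ φ.source, S.L ⟨q, N q⟩ = 0
  gradient : ∀ q ∈ φ.source, ∀ u : TangentSpace (𝓡 4) q,
    S.g (N q) (N q) u = mfderiv (𝓡 4) 𝓘(ℝ, ℝ) f q u
  N_eq : ∀ x ∈ φ.target, N (φ.symm x) = coordVec φ.symm x 0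
  gram_00 : ∀ x ∈ φ.target, S.gram φ.symm x 0 0 = 0
  gram_01 : ∀ x ∈ φ.target, S.gram φ.symm x 0 1 = 1
  gram_02 : ∀ x ∈ φ.target, S.gram φ.symm x 0 2 = 0
  gram_03 : ∀ x ∈ φ.target, S.gram φ.symm x 0 3 = 0

/-- The coordinate slice `Λ_{b,c}` of the chart `φ`. -/
def slice (φ : OpenPartialHomeomorph M E4) (b c : ℝ) : Set M :=
  {q ∈ φ.source | φ q 0 = b ∧ φ q 1 = c}

/-- The `x⁰`-coordinate line through `z`, parametrized by `x⁰`. -/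
def line (z : E4) (s : ℝ) : E4 := z + (s - z 0) • basisVec 0

/-- `Φ`, defined on the open set `W` of `ℝ⁴`, continues the coordinates `φ` along the integral
curves of `N = ∂_0`: it is smooth, it is the inverse of `φ` on the range of `φ`, and outside that
range the `x⁰`-lines are still geodesics. The coordinate vectors may become linearly dependent
outside the range of `φ`. The case `W = φ.target`, `Φ = φ.symm` is that of the coordinates `φ`
themselves. -/
structure IsContinuation (φ : OpenPartialHomeomorph M E4) (W : Set E4) (Φ : E4 → M) : Prop where
  isOpen : IsOpen W
  target_subset : φ.target ⊆ W
  smooth : ContMDiffOn (𝓡 4) (𝓡 4) ∞ Φ W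
  eq_symm : ∀ x ∈ φ.target, Φ x = φ.symm x
  geodesic : ∀ x ∈ W \ φ.target, S.IsGeodesicAt (fun s => Φ (line x s)) (x 0)

end FinslerSpacetime

end Manifold

end

noncomputable section

/-! The `x⁰`-lines are geodesics: inside the range of the coordinates because `N` is null and the
`g_N(N, ∂_i)` are constant, outside it by hypothesis (`exists_chart_geodesics`). Differentiating a
family of geodesics gives Jacobi fields, so `dΦ(w)` is one for every constant `w`, and so is `(s -
b) N`. Their combinations `dΦ(w) + c (s - b) N` are the fields `variationField`. If `w` is spanned
by the directions `2` and `3`, then at time `b` the derivative of such a field differs from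
`∇_{J(b)} N` by `c N`. This is orthogonal to the slice, so the field is a Jacobi field of the slice.

Conversely, let `J` be a Jacobi field of the slice with `J(t) = 0`, `t ≠ b`. Along any Jacobi field
`g_N(N, J)` is an affine function of time (`IsJacobiField.affine`). Here it vanishes at `b` and at
`t`, hence identically, so the difference `J'(b) - ∇_{J(b)} N` has no `∂_1` component. The
tangential condition makes this difference orthogonal to `∂_2` and `∂_3`; since `h` is nondegenerate
at time `b`, it is a multiple of `N`. Uniqueness for the Jacobi equation now shows that `J` is one
of the fields above (`IsSubmanifoldJacobiField.eq_variationField`).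

Thus `γ(t)` is a focal point exactly when `t ≠ b` and some nontrivial combination of `∂_2, ∂_3` is a
multiple of `N` at time `t`. The affine law applied to `∂_i` shows that the first row `(0,1,0,0)` of
the Gram matrix persists along `γ` (`gram_line`), so `∂_2, ∂_3` stay orthogonal to `N`. On the
orthogonal space of a null vector a Lorentzian form is semidefinite with kernel spanned by that
vector. So the degeneracy just described is the vanishing of `Δ` (`delta_eq_zero_iff`). The time `b`
itself is excluded because `Δ ≠ 0` on the range of the coordinates.

The analytic input is `jacobi_iff`: in a chart, the Jacobi equation written with the Chern curvature
is the linearization of the geodesic equation. It needs `Γ^i_jk v^k = N^i_j` and `(∂Γ^i_jk/∂v^m) v^j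
v^k = 0`. Both follow from homogeneity on the open cone and are carried to the lightlike boundary,
where `N` lies, by continuity. -/

lemma E4.sum_smul_basisVec (v : E4) : ∑ i, v i • basisVec i = v := by
  ext j
  simp [basisVec, Pi.single_apply]

lemma basisVec_apply (i j : Fin 4) : basisVec i j = if j = i then 1 else 0 := by
  simp [basisVec, PiLp.single_apply]

lemma map_eq_sum_basisVec {G : Type*} [AddCommGroup G] [Module ℝ G] (T : E4 →ₗ[ℝ] G) (v : E4) :
    T v = ∑ i, v i • T (basisVec i) := by
  conv_lhs => rw [← E4.sum_smul_basisVec v]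
  simp

/-- Regrouping `v + t u + s w` as `(v + s w) + t u` gives iterated directional derivatives, to which
the smooth calculus below applies. -/
lemma fundTensor_eq_lineDeriv {V : Type*} [AddCommGroup V] [Module ℝ V] (F : V → ℝ) (v u w : V) :
    fundTensor F v u w = (1 / 2) * lineDeriv ℝ (fun y => lineDeriv ℝ F y u) v w := by
  simp only [fundTensor, lineDeriv]
  simp only [add_right_comm]

lemma cartanTensor_eq_lineDeriv {V : Type*} [AddCommGroup V] [Module ℝ V] (F : V → ℝ)
    (v u w z : V) : cartanTensor F v u w z =
      (1 / 4) * lineDeriv ℝ (fun x => lineDeriv ℝ (fun y => lineDeriv ℝ F y u) x w) v z := by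
  simp only [cartanTensor, lineDeriv]
  congr 3
  ext r
  congr 1
  ext s
  congr 1
  ext t
  congr 1
  abel

/-! ### Calculus of functions of position and direction -/

namespace LocalFinsler

/-- Smoothness of a function of position and direction on a set. -/
abbrev SmoothOn (U : Set (E4 × E4)) (F : E4 → E4 → ℝ) : Prop :=
  ContDiffOn ℝ ∞ (Function.uncurry F) U

variable {U : Set (E4 × E4)} {F G : E4 → E4 → ℝ} {x v : E4}

lemma SmoothOn.differentiableAt (hF : SmoothOn U F) (hU : IsOpen U) (h : (x, v) ∈ U) :
    DifferentiableAt ℝ (Function.uncurry F) (x, v) :=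
  (hF.contDiffAt (hU.mem_nhds h)).differentiableAt (by simp)

lemma SmoothOn.lineDeriv_pos (hF : SmoothOn U F) (hU : IsOpen U) (h : (x, v) ∈ U) (w : E4) :
    HasLineDerivAt ℝ (fun y => F y v) (fderiv ℝ (Function.uncurry F) (x, v) (w, 0)) x w := by
  have h1 := (hF.differentiableAt hU h).hasFDerivAt
  have h2 : HasFDerivAt (fun y : E4 => (y, v)) (ContinuousLinearMap.inl ℝ E4 E4) x :=
    (hasFDerivAt_id x).prodMk (hasFDerivAt_const v x)
  exact (h1.comp x h2).hasLineDerivAt w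

lemma SmoothOn.lineDeriv_dir (hF : SmoothOn U F) (hU : IsOpen U) (h : (x, v) ∈ U) (w : E4) :
    HasLineDerivAt ℝ (fun y => F x y) (fderiv ℝ (Function.uncurry F) (x, v) (0, w)) v w := by
  have h1 := (hF.differentiableAt hU h).hasFDerivAt
  have h2 : HasFDerivAt (fun y : E4 => (x, y)) (ContinuousLinearMap.inr ℝ E4 E4) v :=
    (hasFDerivAt_const x v).prodMk (hasFDerivAt_id v)
  exact (h1.comp v h2).hasLineDerivAt w

lemma SmoothOn.dPos_eq (hF : SmoothOn U F) (hU : IsOpen U) (h : (x, v) ∈ U) (j : Fin 4) :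
    dPos F x v j = fderiv ℝ (Function.uncurry F) (x, v) (basisVec j, 0) :=
  (hF.lineDeriv_pos hU h _).lineDeriv

lemma SmoothOn.dDir_eq (hF : SmoothOn U F) (hU : IsOpen U) (h : (x, v) ∈ U) (j : Fin 4) :
    dDir F x v j = fderiv ℝ (Function.uncurry F) (x, v) (0, basisVec j) :=
  (hF.lineDeriv_dir hU h _).lineDeriv

lemma SmoothOn.fderiv_apply (hF : SmoothOn U F) (hU : IsOpen U) (h : (x, v) ∈ U) (X Y : E4) :
    fderiv ℝ (Function.uncurry F) (x, v) (X, Y) =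
      ∑ m, dPos F x v m * X m + ∑ m, dDir F x v m * Y m := by
  have h1 : ((X, Y) : E4 × E4) = ContinuousLinearMap.inl ℝ E4 E4 X
      + ContinuousLinearMap.inr ℝ E4 E4 Y := by simp
  set T := fderiv ℝ (Function.uncurry F) (x, v) with hT
  have hX := map_eq_sum_basisVec (T.comp (ContinuousLinearMap.inl ℝ E4 E4)).toLinearMap X
  have hY := map_eq_sum_basisVec (T.comp (ContinuousLinearMap.inr ℝ E4 E4)).toLinearMap Y
  simp only [ContinuousLinearMap.coe_coe, ContinuousLinearMap.comp_apply,
    ContinuousLinearMap.inl_apply, ContinuousLinearMap.inr_apply, smul_eq_mul] at hX hY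
  rw [h1, map_add, ContinuousLinearMap.inl_apply, ContinuousLinearMap.inr_apply, hX, hY]
  simp only [hF.dPos_eq hU h, hF.dDir_eq hU h, ← hT, mul_comm]

lemma SmoothOn.fderiv_clm (hF : SmoothOn U F) (hU : IsOpen U) (w : E4 × E4) :
    ContDiffOn ℝ ∞ (fun p => fderiv ℝ (Function.uncurry F) p w) U :=
  (hF.fderiv_of_isOpen hU (m := ∞) (by simp)).clm_apply contDiffOn_const

lemma SmoothOn.dPos (hF : SmoothOn U F) (hU : IsOpen U) (j : Fin 4) :
    SmoothOn U (fun x v => dPos F x v j) :=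
  (hF.fderiv_clm hU (basisVec j, 0)).congr fun p hp => hF.dPos_eq hU (x := p.1) (v := p.2) hp j

lemma SmoothOn.dDir (hF : SmoothOn U F) (hU : IsOpen U) (j : Fin 4) :
    SmoothOn U (fun x v => dDir F x v j) :=
  (hF.fderiv_clm hU (0, basisVec j)).congr fun p hp => hF.dDir_eq hU (x := p.1) (v := p.2) hp j

lemma SmoothOn.fderiv_fderiv_comm (hF : SmoothOn U F) (hU : IsOpen U) (h : (x, v) ∈ U)
    (a b : E4 × E4) :
    fderiv ℝ (fun p => fderiv ℝ (Function.uncurry F) p a) (x, v) b =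
      fderiv ℝ (fun p => fderiv ℝ (Function.uncurry F) p b) (x, v) a := by
  have hc := hF.contDiffAt (hU.mem_nhds h)
  have h1 : DifferentiableAt ℝ (fderiv ℝ (Function.uncurry F)) (x, v) :=
    (hc.fderiv_right (m := 1) (by norm_cast)).differentiableAt (by simp)
  have hs : IsSymmSndFDerivAt ℝ (Function.uncurry F) (x, v) :=
    hc.isSymmSndFDerivAt (by simp; norm_cast)
  have key : ∀ c d : E4 × E4, fderiv ℝ (fun p => fderiv ℝ (Function.uncurry F) p c) (x, v) d =
      fderiv ℝ (fderiv ℝ (Function.uncurry F)) (x, v) d c := by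
    intro c d
    rw [fderiv_clm_apply h1 (by fun_prop)]
    simp
  rw [key, key, hs.eq]

lemma SmoothOn.dPos_congr (hU : IsOpen U) (h : (x, v) ∈ U)
    (hFG : ∀ y u, (y, u) ∈ U → F y u = G y u) (j : Fin 4) :
    LocalFinsler.dPos F x v j = LocalFinsler.dPos G x v j := by
  refine Filter.EventuallyEq.lineDeriv_eq ?_
  have : Filter.Tendsto (fun y => (y, v)) (𝓝 x) (𝓝 (x, v)) :=
    (Continuous.prodMk_left v).tendsto x
  filter_upwards [this (hU.mem_nhds h)] with y hy using hFG y v hy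

lemma SmoothOn.dDir_congr (hU : IsOpen U) (h : (x, v) ∈ U)
    (hFG : ∀ y u, (y, u) ∈ U → F y u = G y u) (j : Fin 4) :
    LocalFinsler.dDir F x v j = LocalFinsler.dDir G x v j := by
  refine Filter.EventuallyEq.lineDeriv_eq ?_
  have : Filter.Tendsto (fun y => (x, y)) (𝓝 v) (𝓝 (x, v)) :=
    (Continuous.prodMk_right x).tendsto v
  filter_upwards [this (hU.mem_nhds h)] with y hy using hFG x y hy

lemma SmoothOn.dDir_dDir_comm (hF : SmoothOn U F) (hU : IsOpen U) (h : (x, v) ∈ U)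
    (i j : Fin 4) :
    LocalFinsler.dDir (fun y u => LocalFinsler.dDir F y u i) x v j =
      LocalFinsler.dDir (fun y u => LocalFinsler.dDir F y u j) x v i := by
  rw [(hF.dDir hU i).dDir_eq hU h, (hF.dDir hU j).dDir_eq hU h]
  have key : ∀ i, Function.uncurry (fun y u => LocalFinsler.dDir F y u i) =ᶠ[𝓝 (x, v)]
      fun p => fderiv ℝ (Function.uncurry F) p (0, basisVec i) := fun i => by
    filter_upwards [hU.mem_nhds h] with p hp using hF.dDir_eq hU (x := p.1) (v := p.2) hp i
  rw [(key i).fderiv_eq, (key j).fderiv_eq, hF.fderiv_fderiv_comm hU h]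

lemma SmoothOn.dDir_dPos_comm (hF : SmoothOn U F) (hU : IsOpen U) (h : (x, v) ∈ U)
    (i j : Fin 4) :
    LocalFinsler.dDir (fun y u => LocalFinsler.dPos F y u i) x v j =
      LocalFinsler.dPos (fun y u => LocalFinsler.dDir F y u j) x v i := by
  rw [(hF.dPos hU i).dDir_eq hU h, (hF.dDir hU j).dPos_eq hU h]
  have key : ∀ i, Function.uncurry (fun y u => LocalFinsler.dDir F y u i) =ᶠ[𝓝 (x, v)]
      fun p => fderiv ℝ (Function.uncurry F) p (0, basisVec i) := fun i => by
    filter_upwards [hU.mem_nhds h] with p hp using hF.dDir_eq hU (x := p.1) (v := p.2) hp i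
  have key' : Function.uncurry (fun y u => LocalFinsler.dPos F y u i) =ᶠ[𝓝 (x, v)]
      fun p => fderiv ℝ (Function.uncurry F) p (basisVec i, 0) := by
    filter_upwards [hU.mem_nhds h] with p hp using hF.dPos_eq hU (x := p.1) (v := p.2) hp i
  rw [key'.fderiv_eq, (key j).fderiv_eq, hF.fderiv_fderiv_comm hU h]

/-- Chain rule along a curve of positions and directions. -/
lemma SmoothOn.hasDerivAt_comp (hF : SmoothOn U F) (hU : IsOpen U) {y u : ℝ → E4} {s : ℝ}
    {y' u' : E4} (h : (y s, u s) ∈ U) (hy : HasDerivAt y y' s) (hu : HasDerivAt u u' s) :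
    HasDerivAt (fun r => F (y r) (u r))
      (∑ m, LocalFinsler.dPos F (y s) (u s) m * y' m
        + ∑ m, LocalFinsler.dDir F (y s) (u s) m * u' m) s := by
  rw [← hF.fderiv_apply hU h]
  exact (hF.differentiableAt hU h).hasFDerivAt.comp_hasDerivAt s (hy.prodMk hu)

section Rules

lemma SmoothOn.hasDerivAt_dDir (hF : SmoothOn U F) (hU : IsOpen U) (h : (x, v) ∈ U) (j : Fin 4) :
    HasDerivAt (fun t : ℝ => F x (v + t • basisVec j)) (LocalFinsler.dDir F x v j) 0 := by
  rw [hF.dDir_eq hU h]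
  exact hF.lineDeriv_dir hU h (basisVec j)

lemma SmoothOn.hasDerivAt_dPos (hF : SmoothOn U F) (hU : IsOpen U) (h : (x, v) ∈ U) (j : Fin 4) :
    HasDerivAt (fun t : ℝ => F (x + t • basisVec j) v) (LocalFinsler.dPos F x v j) 0 := by
  rw [hF.dPos_eq hU h]
  exact hF.lineDeriv_pos hU h (basisVec j)

lemma dDir_eq_of_hasDerivAt {c : ℝ} {j : Fin 4}
    (h : HasDerivAt (fun t : ℝ => F x (v + t • basisVec j)) c 0) :
    LocalFinsler.dDir F x v j = c := h.deriv

lemma hasDerivAt_coord (v : E4) (k j : Fin 4) :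
    HasDerivAt (fun t : ℝ => (v + t • basisVec j) k) (if k = j then 1 else 0) 0 := by
  have : HasDerivAt (fun t : ℝ => v k + t * basisVec j k) (1 * basisVec j k) 0 :=
    ((hasDerivAt_id (0 : ℝ)).mul_const _).const_add _
  simpa [basisVec_apply] using this

end Rules

lemma SmoothOn.coord (U : Set (E4 × E4)) (k : Fin 4) : SmoothOn U (fun _ v => v k) := by
  have : ContDiff ℝ ∞ (fun p : E4 × E4 => p.2 k) :=
    (EuclideanSpace.proj k : E4 →L[ℝ] ℝ).contDiff.comp contDiff_snd
  exact this.contDiffOn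

/-- A smooth function which vanishes on an open set `A` vanishes with its derivatives on the
closure of `A` relative to its domain. -/
lemma SmoothOn.eq_zero_of_closure {A : Set (E4 × E4)} (hF : SmoothOn U F) (hU : IsOpen U)
    (h0 : ∀ y u, (y, u) ∈ A → F y u = 0) (h : (x, v) ∈ U ∩ closure A) : F x v = 0 := by
  have hc : ContinuousAt (Function.uncurry F) (x, v) :=
    (hF.contDiffAt (hU.mem_nhds h.1)).continuousAt
  have hfreq : ∃ᶠ p in 𝓝 (x, v), Function.uncurry F p ∈ ({0} : Set ℝ) :=
    (mem_closure_iff_frequently.1 h.2).mono fun p hp => h0 p.1 p.2 hp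
  have := isClosed_singleton.mem_of_frequently_of_tendsto hfreq hc.tendsto
  exact this

/-- The derivative vanishes on the open set `A` and is continuous on `U`, so it vanishes at limit
points of `A` as well, even in directions `w` that leave the closure. This is needed at lightlike
vectors, which are boundary points of the cone. -/
lemma SmoothOn.fderiv_eq_zero_of_closure {A : Set (E4 × E4)} (hF : SmoothOn U F) (hU : IsOpen U)
    (hA : IsOpen A) (h0 : ∀ y u, (y, u) ∈ A → F y u = 0) (h : (x, v) ∈ U ∩ closure A)
    (w : E4 × E4) : fderiv ℝ (Function.uncurry F) (x, v) w = 0 := by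
  have hF' : SmoothOn U (fun y u => fderiv ℝ (Function.uncurry F) (y, u) w) := hF.fderiv_clm hU w
  refine hF'.eq_zero_of_closure hU (A := A) (fun y u hyu => ?_) h
  have : Function.uncurry F =ᶠ[𝓝 (y, u)] fun _ => 0 := by
    filter_upwards [hA.mem_nhds hyu] with p hp using h0 p.1 p.2 hp
  rw [this.fderiv_eq]
  simp

end LocalFinsler

namespace LocalFinsler

section Rules

variable {U : Set (E4 × E4)} {F G : E4 → E4 → ℝ} {x v : E4}

lemma SmoothOn.mul (hF : SmoothOn U F) (hG : SmoothOn U G) :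
    SmoothOn U (fun x v => F x v * G x v) := ContDiffOn.mul hF hG

lemma SmoothOn.add (hF : SmoothOn U F) (hG : SmoothOn U G) :
    SmoothOn U (fun x v => F x v + G x v) := ContDiffOn.add hF hG

lemma SmoothOn.sub (hF : SmoothOn U F) (hG : SmoothOn U G) :
    SmoothOn U (fun x v => F x v - G x v) := ContDiffOn.sub hF hG

lemma SmoothOn.const_mul (c : ℝ) (hF : SmoothOn U F) :
    SmoothOn U (fun x v => c * F x v) := ContDiffOn.mul contDiffOn_const hF

lemma SmoothOn.sum {ι : Type*} (s : Finset ι) {F : ι → E4 → E4 → ℝ}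
    (hF : ∀ i, SmoothOn U (F i)) : SmoothOn U (fun x v => ∑ i ∈ s, F i x v) :=
  ContDiffOn.sum fun i _ => hF i

lemma dDir_const_mul (c : ℝ) (F : E4 → E4 → ℝ) (x v : E4) (m : Fin 4) :
    dDir (fun y u => c * F y u) x v m = c * dDir F x v m :=
  deriv_const_mul_field _

lemma dPos_const_mul (c : ℝ) (F : E4 → E4 → ℝ) (x v : E4) (m : Fin 4) :
    dPos (fun y u => c * F y u) x v m = c * dPos F x v m :=
  deriv_const_mul_field _

lemma dDir_sub (hU : IsOpen U) (h : (x, v) ∈ U) (hF : SmoothOn U F) (hG : SmoothOn U G)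
    (m : Fin 4) : dDir (fun y u => F y u - G y u) x v m = dDir F x v m - dDir G x v m :=
  dDir_eq_of_hasDerivAt ((hF.hasDerivAt_dDir hU h m).sub (hG.hasDerivAt_dDir hU h m))

lemma dDir_mul (hU : IsOpen U) (h : (x, v) ∈ U) (hF : SmoothOn U F) (hG : SmoothOn U G)
    (m : Fin 4) : dDir (fun y u => F y u * G y u) x v m
      = dDir F x v m * G x v + F x v * dDir G x v m := by
  have := dDir_eq_of_hasDerivAt (F := fun y u => F y u * G y u)
    ((hF.hasDerivAt_dDir hU h m).mul (hG.hasDerivAt_dDir hU h m))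
  simpa using this

lemma dDir_sum (hU : IsOpen U) (h : (x, v) ∈ U) {F : Fin 4 → E4 → E4 → ℝ}
    (hF : ∀ i, SmoothOn U (F i)) (m : Fin 4) :
    dDir (fun y u => ∑ i, F i y u) x v m = ∑ i, dDir (F i) x v m :=
  dDir_eq_of_hasDerivAt (HasDerivAt.fun_sum fun i _ => (hF i).hasDerivAt_dDir hU h m)

lemma dDir_coord (x v : E4) (k m : Fin 4) :
    dDir (fun _ u => u k) x v m = if k = m then 1 else 0 :=
  dDir_eq_of_hasDerivAt (hasDerivAt_coord v k m)

lemma dDir_sum_mul_coord (hU : IsOpen U) (h : (x, v) ∈ U) {F : Fin 4 → E4 → E4 → ℝ}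
    (hF : ∀ i, SmoothOn U (F i)) (m : Fin 4) :
    dDir (fun y u => ∑ i, F i y u * u i) x v m
      = ∑ i, dDir (F i) x v m * v i + F m x v := by
  rw [dDir_sum hU h fun i => (hF i).mul (SmoothOn.coord U i)]
  simp only [dDir_mul hU h (hF _) (SmoothOn.coord U _), dDir_coord, Finset.sum_add_distrib]
  simp

lemma dPos_sum_mul_coord (hU : IsOpen U) (h : (x, v) ∈ U) {F : Fin 4 → E4 → E4 → ℝ}
    (hF : ∀ i, SmoothOn U (F i)) (m : Fin 4) :
    dPos (fun y u => ∑ i, F i y u * u i) x v m = ∑ i, dPos (F i) x v m * v i :=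
  HasDerivAt.deriv (HasDerivAt.fun_sum fun i _ => ((hF i).hasDerivAt_dPos hU h m).mul_const (v i))

end Rules

/-! ### Fundamental tensor, connection and homogeneity identities in a chart -/

lemma metric_eq (ℓ : E4 → E4 → ℝ) (x v : E4) (i j : Fin 4) :
    metric ℓ x v i j = (1 / 2) * dDir (fun y u => dDir ℓ y u i) x v j :=
  fundTensor_eq_lineDeriv _ _ _ _

lemma cartan_eq (ℓ : E4 → E4 → ℝ) (x v : E4) (i j k : Fin 4) :
    cartan ℓ x v i j k = (1 / 2) * dDir (fun y u => metric ℓ y u i j) x v k := by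
  have h1 : cartan ℓ x v i j k = (1 / 4) * dDir (fun z w => dDir (fun y u => dDir ℓ y u i) z w j)
      x v k := cartanTensor_eq_lineDeriv _ _ _ _ _
  simp only [h1, metric_eq, dDir_const_mul]
  ring

/-- A Finsler function `ℓ` read in a chart: it is smooth with nondegenerate fundamental tensor on
the open set `U`, and positively homogeneous of degree two on the open set `A ⊆ U`. -/
structure IsChartFinsler (ℓ : E4 → E4 → ℝ) (U A : Set (E4 × E4)) : Prop where
  isOpen_dom : IsOpen U
  isOpen_cone : IsOpen A
  subset : A ⊆ U
  smooth : SmoothOn U ℓ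
  nondeg : ∀ x v, (x, v) ∈ U → (metric ℓ x v).det ≠ 0
  homogeneous : ∀ x v, (x, v) ∈ A → ∀ r : ℝ, 0 < r → ℓ x (r • v) = r ^ 2 * ℓ x v

namespace IsChartFinsler

variable {ℓ : E4 → E4 → ℝ} {U A : Set (E4 × E4)} {x v : E4}

lemma smooth_metric (H : IsChartFinsler ℓ U A) (i j : Fin 4) :
    SmoothOn U (fun x v => metric ℓ x v i j) := by
  simp only [metric_eq]
  exact ((H.smooth.dDir H.isOpen_dom i).dDir H.isOpen_dom j).const_mul _

lemma metric_symm (H : IsChartFinsler ℓ U A) (h : (x, v) ∈ U) (i j : Fin 4) :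
    metric ℓ x v i j = metric ℓ x v j i := by
  rw [metric_eq, metric_eq, H.smooth.dDir_dDir_comm H.isOpen_dom h]

lemma smooth_det {ι : Type*} [Fintype ι] [DecidableEq ι] {B : E4 → E4 → Matrix ι ι ℝ}
    (hB : ∀ i j, SmoothOn U (fun x v => B x v i j)) : SmoothOn U (fun x v => (B x v).det) := by
  simp only [Matrix.det_apply']
  exact SmoothOn.sum _ fun σ => SmoothOn.const_mul _ (contDiffOn_prod fun i _ => hB _ _)

/-- Cramer's rule: the adjugate is polynomial in the entries, and the determinant has no zero on
`U`. -/
lemma smooth_inv (H : IsChartFinsler ℓ U A) (i j : Fin 4) :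
    SmoothOn U (fun x v => (metric ℓ x v)⁻¹ i j) := by
  have h1 : SmoothOn U (fun x v => (metric ℓ x v).det⁻¹) :=
    ContDiffOn.inv (smooth_det H.smooth_metric) fun p hp => H.nondeg p.1 p.2 hp
  have h2 : SmoothOn U (fun x v => (metric ℓ x v).adjugate i j) := by
    simp only [Matrix.adjugate_apply]
    refine smooth_det fun a b => ?_
    simp only [Matrix.updateRow_apply]
    split_ifs
    · exact contDiffOn_const
    · exact H.smooth_metric a b
  have h3 := h1.mul h2
  simpa [Matrix.inv_def, Ring.inverse_eq_inv'] using h3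

lemma mul_inv_apply (H : IsChartFinsler ℓ U A) (h : (x, v) ∈ U) (l : Fin 4) (q : Fin 4 → ℝ) :
    ∑ i, metric ℓ x v l i * ∑ k, (metric ℓ x v)⁻¹ i k * q k = q l := by
  have h1 : metric ℓ x v * (metric ℓ x v)⁻¹ = 1 :=
    Matrix.mul_nonsing_inv _ (isUnit_iff_ne_zero.2 (H.nondeg x v h))
  have h2 := congrFun (Matrix.mulVec_mulVec q (metric ℓ x v) (metric ℓ x v)⁻¹) l
  rw [h1, Matrix.one_mulVec] at h2
  simpa [Matrix.mulVec, dotProduct] using h2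

lemma eq_zero_of_metric_mul (H : IsChartFinsler ℓ U A) (h : (x, v) ∈ U) {q : Fin 4 → ℝ}
    (hq : ∀ l, ∑ i, metric ℓ x v l i * q i = 0) : q = 0 :=
  Matrix.eq_zero_of_mulVec_eq_zero (H.nondeg x v h) (funext hq)

lemma smooth_formalChristoffel (H : IsChartFinsler ℓ U A) (i j k : Fin 4) :
    SmoothOn U (fun x v => formalChristoffel ℓ x v i j k) :=
  SmoothOn.const_mul _ (SmoothOn.sum _ fun l => (H.smooth_inv i l).mul
    ((((H.smooth_metric l k).dPos H.isOpen_dom j).add ((H.smooth_metric j l).dPos H.isOpen_dom k)).sub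
      ((H.smooth_metric j k).dPos H.isOpen_dom l)))

lemma smooth_nonlinearConn (H : IsChartFinsler ℓ U A) (i j : Fin 4) :
    SmoothOn U (fun x v => nonlinearConn ℓ x v i j) := by
  refine SmoothOn.sub (SmoothOn.sum _ fun k =>
    (H.smooth_formalChristoffel i j k).mul (SmoothOn.coord U k)) (SmoothOn.sum _ fun l =>
    SmoothOn.sum _ fun k => SmoothOn.sum _ fun r => SmoothOn.sum _ fun s => ?_)
  simp only [cartan_eq]
  exact ((((H.smooth_inv i l).mul
    (((H.smooth_metric l j).dDir H.isOpen_dom k).const_mul _)).mul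
    (H.smooth_formalChristoffel k r s)).mul (SmoothOn.coord U r)).mul (SmoothOn.coord U s)

lemma smooth_dHor (H : IsChartFinsler ℓ U A) {F : E4 → E4 → ℝ} (hF : SmoothOn U F) (j : Fin 4) :
    SmoothOn U (fun x v => dHor ℓ F x v j) :=
  (hF.dPos H.isOpen_dom j).sub (SmoothOn.sum _ fun m =>
    (H.smooth_nonlinearConn m j).mul (hF.dDir H.isOpen_dom m))

lemma smooth_christoffel (H : IsChartFinsler ℓ U A) (i j k : Fin 4) :
    SmoothOn U (fun x v => christoffel ℓ x v i j k) :=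
  SmoothOn.const_mul _ (SmoothOn.sum _ fun l => (H.smooth_inv i l).mul
    (((H.smooth_dHor (H.smooth_metric l k) j).add (H.smooth_dHor (H.smooth_metric j l) k)).sub
      (H.smooth_dHor (H.smooth_metric j k) l)))

lemma dHor_metric_symm (H : IsChartFinsler ℓ U A) (h : (x, v) ∈ U) (i j m : Fin 4) :
    dHor ℓ (fun y u => metric ℓ y u i j) x v m = dHor ℓ (fun y u => metric ℓ y u j i) x v m := by
  simp only [dHor]
  rw [SmoothOn.dPos_congr H.isOpen_dom h fun y u hyu => H.metric_symm hyu i j]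
  congr 1
  refine Finset.sum_congr rfl fun k _ => ?_
  rw [SmoothOn.dDir_congr H.isOpen_dom h fun y u hyu => H.metric_symm hyu i j]

lemma christoffel_symm (H : IsChartFinsler ℓ U A) (h : (x, v) ∈ U) (i j k : Fin 4) :
    christoffel ℓ x v i j k = christoffel ℓ x v i k j := by
  simp only [christoffel]
  congr 1
  refine Finset.sum_congr rfl fun l _ => ?_
  rw [H.dHor_metric_symm h l k, H.dHor_metric_symm h j l, H.dHor_metric_symm h j k]
  ring

section Cone

/-! ### Identities on the cone of homogeneity -/

/-- Differentiate `ℓ(x, r v) = r² ℓ(x, v)` at `r = 1`. -/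
lemma euler (H : IsChartFinsler ℓ U A) (h : (x, v) ∈ A) :
    ∑ k, dDir ℓ x v k * v k = 2 * ℓ x v := by
  have hU := H.subset h
  have h1 : HasDerivAt (fun r : ℝ => ℓ x (r • v))
      (∑ m, dPos ℓ x ((1 : ℝ) • v) m * (0 : E4) m + ∑ m, dDir ℓ x ((1 : ℝ) • v) m * v m) 1 := by
    refine H.smooth.hasDerivAt_comp H.isOpen_dom (y := fun _ => x) (u := fun r : ℝ => r • v)
      (by simpa using hU) (hasDerivAt_const _ _) ?_
    simpa using (hasDerivAt_id (1 : ℝ)).smul_const v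
  have h2 : HasDerivAt (fun r : ℝ => ℓ x (r • v)) (2 * ℓ x v) 1 := by
    have h3 : HasDerivAt (fun r : ℝ => r ^ 2 * ℓ x v) (2 * ℓ x v) 1 := by
      simpa using (hasDerivAt_pow 2 (1 : ℝ)).mul_const (ℓ x v)
    refine h3.congr_of_eventuallyEq ?_
    filter_upwards [lt_mem_nhds (zero_lt_one (α := ℝ))] with r hr using H.homogeneous x v h r hr
  simpa using h1.unique h2

/-- Differentiating Euler's relation in `vⁱ` gives `2 ∂ℓ/∂vⁱ` on the right; the product rule cancels
one of the two copies. -/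
lemma euler_dDir (H : IsChartFinsler ℓ U A) (h : (x, v) ∈ A) (i : Fin 4) :
    ∑ k, dDir (fun y u => dDir ℓ y u i) x v k * v k = dDir ℓ x v i := by
  have hU := H.subset h
  have h1 := SmoothOn.dDir_congr H.isOpen_cone h (fun y u hyu => H.euler hyu) i
  rw [dDir_sum_mul_coord H.isOpen_dom hU (H.smooth.dDir H.isOpen_dom), dDir_const_mul] at h1
  simp only [H.smooth.dDir_dDir_comm H.isOpen_dom hU _ i] at h1
  linarith

lemma metric_mul_self (H : IsChartFinsler ℓ U A) (h : (x, v) ∈ A) (l : Fin 4) :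
    ∑ k, metric ℓ x v l k * v k = (1 / 2) * dDir ℓ x v l := by
  simp only [metric_eq, mul_assoc, ← Finset.mul_sum, H.euler_dDir h]

lemma dPos_metric_mul_self (H : IsChartFinsler ℓ U A) (h : (x, v) ∈ A) (l j : Fin 4) :
    ∑ k, dPos (fun y u => metric ℓ y u l k) x v j * v k
      = (1 / 2) * dPos (fun y u => dDir ℓ y u l) x v j := by
  rw [← dPos_sum_mul_coord H.isOpen_dom (H.subset h) (H.smooth_metric l), ← dPos_const_mul]
  exact SmoothOn.dPos_congr H.isOpen_cone h (fun y u hyu => H.metric_mul_self hyu l) j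

lemma dPos_euler (H : IsChartFinsler ℓ U A) (h : (x, v) ∈ A) (l : Fin 4) :
    ∑ k, dPos (fun y u => dDir ℓ y u k) x v l * v k = 2 * dPos ℓ x v l := by
  rw [← dPos_sum_mul_coord H.isOpen_dom (H.subset h) (H.smooth.dDir H.isOpen_dom),
    ← dPos_const_mul]
  exact SmoothOn.dPos_congr H.isOpen_cone h (fun y u hyu => H.euler hyu) l

/-- Differentiating `g_lk v^k = (1/2) ∂ℓ/∂v^l` produces `g_lm` on both sides, so the Cartan tensor
annihilates the reference direction. The simplifications of the connection below rest on this. -/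
lemma dDir_metric_mul_self (H : IsChartFinsler ℓ U A) (h : (x, v) ∈ A) (l m : Fin 4) :
    ∑ k, dDir (fun y u => metric ℓ y u l k) x v m * v k = 0 := by
  have h1 := SmoothOn.dDir_congr H.isOpen_cone h (fun y u hyu => H.metric_mul_self hyu l) m
  rw [dDir_sum_mul_coord H.isOpen_dom (H.subset h) (H.smooth_metric l), dDir_const_mul,
    metric_eq] at h1
  linarith

lemma dDir_metric_symm (H : IsChartFinsler ℓ U A) (h : (x, v) ∈ U) (l k m : Fin 4) :
    dDir (fun y u => metric ℓ y u l k) x v m = dDir (fun y u => metric ℓ y u k l) x v m :=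
  SmoothOn.dDir_congr H.isOpen_dom h (fun _ _ hyu => H.metric_symm hyu l k) m

/-- Up to a factor these are third derivatives of `ℓ` in the direction, which are symmetric in all
indices. -/
lemma dDir_metric_comm (H : IsChartFinsler ℓ U A) (h : (x, v) ∈ U) (l k m : Fin 4) :
    dDir (fun y u => metric ℓ y u l k) x v m = dDir (fun y u => metric ℓ y u l m) x v k := by
  simp only [metric_eq, dDir_const_mul]
  rw [(H.smooth.dDir H.isOpen_dom l).dDir_dDir_comm H.isOpen_dom h]

end Cone

end IsChartFinsler

/-- The lowered formal Christoffel symbols. -/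
def lowChristoffel (ℓ : E4 → E4 → ℝ) (x v : E4) (l j k : Fin 4) : ℝ :=
  (1 / 2) * (dPos (fun y u => metric ℓ y u l k) x v j + dPos (fun y u => metric ℓ y u j l) x v k
      - dPos (fun y u => metric ℓ y u j k) x v l)

lemma formalChristoffel_eq (ℓ : E4 → E4 → ℝ) (x v : E4) (i j k : Fin 4) :
    formalChristoffel ℓ x v i j k = ∑ l, (metric ℓ x v)⁻¹ i l * lowChristoffel ℓ x v l j k := by
  simp only [formalChristoffel, lowChristoffel, Finset.mul_sum]
  exact Finset.sum_congr rfl fun l _ => by ring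

/-- The quadratic expression `Γ^i_jk v^j v^k`; geodesics satisfy `x'' + spray = 0`. -/
def spray (ℓ : E4 → E4 → ℝ) (x v : E4) (i : Fin 4) : ℝ :=
  ∑ j, ∑ k, christoffel ℓ x v i j k * v j * v k

/-- The quadratic expression in the formal Christoffel symbols. -/
def formalSpray (ℓ : E4 → E4 → ℝ) (x v : E4) (i : Fin 4) : ℝ :=
  ∑ j, ∑ k, formalChristoffel ℓ x v i j k * v j * v k

/-- With the inverse metric factored out, lowering the index leaves only the bracket; later
identities are compared in this lowered form. -/
lemma nonlinearConn_eq (ℓ : E4 → E4 → ℝ) (x v : E4) (i j : Fin 4) :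
    nonlinearConn ℓ x v i j = ∑ l, (metric ℓ x v)⁻¹ i l * (∑ k, lowChristoffel ℓ x v l j k * v k
      - ∑ k, cartan ℓ x v l j k * formalSpray ℓ x v k) := by
  have h1 : ∑ k, formalChristoffel ℓ x v i j k * v k
      = ∑ l, (metric ℓ x v)⁻¹ i l * ∑ k, lowChristoffel ℓ x v l j k * v k := by
    simp only [formalChristoffel_eq, Finset.sum_mul, Finset.mul_sum]
    rw [Finset.sum_comm]
    simp only [mul_assoc]
  have h2 : ∑ l, ∑ k, ∑ r, ∑ s, (metric ℓ x v)⁻¹ i l * cartan ℓ x v l j k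
        * formalChristoffel ℓ x v k r s * v r * v s
      = ∑ l, (metric ℓ x v)⁻¹ i l * ∑ k, cartan ℓ x v l j k * formalSpray ℓ x v k := by
    simp only [formalSpray, Finset.mul_sum, mul_assoc]
  rw [nonlinearConn, h1, h2, ← Finset.sum_sub_distrib]
  simp only [mul_sub]

namespace IsChartFinsler

variable {ℓ : E4 → E4 → ℝ} {U A : Set (E4 × E4)} {x v : E4}

lemma cartan_mul_self (H : IsChartFinsler ℓ U A) (h : (x, v) ∈ A) (l k : Fin 4) :
    ∑ j, cartan ℓ x v l j k * v j = 0 := by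
  simp only [cartan_eq, mul_assoc, ← Finset.mul_sum, H.dDir_metric_mul_self h, mul_zero]

/-- The Cartan term is contracted with the reference direction and drops out. -/
lemma nonlinearConn_mul_self (H : IsChartFinsler ℓ U A) (h : (x, v) ∈ A) (i : Fin 4) :
    ∑ j, nonlinearConn ℓ x v i j * v j = formalSpray ℓ x v i := by
  have h1 : ∀ l, ∑ j, (∑ k, cartan ℓ x v l j k * formalSpray ℓ x v k) * v j = 0 := fun l => by
    simp only [Finset.sum_mul]
    rw [Finset.sum_comm]
    refine Finset.sum_eq_zero fun k _ => ?_
    rw [← zero_mul (formalSpray ℓ x v k), ← H.cartan_mul_self h l k, Finset.sum_mul]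
    exact Finset.sum_congr rfl fun j _ => by ring
  simp only [nonlinearConn_eq, Finset.sum_mul]
  rw [Finset.sum_comm]
  simp only [mul_assoc, ← Finset.mul_sum, sub_mul, Finset.sum_sub_distrib, h1, sub_zero]
  simp only [formalSpray, formalChristoffel_eq, Finset.sum_mul, Finset.mul_sum]
  rw [Finset.sum_comm]
  refine Finset.sum_congr rfl fun j _ => ?_
  rw [Finset.sum_comm]
  exact Finset.sum_congr rfl fun k _ => Finset.sum_congr rfl fun l _ => by ring

lemma sum_dHor_metric_mul_self (H : IsChartFinsler ℓ U A) (h : (x, v) ∈ A) (l j : Fin 4) :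
    ∑ k, dHor ℓ (fun y u => metric ℓ y u l k) x v j * v k
      = ∑ k, dPos (fun y u => metric ℓ y u l k) x v j * v k := by
  simp only [dHor, sub_mul, Finset.sum_sub_distrib, Finset.sum_mul]
  rw [Finset.sum_comm, sub_eq_self]
  refine Finset.sum_eq_zero fun m _ => ?_
  simp only [mul_assoc, ← Finset.mul_sum, H.dDir_metric_mul_self h, mul_zero]

/-- Here `v` is contracted with the index of differentiation, so the vertical part survives: `N^m_k
v^k` is the spray, and the vertical derivative of the metric is twice the Cartan tensor. -/
lemma sum_dHor_metric_dir (H : IsChartFinsler ℓ U A) (h : (x, v) ∈ A) (l j : Fin 4) :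
    ∑ k, dHor ℓ (fun y u => metric ℓ y u j l) x v k * v k
      = ∑ k, dPos (fun y u => metric ℓ y u j l) x v k * v k
        - 2 * ∑ k, cartan ℓ x v l j k * formalSpray ℓ x v k := by
  simp only [dHor, sub_mul, Finset.sum_sub_distrib, Finset.sum_mul]
  rw [Finset.sum_comm, Finset.mul_sum]
  congr 1
  refine Finset.sum_congr rfl fun m _ => ?_
  rw [← H.nonlinearConn_mul_self h, Finset.mul_sum, Finset.mul_sum, cartan_eq,
    H.dDir_metric_symm (H.subset h) l j]
  exact Finset.sum_congr rfl fun k _ => by ring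

/-- Contraction of the Koszul expression with `v^k` kills the vertical parts of two of the three
horizontal derivatives, since `C_v(v,·,·) = 0`. The third one yields exactly the Cartan term of
`N^i_j`. -/
lemma christoffel_mul_self_of_cone (H : IsChartFinsler ℓ U A) (h : (x, v) ∈ A) (i j : Fin 4) :
    ∑ k, christoffel ℓ x v i j k * v k = nonlinearConn ℓ x v i j := by
  rw [nonlinearConn_eq]
  have h0 : ∀ k, christoffel ℓ x v i j k * v k = ∑ l, (1 / 2) * ((metric ℓ x v)⁻¹ i l *
      (dHor ℓ (fun y u => metric ℓ y u l k) x v j + dHor ℓ (fun y u => metric ℓ y u j l) x v k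
        - dHor ℓ (fun y u => metric ℓ y u j k) x v l)) * v k := fun k => by
    rw [christoffel, Finset.mul_sum, Finset.sum_mul]
  simp only [h0]
  rw [Finset.sum_comm]
  refine Finset.sum_congr rfl fun l _ => ?_
  have h1 := H.sum_dHor_metric_mul_self h l j
  have h2 := H.sum_dHor_metric_mul_self h j l
  have h3 := H.sum_dHor_metric_dir h l j
  have h4 : ∑ k, (1 / 2) * ((metric ℓ x v)⁻¹ i l *
      (dHor ℓ (fun y u => metric ℓ y u l k) x v j + dHor ℓ (fun y u => metric ℓ y u j l) x v k
        - dHor ℓ (fun y u => metric ℓ y u j k) x v l)) * v k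
      = (1 / 2) * (metric ℓ x v)⁻¹ i l *
        (∑ k, dHor ℓ (fun y u => metric ℓ y u l k) x v j * v k
        + ∑ k, dHor ℓ (fun y u => metric ℓ y u j l) x v k * v k
        - ∑ k, dHor ℓ (fun y u => metric ℓ y u j k) x v l * v k) := by
    rw [← Finset.sum_add_distrib, ← Finset.sum_sub_distrib, Finset.mul_sum]
    exact Finset.sum_congr rfl fun k _ => by ring
  have h5 : ∑ k, lowChristoffel ℓ x v l j k * v k = (1 / 2) *
        (∑ k, dPos (fun y u => metric ℓ y u l k) x v j * v k
        + ∑ k, dPos (fun y u => metric ℓ y u j l) x v k * v k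
        - ∑ k, dPos (fun y u => metric ℓ y u j k) x v l * v k) := by
    rw [← Finset.sum_add_distrib, ← Finset.sum_sub_distrib, Finset.mul_sum]
    exact Finset.sum_congr rfl fun k _ => by rw [lowChristoffel]; ring
  rw [h4, h5, h1, h2, h3]
  ring

lemma spray_eq_formalSpray (H : IsChartFinsler ℓ U A) (h : (x, v) ∈ A) (i : Fin 4) :
    spray ℓ x v i = formalSpray ℓ x v i := by
  rw [← H.nonlinearConn_mul_self h, spray]
  refine Finset.sum_congr rfl fun j _ => ?_
  rw [← H.christoffel_mul_self_of_cone h, Finset.sum_mul]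
  exact Finset.sum_congr rfl fun k _ => by ring

/-- The lowered spray is the Euler--Lagrange expression of `ℓ`, which contains no Christoffel
symbols. It can therefore be differentiated in `v` without any knowledge of the derivatives of `Γ`.
-/
lemma metric_mul_spray_of_cone (H : IsChartFinsler ℓ U A) (h : (x, v) ∈ A) (l : Fin 4) :
    ∑ i, metric ℓ x v l i * spray ℓ x v i
      = (1 / 2) * (∑ j, dPos (fun y u => dDir ℓ y u l) x v j * v j - dPos ℓ x v l) := by
  have h1 : ∀ i, spray ℓ x v i = ∑ k, (metric ℓ x v)⁻¹ i k *
      ∑ j, (∑ m, lowChristoffel ℓ x v k j m * v m) * v j := fun i => by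
    rw [H.spray_eq_formalSpray h, formalSpray]
    simp only [formalChristoffel_eq, Finset.sum_mul, Finset.mul_sum]
    rw [eq_comm, Finset.sum_comm]
    refine Finset.sum_congr rfl fun j _ => ?_
    rw [Finset.sum_comm]
    exact Finset.sum_congr rfl fun k _ => Finset.sum_congr rfl fun l _ => by ring
  simp only [h1]
  rw [H.mul_inv_apply (H.subset h)]
  have h5 : ∀ j, ∑ k, lowChristoffel ℓ x v l j k * v k = (1 / 2) *
        (∑ k, dPos (fun y u => metric ℓ y u l k) x v j * v k
        + ∑ k, dPos (fun y u => metric ℓ y u j l) x v k * v k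
        - ∑ k, dPos (fun y u => metric ℓ y u j k) x v l * v k) := fun j => by
    rw [← Finset.sum_add_distrib, ← Finset.sum_sub_distrib, Finset.mul_sum]
    exact Finset.sum_congr rfl fun k _ => by rw [lowChristoffel]; ring
  have h6 : ∑ j, (∑ k, dPos (fun y u => metric ℓ y u j l) x v k * v k) * v j
      = (1 / 2) * ∑ j, dPos (fun y u => dDir ℓ y u l) x v j * v j := by
    simp only [Finset.sum_mul]
    rw [Finset.sum_comm, Finset.mul_sum]
    refine Finset.sum_congr rfl fun k _ => ?_
    rw [← mul_assoc, ← H.dPos_metric_mul_self h l k, Finset.sum_mul]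
    refine Finset.sum_congr rfl fun j _ => ?_
    rw [SmoothOn.dPos_congr H.isOpen_dom (H.subset h) fun y u hyu => H.metric_symm hyu l j]
    ring
  have h7 := H.dPos_euler h l
  simp only [h5, H.dPos_metric_mul_self h]
  have h8 : ∑ j, (1 / 2 : ℝ) * (1 / 2 * dPos (fun y u => dDir ℓ y u l) x v j
      + ∑ k, dPos (fun y u => metric ℓ y u j l) x v k * v k
      - 1 / 2 * dPos (fun y u => dDir ℓ y u j) x v l) * v j
      = (1 / 2) * ((1 / 2) * ∑ j, dPos (fun y u => dDir ℓ y u l) x v j * v j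
        + ∑ j, (∑ k, dPos (fun y u => metric ℓ y u j l) x v k * v k) * v j
        - (1 / 2) * ∑ j, dPos (fun y u => dDir ℓ y u j) x v l * v j) := by
    rw [Finset.mul_sum, Finset.mul_sum, ← Finset.sum_add_distrib, ← Finset.sum_sub_distrib,
      Finset.mul_sum]
    exact Finset.sum_congr rfl fun j _ => by ring
  rw [h8, h6, h7]
  ring

end IsChartFinsler
end LocalFinsler

/-! ### The spray: vertical derivatives, passage to the closed cone, conservation of `ℓ` -/

namespace LocalFinsler
namespace IsChartFinsler

variable {ℓ : E4 → E4 → ℝ} {U A : Set (E4 × E4)} {x v : E4}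

lemma smooth_spray (H : IsChartFinsler ℓ U A) (i : Fin 4) :
    SmoothOn U (fun x v => spray ℓ x v i) :=
  SmoothOn.sum _ fun j => SmoothOn.sum _ fun k =>
    ((H.smooth_christoffel i j k).mul (SmoothOn.coord U j)).mul (SmoothOn.coord U k)

lemma spray_eq_sum (ℓ : E4 → E4 → ℝ) (x v : E4) (i : Fin 4) :
    spray ℓ x v i = ∑ j, (∑ k, christoffel ℓ x v i j k * v k) * v j := by
  simp only [spray, Finset.sum_mul]
  exact Finset.sum_congr rfl fun j _ => Finset.sum_congr rfl fun k _ => by ring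

lemma dPos_spray (H : IsChartFinsler ℓ U A) (h : (x, v) ∈ U) (i m : Fin 4) :
    dPos (fun y u => spray ℓ y u i) x v m
      = ∑ j, ∑ k, dPos (fun y u => christoffel ℓ y u i j k) x v m * v j * v k := by
  have hs : ∀ j, SmoothOn U (fun y u => ∑ k, christoffel ℓ y u i j k * u k) := fun j =>
    SmoothOn.sum _ fun k => (H.smooth_christoffel i j k).mul (SmoothOn.coord U k)
  simp only [spray_eq_sum]
  rw [dPos_sum_mul_coord H.isOpen_dom h hs]
  refine Finset.sum_congr rfl fun j _ => ?_
  rw [dPos_sum_mul_coord H.isOpen_dom h (H.smooth_christoffel i j), Finset.sum_mul]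
  exact Finset.sum_congr rfl fun k _ => by ring

lemma dDir_spray (H : IsChartFinsler ℓ U A) (h : (x, v) ∈ U) (i m : Fin 4) :
    dDir (fun y u => spray ℓ y u i) x v m
      = ∑ j, ∑ k, dDir (fun y u => christoffel ℓ y u i j k) x v m * v j * v k
        + 2 * ∑ k, christoffel ℓ x v i m k * v k := by
  have hs : ∀ j, SmoothOn U (fun y u => ∑ k, christoffel ℓ y u i j k * u k) := fun j =>
    SmoothOn.sum _ fun k => (H.smooth_christoffel i j k).mul (SmoothOn.coord U k)
  simp only [spray_eq_sum]
  rw [dDir_sum_mul_coord H.isOpen_dom h hs, two_mul, ← add_assoc]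
  congr 1
  rw [← Finset.sum_add_distrib]
  refine Finset.sum_congr rfl fun j _ => ?_
  rw [dDir_sum_mul_coord H.isOpen_dom h (H.smooth_christoffel i j), add_mul, Finset.sum_mul,
    H.christoffel_symm h i m j]
  congr 1
  exact Finset.sum_congr rfl fun k _ => by ring

/-- Differentiate `metric_mul_spray_of_cone` in `v^m`. The derivative of the spray is the present
expression plus `2 N^i_m`, and after inserting the formula for `N^i_m` all other terms cancel. What
remains is the metric applied to the present expression, so nondegeneracy concludes. -/
lemma vertical_christoffel_of_cone (H : IsChartFinsler ℓ U A) (h : (x, v) ∈ A) (i m : Fin 4) :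
    ∑ j, ∑ k, dDir (fun y u => christoffel ℓ y u i j k) x v m * v j * v k = 0 := by
  have hU := H.subset h
  refine congrFun (H.eq_zero_of_metric_mul hU (q := fun i =>
    ∑ j, ∑ k, dDir (fun y u => christoffel ℓ y u i j k) x v m * v j * v k) fun l => ?_) i
  have hd := SmoothOn.dDir_congr H.isOpen_cone h
    (fun y u hyu => H.metric_mul_spray_of_cone hyu l) m
  have hs1 : ∀ j, SmoothOn U (fun y u => dPos (fun y u => dDir ℓ y u l) y u j) := fun j =>
    (H.smooth.dDir H.isOpen_dom l).dPos H.isOpen_dom j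
  rw [dDir_sum H.isOpen_dom hU fun i => (H.smooth_metric l i).mul (H.smooth_spray i),
    dDir_const_mul, dDir_sub H.isOpen_dom hU
      (SmoothOn.sum _ fun j => (hs1 j).mul (SmoothOn.coord U j)) (H.smooth.dPos H.isOpen_dom l),
    dDir_sum_mul_coord H.isOpen_dom hU hs1, H.smooth.dDir_dPos_comm H.isOpen_dom hU] at hd
  simp only [dDir_mul H.isOpen_dom hU (H.smooth_metric l _) (H.smooth_spray _),
    (H.smooth.dDir H.isOpen_dom l).dDir_dPos_comm H.isOpen_dom hU, H.dDir_spray hU,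
    H.christoffel_mul_self_of_cone h] at hd
  have h1 : ∀ j, dPos (fun y u => dDir (fun y u => dDir ℓ y u l) y u m) x v j
      = 2 * dPos (fun y u => metric ℓ y u m l) x v j := fun j => by
    rw [SmoothOn.dPos_congr H.isOpen_dom hU fun y u hyu => H.metric_symm hyu m l]
    simp only [metric_eq, dPos_const_mul]
    ring
  have h2 := H.dPos_metric_mul_self h l m
  have h3 := H.dPos_metric_mul_self h m l
  have h4 : ∑ k, metric ℓ x v l k * nonlinearConn ℓ x v k m
      = ∑ k, lowChristoffel ℓ x v l m k * v k
        - ∑ k, cartan ℓ x v l m k * formalSpray ℓ x v k := by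
    simp only [nonlinearConn_eq]
    rw [H.mul_inv_apply hU]
  have h5 : ∑ k, lowChristoffel ℓ x v l m k * v k = (1 / 2) *
        (∑ k, dPos (fun y u => metric ℓ y u l k) x v m * v k
        + ∑ k, dPos (fun y u => metric ℓ y u m l) x v k * v k
        - ∑ k, dPos (fun y u => metric ℓ y u m k) x v l * v k) := by
    rw [← Finset.sum_add_distrib, ← Finset.sum_sub_distrib, Finset.mul_sum]
    exact Finset.sum_congr rfl fun k _ => by rw [lowChristoffel]; ring
  have h6 : ∑ k, cartan ℓ x v l m k * formalSpray ℓ x v k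
      = (1 / 2) * ∑ k, dDir (fun y u => metric ℓ y u l k) x v m * spray ℓ x v k := by
    rw [Finset.mul_sum]
    refine Finset.sum_congr rfl fun k _ => ?_
    rw [cartan_eq, H.dDir_metric_comm hU l m k, H.spray_eq_formalSpray h]
    ring
  simp only [h1, mul_assoc, ← Finset.mul_sum] at hd
  simp only [mul_add, Finset.sum_add_distrib, mul_left_comm _ (2 : ℝ), ← Finset.mul_sum] at hd
  rw [h4, h5, h6] at hd
  simp only [mul_assoc]
  linarith

/-- Both sides are smooth on `U`, so equality on the cone passes to its closure there. The next
three lemmas extend identities of the open cone in the same way. -/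
lemma christoffel_mul_self (H : IsChartFinsler ℓ U A) (h : (x, v) ∈ U ∩ closure A) (i j : Fin 4) :
    ∑ k, christoffel ℓ x v i j k * v k = nonlinearConn ℓ x v i j := by
  refine sub_eq_zero.1 (SmoothOn.eq_zero_of_closure (U := U) (A := A) (F := fun x v =>
    ∑ k, christoffel ℓ x v i j k * v k - nonlinearConn ℓ x v i j) ?_ H.isOpen_dom ?_ h)
  · exact (SmoothOn.sum _ fun k => (H.smooth_christoffel i j k).mul (SmoothOn.coord U k)).sub
      (H.smooth_nonlinearConn i j)
  · exact fun y u hyu => sub_eq_zero.2 (H.christoffel_mul_self_of_cone hyu i j)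

lemma vertical_christoffel (H : IsChartFinsler ℓ U A) (h : (x, v) ∈ U ∩ closure A) (i m : Fin 4) :
    ∑ j, ∑ k, dDir (fun y u => christoffel ℓ y u i j k) x v m * v j * v k = 0 := by
  refine SmoothOn.eq_zero_of_closure (U := U) (A := A) (F := fun x v =>
    ∑ j, ∑ k, dDir (fun y u => christoffel ℓ y u i j k) x v m * v j * v k) ?_ H.isOpen_dom ?_ h
  · exact SmoothOn.sum _ fun j => SmoothOn.sum _ fun k =>
      (((H.smooth_christoffel i j k).dDir H.isOpen_dom m).mul (SmoothOn.coord U j)).mul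
        (SmoothOn.coord U k)
  · exact fun y u hyu => H.vertical_christoffel_of_cone hyu i m

lemma metric_mul_spray (H : IsChartFinsler ℓ U A) (h : (x, v) ∈ U ∩ closure A) (l : Fin 4) :
    ∑ i, metric ℓ x v l i * spray ℓ x v i
      = (1 / 2) * (∑ j, dPos (fun y u => dDir ℓ y u l) x v j * v j - dPos ℓ x v l) := by
  refine sub_eq_zero.1 (SmoothOn.eq_zero_of_closure (U := U) (A := A) (F := fun x v =>
    ∑ i, metric ℓ x v l i * spray ℓ x v i
      - (1 / 2) * (∑ j, dPos (fun y u => dDir ℓ y u l) x v j * v j - dPos ℓ x v l))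
    ?_ H.isOpen_dom ?_ h)
  · refine (SmoothOn.sum _ fun k => (H.smooth_metric l k).mul (H.smooth_spray k)).sub
      (SmoothOn.const_mul _ (SmoothOn.sub (SmoothOn.sum _ fun j => ?_)
        (H.smooth.dPos H.isOpen_dom l)))
    exact ((H.smooth.dDir H.isOpen_dom l).dPos H.isOpen_dom j).mul (SmoothOn.coord U j)
  · exact fun y u hyu => sub_eq_zero.2 (H.metric_mul_spray_of_cone hyu l)

lemma metric_mul_dir (H : IsChartFinsler ℓ U A) (h : (x, v) ∈ U ∩ closure A) (l : Fin 4) :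
    ∑ k, metric ℓ x v l k * v k = (1 / 2) * dDir ℓ x v l := by
  refine sub_eq_zero.1 (SmoothOn.eq_zero_of_closure (U := U) (A := A) (F := fun x v =>
    ∑ k, metric ℓ x v l k * v k - (1 / 2) * dDir ℓ x v l) ?_ H.isOpen_dom ?_ h)
  · exact (SmoothOn.sum _ fun k => (H.smooth_metric l k).mul (SmoothOn.coord U k)).sub
      (SmoothOn.const_mul _ (H.smooth.dDir H.isOpen_dom l))
  · exact fun y u hyu => sub_eq_zero.2 (H.metric_mul_self hyu l)

/-- The derivative of `ℓ` along the geodesic flow. -/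
def flowDeriv (ℓ : E4 → E4 → ℝ) (x v : E4) : ℝ :=
  ∑ j, dPos ℓ x v j * v j - ∑ l, dDir ℓ x v l * spray ℓ x v l

lemma smooth_flowDeriv (H : IsChartFinsler ℓ U A) : SmoothOn U (flowDeriv ℓ) :=
  (SmoothOn.sum _ fun j => (H.smooth.dPos H.isOpen_dom j).mul (SmoothOn.coord U j)).sub
    (SmoothOn.sum _ fun l => (H.smooth.dDir H.isOpen_dom l).mul (H.smooth_spray l))

/-- Pair the Euler--Lagrange form of the spray with `v`: by Euler's relation what is left is
`(∂ℓ/∂x^j) v^j`. This is conservation of `ℓ` along geodesics. -/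
lemma flowDeriv_eq_zero_of_cone (H : IsChartFinsler ℓ U A) (h : (x, v) ∈ A) :
    flowDeriv ℓ x v = 0 := by
  have h1 : ∑ l, dDir ℓ x v l * spray ℓ x v l
      = 2 * ∑ l, v l * ∑ k, metric ℓ x v l k * spray ℓ x v k := by
    have : ∀ l, dDir ℓ x v l = 2 * ∑ k, metric ℓ x v l k * v k := fun l => by
      rw [H.metric_mul_self h]; ring
    simp only [this, Finset.mul_sum, Finset.sum_mul]
    rw [Finset.sum_comm]
    refine Finset.sum_congr rfl fun k _ => Finset.sum_congr rfl fun l _ => ?_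
    rw [H.metric_symm (H.subset h) l k]
    ring
  have h2 : ∑ l, v l * ∑ j, dPos (fun y u => dDir ℓ y u l) x v j * v j
      = 2 * ∑ j, dPos ℓ x v j * v j := by
    simp only [Finset.mul_sum]
    rw [Finset.sum_comm]
    refine Finset.sum_congr rfl fun j _ => ?_
    rw [← mul_assoc, ← H.dPos_euler h, Finset.sum_mul]
    exact Finset.sum_congr rfl fun l _ => by ring
  have h3 : ∑ l, v l * dPos ℓ x v l = ∑ j, dPos ℓ x v j * v j :=
    Finset.sum_congr rfl fun j _ => mul_comm _ _
  rw [flowDeriv, h1]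
  simp only [H.metric_mul_spray_of_cone h, mul_left_comm _ (1 / 2 : ℝ), mul_sub,
    Finset.sum_sub_distrib, ← Finset.mul_sum, h2, h3]
  ring

lemma fderiv_flowDeriv (H : IsChartFinsler ℓ U A) (h : (x, v) ∈ U ∩ closure A) (w : E4 × E4) :
    fderiv ℝ (Function.uncurry (flowDeriv ℓ)) (x, v) w = 0 :=
  H.smooth_flowDeriv.fderiv_eq_zero_of_closure H.isOpen_dom H.isOpen_cone
    (fun _ _ hyu => H.flowDeriv_eq_zero_of_cone hyu) h w

end IsChartFinsler

/-- The index computation behind the Jacobi equation. `P` and `Q` stand for the derivatives of the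
Christoffel symbols `c` in position and direction. -/
lemma jacobi_index_identity (c : Fin 4 → Fin 4 → Fin 4 → ℝ)
    (P Q : Fin 4 → Fin 4 → Fin 4 → Fin 4 → ℝ) (v a X Y Z : Fin 4 → ℝ) (i : Fin 4)
    (hc : ∀ i j k, c i j k = c i k j) (hP : ∀ i j k m, P i j k m = P i k j m)
    (hQ : ∀ i j k m, Q i j k m = Q i k j m)
    (hv : ∀ i m, ∑ j, ∑ k, Q i j k m * v j * v k = 0)
    (ha : ∀ i, a i = - ∑ j, ∑ k, c i j k * v j * v k) :
    (Z i + ∑ j, ∑ k, ((∑ m, P i j k m * v m + ∑ m, Q i j k m * a m) * v j * X k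
        + c i j k * (a j * X k + v j * Y k)))
      + ∑ j, ∑ k, c i j k * v j * (Y k + ∑ p, ∑ q, c k p q * v p * X q)
      + ∑ j, ∑ k, ∑ l, ((P i l j k - ∑ m, (∑ n, c m k n * v n) * Q i l j m)
          - (P i k j l - ∑ m, (∑ n, c m l n * v n) * Q i k j m)
          + ∑ m, (c i k m * c m l j - c i l m * c m k j)) * v j * X k * v l
    = Z i + ∑ m, (∑ j, ∑ k, P i j k m * v j * v k) * X m
      + ∑ m, (2 * ∑ k, c i m k * v k) * Y m := by
  -- This curvature term is already the position part of the linearized spray.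
  have C1 : ∑ j, ∑ k, ∑ l, P i l j k * v j * X k * v l
      = ∑ m, (∑ j, ∑ k, P i j k m * v j * v k) * X m := by
    rw [Finset.sum_comm]
    refine Finset.sum_congr rfl fun k _ => ?_
    rw [Finset.sum_comm]
    simp only [Finset.sum_mul]
    exact Finset.sum_congr rfl fun j _ => Finset.sum_congr rfl fun l _ => by ring
  -- Here both lower slots of `Γ` are filled with `v`, so `hv` applies.
  have C2 : ∑ j, ∑ k, ∑ l, (∑ m, (∑ n, c m k n * v n) * Q i l j m) * v j * X k * v l = 0 := by
    rw [Finset.sum_comm]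
    refine Finset.sum_eq_zero fun k _ => ?_
    rw [Finset.sum_comm]
    have : ∀ l j, (∑ m, (∑ n, c m k n * v n) * Q i l j m) * v j * X k * v l
        = ∑ m, (∑ n, c m k n * v n) * X k * (Q i l j m * v l * v j) := fun l j => by
      simp only [mul_assoc, Finset.sum_mul]
      exact Finset.sum_congr rfl fun m _ => Finset.sum_congr rfl fun n _ => by ring
    simp only [this]
    have h2 : ∀ l, ∑ j, ∑ m, (∑ n, c m k n * v n) * X k * (Q i l j m * v l * v j)
        = ∑ m, (∑ n, c m k n * v n) * X k * ∑ j, (Q i l j m * v l * v j) := fun l => by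
      rw [Finset.sum_comm]
      simp only [Finset.mul_sum]
    simp only [h2]
    rw [Finset.sum_comm]
    simp only [← Finset.mul_sum, hv, mul_zero, Finset.sum_const_zero]
  -- The remaining curvature terms cancel what the two covariant derivatives produce in excess: `C3`
  -- and `C4` the derivative of `Γ` along the curve, `C5` the acceleration terms, `C6` the product
  -- of two symbols.
  have C3 : ∑ j, ∑ k, ∑ l, P i k j l * v j * X k * v l
      = ∑ j, ∑ k, (∑ m, P i j k m * v m) * v j * X k := by
    simp only [Finset.sum_mul]
    refine Finset.sum_congr rfl fun j _ => Finset.sum_congr rfl fun k _ =>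
      Finset.sum_congr rfl fun l _ => ?_
    rw [hP i k j]
    ring
  have hN : ∀ m, ∑ l, (∑ n, c m l n * v n) * v l = - a m := fun m => by
    rw [ha, neg_neg]
    simp only [Finset.sum_mul]
    exact Finset.sum_congr rfl fun j _ => Finset.sum_congr rfl fun k _ => by ring
  have C4 : ∑ j, ∑ k, ∑ l, (∑ m, (∑ n, c m l n * v n) * Q i k j m) * v j * X k * v l
      = - ∑ j, ∑ k, (∑ m, Q i j k m * a m) * v j * X k := by
    rw [← Finset.sum_neg_distrib]
    refine Finset.sum_congr rfl fun j _ => ?_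
    rw [← Finset.sum_neg_distrib]
    refine Finset.sum_congr rfl fun k _ => ?_
    have : ∀ l, (∑ m, (∑ n, c m l n * v n) * Q i k j m) * v j * X k * v l
        = ∑ m, Q i j k m * v j * X k * ((∑ n, c m l n * v n) * v l) := fun l => by
      rw [Finset.sum_mul, Finset.sum_mul, Finset.sum_mul]
      refine Finset.sum_congr rfl fun m _ => ?_
      rw [hQ i k j]
      ring
    simp only [this]
    rw [Finset.sum_comm]
    simp only [← Finset.mul_sum, hN]
    rw [Finset.sum_mul, Finset.sum_mul, ← Finset.sum_neg_distrib]
    exact Finset.sum_congr rfl fun m _ => by ring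
  have C5 : ∑ j, ∑ k, ∑ l, (∑ m, c i k m * c m l j) * v j * X k * v l
      = - ∑ j, ∑ k, c i j k * (a j * X k) := by
    rw [Finset.sum_comm, Finset.sum_comm (f := fun j k => c i j k * (a j * X k)),
      ← Finset.sum_neg_distrib]
    refine Finset.sum_congr rfl fun k _ => ?_
    have : ∀ j l, (∑ m, c i k m * c m l j) * v j * X k * v l
        = ∑ m, c i k m * X k * (c m l j * v l * v j) := fun j l => by
      rw [Finset.sum_mul, Finset.sum_mul, Finset.sum_mul]
      exact Finset.sum_congr rfl fun m _ => by ring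
    simp only [this]
    rw [Finset.sum_comm]
    have h2 : ∀ l, ∑ j, ∑ m, c i k m * X k * (c m l j * v l * v j)
        = ∑ m, c i k m * X k * ∑ j, c m l j * v l * v j := fun l => by
      rw [Finset.sum_comm]
      simp only [Finset.mul_sum]
    simp only [h2]
    rw [Finset.sum_comm, ← Finset.sum_neg_distrib]
    refine Finset.sum_congr rfl fun m _ => ?_
    rw [← Finset.mul_sum, hc i m k, ha m]
    ring
  have C6 : ∑ j, ∑ k, ∑ l, (∑ m, c i l m * c m k j) * v j * X k * v l
      = ∑ j, ∑ k, c i j k * v j * ∑ p, ∑ q, c k p q * v p * X q := by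
    have : ∀ j k l, (∑ m, c i l m * c m k j) * v j * X k * v l
        = ∑ m, c i l m * v l * (c m j k * v j * X k) := fun j k l => by
      rw [Finset.sum_mul, Finset.sum_mul, Finset.sum_mul]
      refine Finset.sum_congr rfl fun m _ => ?_
      rw [hc m k j]
      ring
    simp only [this, Finset.mul_sum]
    have h1 : ∀ j, ∑ k, ∑ l, ∑ m, c i l m * v l * (c m j k * v j * X k)
        = ∑ l, ∑ m, ∑ k, c i l m * v l * (c m j k * v j * X k) := fun j => by
      rw [Finset.sum_comm]
      exact Finset.sum_congr rfl fun l _ => Finset.sum_comm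
    simp only [h1]
    rw [Finset.sum_comm]
    exact Finset.sum_congr rfl fun l _ => Finset.sum_comm
  have C7 : ∑ m, (2 * ∑ k, c i m k * v k) * Y m = 2 * ∑ j, ∑ k, c i j k * v j * Y k := by
    rw [Finset.sum_comm, Finset.mul_sum]
    refine Finset.sum_congr rfl fun k _ => ?_
    rw [mul_assoc, Finset.sum_mul]
    congr 1
    exact Finset.sum_congr rfl fun j _ => by rw [hc i j k]
  rw [C7, ← C1]
  simp only [add_mul, sub_mul, mul_add, Finset.sum_add_distrib, Finset.sum_sub_distrib,
    mul_assoc]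
  simp only [mul_assoc] at C1 C2 C3 C4 C5 C6
  linarith

end LocalFinsler

/-! ### Geodesics, linearized geodesics and momentum along a curve in a chart -/

lemma hasDerivAt_E4 {f : ℝ → E4} {f' : E4} {s : ℝ} :
    HasDerivAt f f' s ↔ ∀ i, HasDerivAt (fun r => f r i) (f' i) s := by
  constructor
  · intro h i
    exact (EuclideanSpace.proj i : E4 →L[ℝ] ℝ).hasFDerivAt.comp_hasDerivAt s h
  · intro h
    have h1 : HasDerivAt (fun r i => f r i) (fun i => f' i) s := hasDerivAt_pi.2 h
    exact (EuclideanSpace.equiv (Fin 4) ℝ).symm.toContinuousLinearMap.hasFDerivAt.comp_hasDerivAt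
      s h1

lemma ContDiffAt.eventually_hasDerivAt {f : ℝ → E4} {s : ℝ} (hf : ContDiffAt ℝ ∞ f s) :
    ∀ᶠ r in 𝓝 s, HasDerivAt f (deriv f r) r := by
  have h1 : ContDiffAt ℝ 1 f s := hf.of_le (by simp)
  filter_upwards [h1.eventually (by simp)] with r hr
  exact (hr.differentiableAt (by simp)).hasDerivAt

lemma ContDiffAt.deriv_smooth {f : ℝ → E4} {s : ℝ} (hf : ContDiffAt ℝ ∞ f s) :
    ContDiffAt ℝ ∞ (deriv f) s := by
  have h1 : ContDiffAt ℝ ∞ (fun r => fderiv ℝ f r (1 : ℝ)) s :=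
    (hf.fderiv_right (m := ∞) (by simp)).clm_apply contDiffAt_const
  exact h1

lemma ContDiffAt.hasDerivAt_deriv {f : ℝ → E4} {s : ℝ} (hf : ContDiffAt ℝ ∞ f s) :
    HasDerivAt (deriv f) (deriv (deriv f) s) s :=
  (hf.deriv_smooth.differentiableAt (by simp)).hasDerivAt

/-- If `f` is constant along the flow of the vector field `T`, to first order at `c s`, then
`df(Y)` has vanishing derivative along a flow line `c`, for `Y` a solution of the linearized
flow equation. -/
lemma hasDerivAt_fderiv_of_invariant {V : Type*} [NormedAddCommGroup V] [NormedSpace ℝ V]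
    {f : V → ℝ} {T : V → V} {T' : V →L[ℝ] V} {c Y : ℝ → V} {s : ℝ} {Y' : V}
    (hf : ContDiffAt ℝ ∞ f (c s)) (hT : HasFDerivAt T T' (c s)) (hc : HasDerivAt c (T (c s)) s)
    (hY : HasDerivAt Y Y' s) (hY' : Y' = T' (Y s))
    (h0 : fderiv ℝ (fun q => fderiv ℝ f q (T q)) (c s) (Y s) = 0) :
    HasDerivAt (fun r => fderiv ℝ f (c r) (Y r)) 0 s := by
  have h1 : HasFDerivAt (fderiv ℝ f) (fderiv ℝ (fderiv ℝ f) (c s)) (c s) :=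
    ((hf.fderiv_right (m := 1) (by norm_cast)).differentiableAt (by simp)).hasFDerivAt
  have hsym : IsSymmSndFDerivAt ℝ f (c s) := hf.isSymmSndFDerivAt (by simp; norm_cast)
  have hmain := (h1.comp_hasDerivAt s hc).clm_apply hY
  rw [(h1.clm_apply hT).fderiv] at h0
  refine hmain.congr_deriv ?_
  -- The derivative is `D²f(T, Y) + df(T' Y)`. By symmetry of `D²f` this is the derivative of `q ↦
  -- df_q(T q)` in the direction `Y`, which is zero by `h0`.
  rw [← h0, hY', hsym.eq]
  simp [add_comm]

namespace LocalFinsler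

/-- The vector with components `Γ^i_jk v^j v^k`. -/
def sprayVec (ℓ : E4 → E4 → ℝ) (p : E4 × E4) : E4 := WithLp.toLp 2 fun i => spray ℓ p.1 p.2 i

lemma covDeriv_velocity (ℓ : E4 → E4 → ℝ) (x : ℝ → E4) (s : ℝ) :
    covDeriv ℓ x (deriv x) (deriv x) s = deriv (deriv x) s + sprayVec ℓ (x s, deriv x s) := by
  ext i
  simp [covDeriv, sprayVec, spray]

namespace IsChartFinsler

variable {ℓ : E4 → E4 → ℝ} {U A : Set (E4 × E4)} {x X : ℝ → E4} {s : ℝ}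

lemma contDiffOn_sprayVec (H : IsChartFinsler ℓ U A) : ContDiffOn ℝ ∞ (sprayVec ℓ) U := by
  rw [contDiffOn_euclidean]
  exact fun i => H.smooth_spray i

lemma fderiv_sprayVec_apply (H : IsChartFinsler ℓ U A) {y u : E4} (h : (y, u) ∈ U) (X Y : E4)
    (i : Fin 4) : fderiv ℝ (sprayVec ℓ) (y, u) (X, Y) i
      = ∑ m, dPos (fun y u => spray ℓ y u i) y u m * X m
        + ∑ m, dDir (fun y u => spray ℓ y u i) y u m * Y m := by
  rw [← (H.smooth_spray i).fderiv_apply H.isOpen_dom h]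
  have h1 : HasFDerivAt (sprayVec ℓ) (fderiv ℝ (sprayVec ℓ) (y, u)) (y, u) :=
    ((H.contDiffOn_sprayVec.contDiffAt (H.isOpen_dom.mem_nhds h)).differentiableAt
      (by simp)).hasFDerivAt
  have h2 : HasFDerivAt (Function.uncurry fun y u => spray ℓ y u i)
      ((EuclideanSpace.proj i : E4 →L[ℝ] ℝ).comp (fderiv ℝ (sprayVec ℓ) (y, u))) (y, u) :=
    (EuclideanSpace.proj i : E4 →L[ℝ] ℝ).hasFDerivAt.comp (y, u) h1
  rw [h2.fderiv]
  rfl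

lemma covDeriv_covDeriv_apply (H : IsChartFinsler ℓ U A) (hx : ContDiffAt ℝ ∞ x s)
    (hX : ContDiffAt ℝ ∞ X s) (h : (x s, deriv x s) ∈ U) (i : Fin 4) :
    covDeriv ℓ x (deriv x) (covDeriv ℓ x (deriv x) X) s i
      = (deriv (deriv X) s i + ∑ j, ∑ k,
        ((∑ m, dPos (fun y u => christoffel ℓ y u i j k) (x s) (deriv x s) m * deriv x s m
          + ∑ m, dDir (fun y u => christoffel ℓ y u i j k) (x s) (deriv x s) m
            * deriv (deriv x) s m) * deriv x s j * X s k
        + christoffel ℓ (x s) (deriv x s) i j k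
          * (deriv (deriv x) s j * X s k + deriv x s j * deriv X s k)))
      + ∑ j, ∑ k, christoffel ℓ (x s) (deriv x s) i j k * deriv x s j *
        (deriv X s k + ∑ p, ∑ q, christoffel ℓ (x s) (deriv x s) k p q * deriv x s p * X s q) := by
  have hx0 := hx.eventually_hasDerivAt.self_of_nhds
  have hX0 := hX.eventually_hasDerivAt.self_of_nhds
  have hx1 := hx.hasDerivAt_deriv
  have hX1 := hX.hasDerivAt_deriv
  have hD : HasDerivAt (covDeriv ℓ x (deriv x) X) (WithLp.toLp 2 fun i =>
      (deriv (deriv X) s i + ∑ j, ∑ k,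
        ((∑ m, dPos (fun y u => christoffel ℓ y u i j k) (x s) (deriv x s) m * deriv x s m
          + ∑ m, dDir (fun y u => christoffel ℓ y u i j k) (x s) (deriv x s) m
            * deriv (deriv x) s m) * deriv x s j * X s k
        + christoffel ℓ (x s) (deriv x s) i j k
          * (deriv (deriv x) s j * X s k + deriv x s j * deriv X s k)))) s := by
    rw [hasDerivAt_E4]
    intro i
    refine (hasDerivAt_E4.1 hX1 i).add ?_
    refine HasDerivAt.fun_sum fun j _ => HasDerivAt.fun_sum fun k _ => ?_
    have h1 := (H.smooth_christoffel i j k).hasDerivAt_comp H.isOpen_dom h hx0 hx1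
    have h2 := (h1.mul (hasDerivAt_E4.1 hx1 j)).mul (hasDerivAt_E4.1 hX0 k)
    refine h2.congr_deriv ?_
    simp only [Pi.mul_apply]
    ring
  rw [covDeriv, hD.deriv]
  rfl

lemma curvVec_apply (H : IsChartFinsler ℓ U A) {y v : E4} (h : (y, v) ∈ U ∩ closure A) (X : E4)
    (i : Fin 4) : curvVec ℓ y v X v v i = ∑ j, ∑ k, ∑ l,
      ((dPos (fun y u => christoffel ℓ y u i l j) y v k
          - ∑ m, (∑ n, christoffel ℓ y v m k n * v n)
            * dDir (fun y u => christoffel ℓ y u i l j) y v m)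
        - (dPos (fun y u => christoffel ℓ y u i k j) y v l
          - ∑ m, (∑ n, christoffel ℓ y v m l n * v n)
            * dDir (fun y u => christoffel ℓ y u i k j) y v m)
        + ∑ m, (christoffel ℓ y v i k m * christoffel ℓ y v m l j
          - christoffel ℓ y v i l m * christoffel ℓ y v m k j)) * v j * X k * v l := by
  simp only [H.christoffel_mul_self h, curvVec, chernCurvature, dHor]

/-- By `vertical_christoffel` only the explicit `v`-dependence of `Γ^i_jk v^j v^k` contributes to
the direction part. -/
lemma fderiv_sprayVec_apply_of_closure (H : IsChartFinsler ℓ U A) {y v : E4}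
    (h : (y, v) ∈ U ∩ closure A) (X Y : E4) (i : Fin 4) :
    fderiv ℝ (sprayVec ℓ) (y, v) (X, Y) i
      = ∑ m, (∑ j, ∑ k, dPos (fun y u => christoffel ℓ y u i j k) y v m * v j * v k) * X m
        + ∑ m, (2 * ∑ k, christoffel ℓ y v i m k * v k) * Y m := by
  rw [H.fderiv_sprayVec_apply h.1]
  congr 1
  · exact Finset.sum_congr rfl fun m _ => by rw [H.dPos_spray h.1]
  · exact Finset.sum_congr rfl fun m _ => by
      rw [H.dDir_spray h.1, H.vertical_christoffel h, zero_add]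

lemma jacobi_expression (H : IsChartFinsler ℓ U A) {y v : E4} (h : (y, v) ∈ U ∩ closure A)
    (X Y Z : E4) (a : E4) (ha : a = - sprayVec ℓ (y, v)) (i : Fin 4) :
    (Z i + ∑ j, ∑ k, ((∑ m, dPos (fun y u => christoffel ℓ y u i j k) y v m * v m
          + ∑ m, dDir (fun y u => christoffel ℓ y u i j k) y v m * a m) * v j * X k
        + christoffel ℓ y v i j k * (a j * X k + v j * Y k)))
      + ∑ j, ∑ k, christoffel ℓ y v i j k * v j *
        (Y k + ∑ p, ∑ q, christoffel ℓ y v k p q * v p * X q)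
      + curvVec ℓ y v X v v i
    = Z i + fderiv ℝ (sprayVec ℓ) (y, v) (X, Y) i := by
  have hs : ∀ i j k y u, (y, u) ∈ U → christoffel ℓ y u i j k = christoffel ℓ y u i k j :=
    fun i j k y u hyu => H.christoffel_symm hyu i j k
  have ha' : ∀ i, a i = - ∑ j, ∑ k, christoffel ℓ y v i j k * v j * v k :=
    fun i => congrArg (fun w : E4 => w i) ha
  have hP : ∀ i j k m, dPos (fun y u => christoffel ℓ y u i j k) y v m
      = dPos (fun y u => christoffel ℓ y u i k j) y v m := fun i j k m =>
    SmoothOn.dPos_congr H.isOpen_dom h.1 (hs i j k) m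
  have hQ : ∀ i j k m, dDir (fun y u => christoffel ℓ y u i j k) y v m
      = dDir (fun y u => christoffel ℓ y u i k j) y v m := fun i j k m =>
    SmoothOn.dDir_congr H.isOpen_dom h.1 (hs i j k) m
  have := jacobi_index_identity (fun i j k => christoffel ℓ y v i j k)
    (fun i j k m => dPos (fun y u => christoffel ℓ y u i j k) y v m)
    (fun i j k m => dDir (fun y u => christoffel ℓ y u i j k) y v m)
    v.ofLp a.ofLp X.ofLp Y.ofLp Z.ofLp i (fun i j k => hs i j k y v h.1) hP hQ
    (fun i m => H.vertical_christoffel h i m) ha'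
  rw [H.fderiv_sprayVec_apply_of_closure h, H.curvVec_apply h, ← add_assoc]
  exact this

/-- Along a geodesic, the Jacobi equation is the linearization of the geodesic equation. -/
lemma jacobi_iff (H : IsChartFinsler ℓ U A) (hx : ContDiffAt ℝ ∞ x s)
    (hX : ContDiffAt ℝ ∞ X s) (h : (x s, deriv x s) ∈ U ∩ closure A)
    (hgeo : deriv (deriv x) s = - sprayVec ℓ (x s, deriv x s)) :
    covDeriv ℓ x (deriv x) (covDeriv ℓ x (deriv x) X) s
        = - curvVec ℓ (x s) (deriv x s) (X s) (deriv x s) (deriv x s) ↔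
      deriv (deriv X) s = - fderiv ℝ (sprayVec ℓ) (x s, deriv x s) (X s, deriv X s) := by
  -- The two operators agree on every field `X`; only the base curve has to satisfy the geodesic
  -- equation.
  have key : covDeriv ℓ x (deriv x) (covDeriv ℓ x (deriv x) X) s
      + curvVec ℓ (x s) (deriv x s) (X s) (deriv x s) (deriv x s)
      = deriv (deriv X) s
        + fderiv ℝ (sprayVec ℓ) (x s, deriv x s) (X s, deriv X s) := by
    ext i
    rw [PiLp.add_apply, PiLp.add_apply, H.covDeriv_covDeriv_apply hx hX h.1]
    exact H.jacobi_expression h _ _ _ _ hgeo i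
  rw [eq_neg_iff_add_eq_zero, eq_neg_iff_add_eq_zero, key]

/-- The Euler--Lagrange expression in terms of the spray. -/
lemma euler_lagrange (H : IsChartFinsler ℓ U A) (hx : ContDiffAt ℝ ∞ x s)
    (h : (x s, deriv x s) ∈ U ∩ closure A) (l : Fin 4) :
    HasDerivAt (fun r => dDir ℓ (x r) (deriv x r) l) (dPos ℓ (x s) (deriv x s) l
      + 2 * ∑ i, metric ℓ (x s) (deriv x s) l i
        * (deriv (deriv x) s i + spray ℓ (x s) (deriv x s) i)) s := by
  have h1 := (H.smooth.dDir H.isOpen_dom l).hasDerivAt_comp H.isOpen_dom h.1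
    hx.eventually_hasDerivAt.self_of_nhds hx.hasDerivAt_deriv
  refine h1.congr_deriv ?_
  simp only [mul_add, Finset.sum_add_distrib, H.metric_mul_spray h l]
  simp only [metric_eq, mul_assoc, ← Finset.mul_sum]
  ring

/-- The Euler--Lagrange equations imply the geodesic equation. -/
lemma geodesic_of_euler_lagrange (H : IsChartFinsler ℓ U A) (hx : ContDiffAt ℝ ∞ x s)
    (h : (x s, deriv x s) ∈ U ∩ closure A)
    (hEL : ∀ l, deriv (fun r => dDir ℓ (x r) (deriv x r) l) s = dPos ℓ (x s) (deriv x s) l) :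
    deriv (deriv x) s = - sprayVec ℓ (x s, deriv x s) := by
  have h1 : (fun i => deriv (deriv x) s i + spray ℓ (x s) (deriv x s) i) = 0 := by
    refine H.eq_zero_of_metric_mul h.1 fun l => ?_
    have h2 := (H.euler_lagrange hx h l).deriv
    rw [hEL] at h2
    linarith
  ext i
  have := congrFun h1 i
  simp only [Pi.zero_apply] at this
  simp only [sprayVec, PiLp.neg_apply]
  linarith

/-- Along a geodesic the derivative of `∂ℓ/∂v` is `∂ℓ/∂x`, so the product rule assembles the full
differential of `ℓ` at `(X, X')`. -/
lemma hasDerivAt_momentum (H : IsChartFinsler ℓ U A) (hx : ContDiffAt ℝ ∞ x s)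
    (hX : ContDiffAt ℝ ∞ X s) (h : (x s, deriv x s) ∈ U ∩ closure A)
    (hgeo : deriv (deriv x) s = - sprayVec ℓ (x s, deriv x s)) :
    HasDerivAt (fun r => ∑ l, dDir ℓ (x r) (deriv x r) l * X r l)
      (fderiv ℝ (Function.uncurry ℓ) (x s, deriv x s) (X s, deriv X s)) s := by
  rw [H.smooth.fderiv_apply H.isOpen_dom h.1, ← Finset.sum_add_distrib]
  refine HasDerivAt.fun_sum fun l _ => ?_
  have h1 := (H.euler_lagrange hx h l).mul
    (hasDerivAt_E4.1 hX.eventually_hasDerivAt.self_of_nhds l)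
  refine h1.congr_deriv ?_
  rw [hgeo]
  simp [sprayVec]

lemma flowDeriv_eq (H : IsChartFinsler ℓ U A) {p : E4 × E4} (h : p ∈ U) :
    Function.uncurry (flowDeriv ℓ) p
      = fderiv ℝ (Function.uncurry ℓ) p (p.2, - sprayVec ℓ p) := by
  rw [H.smooth.fderiv_apply H.isOpen_dom (x := p.1) (v := p.2) h]
  simp [flowDeriv, sprayVec, Function.uncurry, sub_eq_add_neg]

/-- The pair `(X, X')` is carried by the linearized geodesic flow, and `ℓ` is invariant under the
flow, so `dℓ(X, X')` does not change. With `hasDerivAt_momentum` this says that the momentum paired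
with `X` has vanishing second derivative. -/
lemma hasDerivAt_fderiv_momentum (H : IsChartFinsler ℓ U A) (hx : ContDiffAt ℝ ∞ x s)
    (hX : ContDiffAt ℝ ∞ X s) (h : (x s, deriv x s) ∈ U ∩ closure A)
    (hgeo : deriv (deriv x) s = - sprayVec ℓ (x s, deriv x s))
    (hJ : deriv (deriv X) s = - fderiv ℝ (sprayVec ℓ) (x s, deriv x s) (X s, deriv X s)) :
    HasDerivAt (fun r => fderiv ℝ (Function.uncurry ℓ) (x r, deriv x r) (X r, deriv X r)) 0 s := by
  have hS : HasFDerivAt (sprayVec ℓ) (fderiv ℝ (sprayVec ℓ) (x s, deriv x s)) (x s, deriv x s) :=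
    ((H.contDiffOn_sprayVec.contDiffAt (H.isOpen_dom.mem_nhds h.1)).differentiableAt
      (by simp)).hasFDerivAt
  have hP : HasDerivAt (fun r => (x r, deriv x r)) (deriv x s, deriv (deriv x) s) s :=
    hx.eventually_hasDerivAt.self_of_nhds.prodMk hx.hasDerivAt_deriv
  have hY : HasDerivAt (fun r => (X r, deriv X r)) (deriv X s, deriv (deriv X) s) s :=
    hX.eventually_hasDerivAt.self_of_nhds.prodMk hX.hasDerivAt_deriv
  rw [hgeo] at hP
  rw [hJ] at hY
  refine hasDerivAt_fderiv_of_invariant (H.smooth.contDiffAt (H.isOpen_dom.mem_nhds h.1))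
    (HasFDerivAt.prodMk hasFDerivAt_snd hS.neg) hP hY rfl ?_
  have heq : Function.uncurry (flowDeriv ℓ) =ᶠ[𝓝 (x s, deriv x s)]
      fun p : E4 × E4 => fderiv ℝ (Function.uncurry ℓ) p (p.2, - sprayVec ℓ p) := by
    filter_upwards [H.isOpen_dom.mem_nhds h.1] with p hp using H.flowDeriv_eq hp
  have hzero := H.fderiv_flowDeriv h (X s, deriv X s)
  rw [heq.fderiv_eq] at hzero
  exact hzero

/-- A solution of the linearized geodesic equation with vanishing initial data vanishes. -/
lemma linearized_unique (H : IsChartFinsler ℓ U A) (hx : ContDiffAt ℝ ∞ x s)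
    (hX : ContDiffAt ℝ ∞ X s) (h : (x s, deriv x s) ∈ U)
    (hJ : ∀ᶠ r in 𝓝 s,
      deriv (deriv X) r = - fderiv ℝ (sprayVec ℓ) (x r, deriv x r) (X r, deriv X r))
    (h0 : X s = 0) (h1 : deriv X s = 0) : ∀ᶠ r in 𝓝 s, X r = 0 := by
  -- `(X, X')` solves a first-order linear system with coefficient `B`. The coefficient is
  -- continuous, hence bounded near `s`, and the bound serves as Lipschitz constant.
  let B : ℝ → (E4 × E4) →L[ℝ] (E4 × E4) := fun r =>
    (ContinuousLinearMap.snd ℝ E4 E4).prod (- fderiv ℝ (sprayVec ℓ) (x r, deriv x r))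
  have hP : ContinuousAt (fun r => (x r, deriv x r)) s :=
    hx.continuousAt.prodMk hx.deriv_smooth.continuousAt
  have hS : ContinuousAt (fderiv ℝ (sprayVec ℓ)) (x s, deriv x s) :=
    ((H.contDiffOn_sprayVec.contDiffAt (H.isOpen_dom.mem_nhds h)).fderiv_right
      (m := 0) (by simp)).continuousAt
  have hSP : ContinuousAt (fun r => fderiv ℝ (sprayVec ℓ) (x r, deriv x r)) s :=
    ContinuousAt.comp (f := fun r => (x r, deriv x r)) hS hP
  have hbdd : ∀ᶠ r in 𝓝 s, ‖B r‖₊ ≤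
      max 1 (‖fderiv ℝ (sprayVec ℓ) (x s, deriv x s)‖₊ + 1) := by
    have hn : ∀ᶠ r in 𝓝 s, ‖fderiv ℝ (sprayVec ℓ) (x r, deriv x r)‖₊
        < ‖fderiv ℝ (sprayVec ℓ) (x s, deriv x s)‖₊ + 1 :=
      hSP.nnnorm.tendsto.eventually_lt_const (lt_add_one _)
    filter_upwards [hn] with r hr
    have : ‖B r‖ = max ‖ContinuousLinearMap.snd ℝ E4 E4‖
        ‖- fderiv ℝ (sprayVec ℓ) (x r, deriv x r)‖ := ContinuousLinearMap.opNorm_prod _ _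
    rw [← NNReal.coe_le_coe, coe_nnnorm, this, norm_neg, NNReal.coe_max]
    exact max_le_max (ContinuousLinearMap.norm_snd_le ℝ E4 E4) (by exact_mod_cast hr.le)
  have hX' := hX.deriv_smooth
  have := ODE_solution_unique_of_eventually (v := fun r Y => B r Y) (s := fun _ => Set.univ)
    (K := max 1 (‖fderiv ℝ (sprayVec ℓ) (x s, deriv x s)‖₊ + 1))
    (f := fun r => (X r, deriv X r)) (g := fun _ => 0) (t₀ := s)
    (by
      filter_upwards [hbdd] with r hr
      exact ((B r).lipschitz.weaken hr).lipschitzOnWith)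
    (by
      filter_upwards [hX.eventually_hasDerivAt, hX'.eventually_hasDerivAt, hJ] with r hr1 hr2 hr3
      refine ⟨?_, Set.mem_univ _⟩
      have := hr1.prodMk hr2
      rw [hr3] at this
      exact this)
    (by
      refine Filter.Eventually.of_forall fun r => ⟨?_, Set.mem_univ _⟩
      simpa using hasDerivAt_const r (0 : E4 × E4))
    (by simp [h0, h1])
  filter_upwards [this] with r hr using congrArg Prod.fst hr

end IsChartFinsler
end LocalFinsler

/-! ### Smooth lifts to tangent bundles -/

section TangentMaps

variable {M : Type*} [TopologicalSpace M] [ChartedSpace E4 M] [IsManifold (𝓡 4) ∞ M]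

lemma ContMDiffOn.contMDiffOn_tangentMap_of_isOpen
    {N : Type*} [TopologicalSpace N] [ChartedSpace E4 N] [IsManifold (𝓡 4) ∞ N]
    {f : M → N} {s : Set M} (hf : ContMDiffOn (𝓡 4) (𝓡 4) ∞ f s) (hs : IsOpen s) :
    ContMDiffOn (𝓡 4).tangent (𝓡 4).tangent ∞ (tangentMap (𝓡 4) (𝓡 4) f)
      {z : TangentBundle (𝓡 4) M | z.1 ∈ s} := by
  have : IsManifold (𝓡 4) 1 M := IsManifold.of_le (n := ∞) (by simp)
  have : IsManifold (𝓡 4) 1 N := IsManifold.of_le (n := ∞) (by simp)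
  refine (hf.contMDiffOn_tangentMapWithin (m := ∞) (by simp) hs.uniqueMDiffOn).congr ?_
  intro z hz
  simp only [tangentMap, tangentMapWithin]
  rw [mfderivWithin_of_isOpen hs hz]

lemma contMDiff_toTangent : ContMDiff 𝓘(ℝ, E4 × E4) (𝓡 4).tangent ∞
    (fun p : E4 × E4 => (⟨p.1, p.2⟩ : TangentBundle (𝓡 4) E4)) := by
  have := contMDiff_tangentBundleModelSpaceHomeomorph_symm (I := 𝓡 4) (n := ∞)
  rw [modelWithCornersSelf_prod]
  exact this

lemma contMDiff_ofTangent : ContMDiff (𝓡 4).tangent 𝓘(ℝ, E4 × E4) ∞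
    (fun z : TangentBundle (𝓡 4) E4 => ((z.1, z.2) : E4 × E4)) := by
  have := contMDiff_tangentBundleModelSpaceHomeomorph (I := 𝓡 4) (n := ∞)
  rw [modelWithCornersSelf_prod]
  exact this

/-- The lift to tangent bundles of a map from `ℝ⁴`. -/
def liftFrom (Φ : E4 → M) (p : E4 × E4) : TangentBundle (𝓡 4) M :=
  ⟨Φ p.1, mfderiv (𝓡 4) (𝓡 4) Φ p.1 p.2⟩

lemma contMDiffOn_liftFrom {Φ : E4 → M} {W : Set E4} (hW : IsOpen W)
    (hΦ : ContMDiffOn (𝓡 4) (𝓡 4) ∞ Φ W) :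
    ContMDiffOn 𝓘(ℝ, E4 × E4) (𝓡 4).tangent ∞ (liftFrom Φ) {p | p.1 ∈ W} :=
  (hΦ.contMDiffOn_tangentMap_of_isOpen hW).comp (t := {z : TangentBundle (𝓡 4) E4 | z.1 ∈ W})
    contMDiff_toTangent.contMDiffOn fun _ hp => hp

/-- The lift to tangent bundles of a map to `ℝ⁴`. -/
def liftTo (e : M → E4) (z : TangentBundle (𝓡 4) M) : E4 × E4 :=
  (e z.1, mfderiv (𝓡 4) (𝓡 4) e z.1 z.2)

lemma contMDiffOn_liftTo {e : M → E4} {s : Set M} (hs : IsOpen s)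
    (he : ContMDiffOn (𝓡 4) (𝓡 4) ∞ e s) :
    ContMDiffOn (𝓡 4).tangent 𝓘(ℝ, E4 × E4) ∞ (liftTo e) {z | z.1 ∈ s} :=
  contMDiff_ofTangent.comp_contMDiffOn (he.contMDiffOn_tangentMap_of_isOpen hs)

lemma isOpen_proj_preimage {s : Set M} (hs : IsOpen s) :
    IsOpen {z : TangentBundle (𝓡 4) M | z.1 ∈ s} :=
  hs.preimage (FiberBundle.continuous_proj E4 (TangentSpace (𝓡 4)))

variable {e : OpenPartialHomeomorph M E4}

/-- Every fibre is the model space `E4`, so vectors over equal base points can be compared there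
without transport. -/
lemma tangentBundle_ext {q q' : M} {u : TangentSpace (𝓡 4) q} {u' : TangentSpace (𝓡 4) q'}
    (h : q = q') (hu : (u : E4) = u') :
    (⟨q, u⟩ : TangentBundle (𝓡 4) M) = ⟨q', u'⟩ := by
  subst h
  exact congrArg _ hu

lemma mdifferentiable_of_mem_maximalAtlas (he : e ∈ IsManifold.maximalAtlas (𝓡 4) ∞ M) :
    e.MDifferentiable (𝓡 4) (𝓡 4) :=
  ⟨(contMDiffOn_of_mem_maximalAtlas he).mdifferentiableOn (by simp),
    (contMDiffOn_symm_of_mem_maximalAtlas he).mdifferentiableOn (by simp)⟩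

lemma liftFrom_liftTo (he : e ∈ IsManifold.maximalAtlas (𝓡 4) ∞ M) {z : TangentBundle (𝓡 4) M}
    (hz : z.1 ∈ e.source) : liftFrom e.symm (liftTo e z) = z := by
  obtain ⟨q, u⟩ := z
  have h1 := (mdifferentiable_of_mem_maximalAtlas he).symm_comp_deriv hz
  exact tangentBundle_ext (e.left_inv hz) (congrArg (fun T => T u) h1)

lemma liftTo_liftFrom (he : e ∈ IsManifold.maximalAtlas (𝓡 4) ∞ M) {p : E4 × E4}
    (hp : p.1 ∈ e.target) : liftTo e (liftFrom e.symm p) = p := by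
  have h1 := (mdifferentiable_of_mem_maximalAtlas he).comp_symm_deriv hp
  refine Prod.ext (e.right_inv hp) ?_
  exact congrArg (fun T => T p.2) h1

end TangentMaps

/-! ### Lorentzian linear algebra -/

section Lorentz

/-- The bilinear form on `ℝ⁴` with a given matrix. -/
def matrixForm (m : Matrix (Fin 4) (Fin 4) ℝ) : E4 →ₗ[ℝ] E4 →ₗ[ℝ] ℝ :=
  LinearMap.mk₂ ℝ (fun u w => ∑ i, ∑ j, m i j * u i * w j)
    (fun u u' w => by simp only [PiLp.add_apply, mul_add, add_mul, Finset.sum_add_distrib])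
    (fun c u w => by
      simp only [PiLp.smul_apply, smul_eq_mul, Finset.mul_sum]
      exact Finset.sum_congr rfl fun i _ => Finset.sum_congr rfl fun j _ => by ring)
    (fun u w w' => by simp only [PiLp.add_apply, mul_add, Finset.sum_add_distrib])
    (fun c u w => by
      simp only [PiLp.smul_apply, smul_eq_mul, Finset.mul_sum]
      exact Finset.sum_congr rfl fun i _ => Finset.sum_congr rfl fun j _ => by ring)

lemma matrixForm_apply (m : Matrix (Fin 4) (Fin 4) ℝ) (u w : E4) :
    matrixForm m u w = ∑ i, ∑ j, m i j * u i * w j := rfl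

variable {V : Type*} [AddCommGroup V] [Module ℝ V]

lemma lorentz_apply {g : V →ₗ[ℝ] V →ₗ[ℝ] ℝ} {B : Module.Basis (Fin 4) ℝ V}
    (hB : ∀ i j, g (B i) (B j) = if i = j then (if i = 0 then 1 else -1) else 0) (X Y : V) :
    g X Y = B.repr X 0 * B.repr Y 0 - B.repr X 1 * B.repr Y 1 - B.repr X 2 * B.repr Y 2
      - B.repr X 3 * B.repr Y 3 := by
  conv_lhs => rw [← B.sum_repr X, ← B.sum_repr Y]
  simp only [Fin.sum_univ_four, map_add, LinearMap.add_apply, map_smul, LinearMap.smul_apply, hB,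
    smul_eq_mul]
  simp
  ring

lemma eq_zero_of_sum_three_squares {a b c : ℝ} (h : a ^ 2 + b ^ 2 + c ^ 2 = 0) :
    a = 0 ∧ b = 0 ∧ c = 0 := by
  refine ⟨pow_eq_zero_iff two_ne_zero |>.1 ?_, pow_eq_zero_iff two_ne_zero |>.1 ?_,
    pow_eq_zero_iff two_ne_zero |>.1 ?_⟩ <;> linarith [sq_nonneg a, sq_nonneg b, sq_nonneg c]

/-- A Lorentzian form is negative semidefinite on the orthogonal space of a null vector `n`, and
its kernel there is spanned by `n`. -/
lemma lorentz_null_orthogonal {g : V →ₗ[ℝ] V →ₗ[ℝ] ℝ} {B : Module.Basis (Fin 4) ℝ V}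
    (hB : ∀ i j, g (B i) (B j) = if i = j then (if i = 0 then 1 else -1) else 0)
    {n X Y : V} (hn : n ≠ 0) (hnn : g n n = 0) (hX : g n X = 0) (hY : g n Y = 0) :
    0 ≤ g X X * g Y Y - g X Y * g Y X ∧
      (g X X * g Y Y - g X Y * g Y X = 0 →
        ∃ a b μ : ℝ, (a ≠ 0 ∨ b ≠ 0) ∧ a • X + b • Y = μ • n) := by
  have hsymm : ∀ X Y, g X Y = g Y X := fun X Y => by
    rw [lorentz_apply hB, lorentz_apply hB]; ring
  -- If the time component of a null vector vanishes, the squares of its space components add up to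
  -- zero.
  have hn0 : B.repr n 0 ≠ 0 := by
    intro h0
    have h1 := hnn
    rw [lorentz_apply hB, h0] at h1
    refine hn (B.repr.map_eq_zero_iff.1 ?_)
    obtain ⟨e1, e2, e3⟩ := eq_zero_of_sum_three_squares (a := B.repr n 1) (b := B.repr n 2)
      (c := B.repr n 3) (by linarith)
    ext i
    fin_cases i <;> simp [h0, e1, e2, e3]
  -- Subtracting these multiples of `n` removes the time components and changes none of the
  -- products, since `n` is null and orthogonal to `X` and `Y`.
  obtain ⟨α, hα⟩ : ∃ α, α = B.repr X 0 / B.repr n 0 := ⟨_, rfl⟩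
  obtain ⟨β, hβ⟩ : ∃ β, β = B.repr Y 0 / B.repr n 0 := ⟨_, rfl⟩
  obtain ⟨X', hX'⟩ : ∃ X', X' = X - α • n := ⟨_, rfl⟩
  obtain ⟨Y', hY'⟩ : ∃ Y', Y' = Y - β • n := ⟨_, rfl⟩
  have hX0 : B.repr X' 0 = 0 := by rw [hX', hα]; simp [hn0]
  have hY0 : B.repr Y' 0 = 0 := by rw [hY', hβ]; simp [hn0]
  have hXn : g X n = 0 := by rw [hsymm, hX]
  have hYn : g Y n = 0 := by rw [hsymm, hY]
  have e1 : g X X = g X' X' := by rw [hX']; simp [hXn, hX, hnn]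
  have e2 : g Y Y = g Y' Y' := by rw [hY']; simp [hYn, hY, hnn]
  have e3 : g X Y = g X' Y' := by rw [hX', hY']; simp [hXn, hY, hnn]
  -- Lagrange's identity: the Gram determinant of two spatial vectors is the squared length of their
  -- cross product.
  have key : g X X * g Y Y - g X Y * g Y X
      = (B.repr X' 1 * B.repr Y' 2 - B.repr X' 2 * B.repr Y' 1) ^ 2
        + (B.repr X' 1 * B.repr Y' 3 - B.repr X' 3 * B.repr Y' 1) ^ 2
        + (B.repr X' 2 * B.repr Y' 3 - B.repr X' 3 * B.repr Y' 2) ^ 2 := by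
    rw [hsymm Y X, e1, e2, e3, lorentz_apply hB, lorentz_apply hB, lorentz_apply hB, hX0, hY0]
    ring
  rw [key]
  refine ⟨by positivity, fun h0 => ?_⟩
  obtain ⟨c12, c13, c23⟩ := eq_zero_of_sum_three_squares h0
  have hback : ∀ a b : ℝ, a • X' + b • Y' = 0 → a • X + b • Y = (a * α + b * β) • n := by
    intro a b hab
    rw [hX', hY'] at hab
    rw [← sub_eq_zero, ← hab]
    module
  -- When all minors vanish, a nonzero component of `X'` supplies the coefficients of a linear
  -- relation.
  have hprop : ∀ k, B.repr X' k ≠ 0 → (∀ j, B.repr X' k * B.repr Y' j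
      - B.repr X' j * B.repr Y' k = 0) → (- B.repr Y' k) • X' + (B.repr X' k) • Y' = 0 := by
    intro k _ hk
    refine B.repr.map_eq_zero_iff.1 ?_
    ext j
    simp only [map_add, map_smul, Finsupp.add_apply, Finsupp.smul_apply, smul_eq_mul,
      Finsupp.zero_apply]
    linarith [hk j]
  by_cases h1 : B.repr X' 1 = 0
  · by_cases h2 : B.repr X' 2 = 0
    · by_cases h3 : B.repr X' 3 = 0
      · refine ⟨1, 0, 1 * α + 0 * β, Or.inl one_ne_zero, hback 1 0 ?_⟩
        have : X' = 0 := by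
          refine B.repr.map_eq_zero_iff.1 ?_
          ext i
          fin_cases i <;> simp [hX0, h1, h2, h3]
        simp [this]
      · refine ⟨_, _, _, Or.inr h3, hback _ _ (hprop 3 h3 fun j => ?_)⟩
        fin_cases j <;> simp [hX0, hY0] <;> linarith
    · refine ⟨_, _, _, Or.inr h2, hback _ _ (hprop 2 h2 fun j => ?_)⟩
      fin_cases j <;> simp [hX0, hY0] <;> linarith
  · refine ⟨_, _, _, Or.inr h1, hback _ _ (hprop 1 h1 fun j => ?_)⟩
    fin_cases j <;> simp [hX0, hY0] <;> linarith

end Lorentz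

/-! ### A Finsler spacetime read in a chart -/

lemma fundTensor_comp_linear {V W : Type*} [AddCommGroup V] [Module ℝ V] [AddCommGroup W]
    [Module ℝ W] (F : W → ℝ) (T : V →ₗ[ℝ] W) (v u w : V) :
    fundTensor (fun y => F (T y)) v u w = fundTensor F (T v) (T u) (T w) := by
  simp [fundTensor]

namespace LocalFinsler

lemma SmoothOn.metric {ℓ : E4 → E4 → ℝ} {U : Set (E4 × E4)} (hℓ : SmoothOn U ℓ) (hU : IsOpen U)
    (i j : Fin 4) : SmoothOn U (fun x v => metric ℓ x v i j) := by
  simp only [metric_eq]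
  exact ((hℓ.dDir hU i).dDir hU j).const_mul _

/-- As an iterated derivative, `fundTensor` is not bilinear by definition; bilinearity comes from
the smoothness of `ℓ`. -/
lemma SmoothOn.fundTensor_eq {ℓ : E4 → E4 → ℝ} {U : Set (E4 × E4)} (hℓ : SmoothOn U ℓ)
    (hU : IsOpen U) {x v : E4} (h : (x, v) ∈ U) (u w : E4) :
    fundTensor (ℓ x) v u w = matrixForm (LocalFinsler.metric ℓ x v) u w := by
  have h1 : ∀ᶠ y in 𝓝 v, lineDeriv ℝ (ℓ x) y u = ∑ i, LocalFinsler.dDir ℓ x y i * u i := by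
    have : Filter.Tendsto (fun y => (x, y)) (𝓝 v) (𝓝 (x, v)) :=
      (Continuous.prodMk_right x).tendsto v
    filter_upwards [this (hU.mem_nhds h)] with y hy
    rw [(hℓ.lineDeriv_dir hU hy u).lineDeriv, hℓ.fderiv_apply hU hy]
    simp
  have h2 : HasLineDerivAt ℝ (fun y => ∑ i, LocalFinsler.dDir ℓ x y i * u i)
      (∑ i, (∑ j, LocalFinsler.dDir (fun y u => LocalFinsler.dDir ℓ y u i) x v j * w j) * u i) v w := by
    refine HasDerivAt.fun_sum fun i _ => HasDerivAt.mul_const ?_ _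
    have := (hℓ.dDir hU i).lineDeriv_dir hU h w
    rw [(hℓ.dDir hU i).fderiv_apply hU h] at this
    simp only [PiLp.zero_apply, mul_zero, Finset.sum_const_zero, zero_add] at this
    exact this
  rw [fundTensor_eq_lineDeriv, Filter.EventuallyEq.lineDeriv_eq h1, h2.lineDeriv, matrixForm_apply,
    Finset.mul_sum]
  refine Finset.sum_congr rfl fun i _ => ?_
  rw [Finset.sum_mul, Finset.mul_sum]
  refine Finset.sum_congr rfl fun j _ => ?_
  rw [metric_eq]
  ring

end LocalFinsler

open LocalFinsler

namespace FinslerSpacetime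

variable {M : Type*} [TopologicalSpace M] [ChartedSpace E4 M] [IsManifold (𝓡 4) ∞ M]
  (S : FinslerSpacetime M) {e : OpenPartialHomeomorph M E4}

lemma coordL_eq (x v : E4) : S.coordL e x v = S.L (liftFrom e.symm (x, v)) := rfl

lemma coordL_mfderiv (he : e ∈ IsManifold.maximalAtlas (𝓡 4) ∞ M) {q : M} (hq : q ∈ e.source)
    (u : TangentSpace (𝓡 4) q) :
    S.coordL e (e q) (mfderiv (𝓡 4) (𝓡 4) e q u) = S.L ⟨q, u⟩ :=
  congrArg S.L (liftFrom_liftTo he (z := ⟨q, u⟩) hq)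

/-- The fundamental tensor read in a chart. -/
lemma g_eq_fundTensor_coordL (he : e ∈ IsManifold.maximalAtlas (𝓡 4) ∞ M) {q : M}
    (hq : q ∈ e.source) (v u w : TangentSpace (𝓡 4) q) :
    S.g v u w = fundTensor (S.coordL e (e q)) (mfderiv (𝓡 4) (𝓡 4) e q v)
      (mfderiv (𝓡 4) (𝓡 4) e q u) (mfderiv (𝓡 4) (𝓡 4) e q w) := by
  have h1 := fundTensor_comp_linear (S.coordL e (e q))
    (mfderiv (𝓡 4) (𝓡 4) e q).toLinearMap v u w
  have h2 : (fun y : TangentSpace (𝓡 4) q => S.L ⟨q, y⟩)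
      = fun y => S.coordL e (e q) ((mfderiv (𝓡 4) (𝓡 4) e q).toLinearMap y) :=
    funext fun y => (S.coordL_mfderiv he hq y).symm
  rw [g, h2]
  exact h1

lemma exists_basis_coordL (he : e ∈ IsManifold.maximalAtlas (𝓡 4) ∞ M) {z : TangentBundle (𝓡 4) M}
    (hz : z.1 ∈ e.source) (hA : z ∈ S.Abar) :
    ∃ B : Module.Basis (Fin 4) ℝ E4, ∀ i j,
      fundTensor (S.coordL e (liftTo e z).1) (liftTo e z).2 (B i) (B j)
        = if i = j then (if i = 0 then 1 else -1) else 0 := by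
  obtain ⟨q, v⟩ := z
  obtain ⟨B, hB⟩ := S.signature q v hA
  let T : TangentSpace (𝓡 4) q ≃L[ℝ] TangentSpace (𝓡 4) (e q) :=
    (mdifferentiable_of_mem_maximalAtlas he).mfderiv hz
  refine ⟨B.map T.toLinearEquiv, fun i j => ?_⟩
  rw [← hB i j]
  exact (S.g_eq_fundTensor_coordL he hz v (B i) (B j)).symm

/-- A kernel vector of the matrix is orthogonal to everything, so its coordinates in a Lorentz basis
all vanish. -/
lemma metric_det_ne_zero (he : e ∈ IsManifold.maximalAtlas (𝓡 4) ∞ M) {z : TangentBundle (𝓡 4) M}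
    (hz : z.1 ∈ e.source) (hA : z ∈ S.Abar) {U : Set (E4 × E4)} (hU : IsOpen U)
    (hs : SmoothOn U (S.coordL e)) (hzU : liftTo e z ∈ U) :
    (metric (S.coordL e) (liftTo e z).1 (liftTo e z).2).det ≠ 0 := by
  obtain ⟨B, hB⟩ := S.exists_basis_coordL he hz hA
  simp only [hs.fundTensor_eq hU (x := (liftTo e z).1) (v := (liftTo e z).2) hzU] at hB
  intro h0
  obtain ⟨w, hw0, hw⟩ := Matrix.exists_mulVec_eq_zero_iff.2 h0
  have hzero : ∀ u : E4, matrixForm (metric (S.coordL e) (liftTo e z).1 (liftTo e z).2) u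
      (WithLp.toLp 2 w) = 0 := by
    intro u
    rw [matrixForm_apply]
    refine Finset.sum_eq_zero fun i _ => ?_
    have h1 : ∑ j, metric (S.coordL e) (liftTo e z).1 (liftTo e z).2 i j * w j = 0 :=
      congrFun hw i
    rw [← zero_mul (u i), ← h1, Finset.sum_mul]
    exact Finset.sum_congr rfl fun j _ => by ring
  refine hw0 ?_
  have h2 : B.repr (WithLp.toLp 2 w) = 0 := by
    ext i
    have h3 := hzero (B i)
    rw [lorentz_apply hB] at h3
    fin_cases i <;> simpa using h3
  have h4 : WithLp.toLp 2 w = (0 : E4) := B.repr.map_eq_zero_iff.1 h2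
  exact congrArg WithLp.ofLp h4

lemma subset_Abar : S.A ⊆ S.Abar := fun z hz => ⟨subset_closure hz, S.ne_zero z.1 z.2 hz⟩

lemma liftFrom_mem_source {p : E4 × E4} (hp : p.1 ∈ e.target) :
    (liftFrom e.symm p : TangentBundle (𝓡 4) M).1 ∈ e.source := e.map_target hp

/-- In a chart, a Finsler spacetime is given by a smooth nondegenerate Finsler function. -/
theorem exists_isChartFinsler (he : e ∈ IsManifold.maximalAtlas (𝓡 4) ∞ M) :
    ∃ U A : Set (E4 × E4), IsChartFinsler (S.coordL e) U A ∧
      ∀ z : TangentBundle (𝓡 4) M, z.1 ∈ e.source → z ∈ S.Abar → liftTo e z ∈ U ∩ closure A := by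
  obtain ⟨O, hO, hAO, hL⟩ := S.smooth_L
  have hlift := contMDiffOn_liftFrom e.open_target (contMDiffOn_symm_of_mem_maximalAtlas he)
  have htgt : IsOpen {p : E4 × E4 | p.1 ∈ e.target} := e.open_target.preimage continuous_fst
  -- `L` is smooth on `U₀`, and `U` below is the part of it where the metric is nondegenerate. Both
  -- contain the chart image of the closed cone, while homogeneity is retained only on the image `A`
  -- of the open cone.
  obtain ⟨U₀, hU₀⟩ : ∃ U₀, U₀ = {p : E4 × E4 | p.1 ∈ e.target} ∩ liftFrom e.symm ⁻¹' O :=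
    ⟨_, rfl⟩
  obtain ⟨A, hA⟩ : ∃ A, A = {p : E4 × E4 | p.1 ∈ e.target} ∩ liftFrom e.symm ⁻¹' S.A := ⟨_, rfl⟩
  have hU₀o : IsOpen U₀ := hU₀ ▸ hlift.continuousOn.isOpen_inter_preimage htgt hO
  have hAo : IsOpen A := hA ▸ hlift.continuousOn.isOpen_inter_preimage htgt S.isOpen_A
  have hs : SmoothOn U₀ (S.coordL e) := by
    have h1 : ContMDiffOn 𝓘(ℝ, E4 × E4) 𝓘(ℝ, ℝ) ∞ (fun p => S.L (liftFrom e.symm p)) U₀ := by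
      rw [hU₀]
      exact hL.comp (hlift.mono Set.inter_subset_left) fun p hp => hp.2
    exact contMDiffOn_iff_contDiffOn.1 h1
  have hdet : SmoothOn U₀ (fun x v => (metric (S.coordL e) x v).det) :=
    IsChartFinsler.smooth_det fun i j => hs.metric hU₀o i j
  obtain ⟨U, hU⟩ : ∃ U, U = U₀ ∩
      Function.uncurry (fun x v => (metric (S.coordL e) x v).det) ⁻¹' {0}ᶜ := ⟨_, rfl⟩
  have hUo : IsOpen U := hU ▸ hdet.continuousOn.isOpen_inter_preimage hU₀o isOpen_compl_singleton
  have hmem : ∀ z : TangentBundle (𝓡 4) M, z.1 ∈ e.source → z ∈ S.Abar → liftTo e z ∈ U := by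
    intro z hz hzA
    have h0 : liftTo e z ∈ U₀ := by
      rw [hU₀]
      refine ⟨e.map_source hz, ?_⟩
      rw [Set.mem_preimage, liftFrom_liftTo he hz]
      exact hAO hzA
    rw [hU]
    exact ⟨h0, S.metric_det_ne_zero he hz hzA hU₀o hs h0⟩
  have hAmem : ∀ p ∈ A, p ∈ U := by
    intro p hp
    rw [hA] at hp
    have := hmem _ (liftFrom_mem_source hp.1) (S.subset_Abar hp.2)
    rwa [liftTo_liftFrom he hp.1] at this
  refine ⟨U, A, ⟨hUo, hAo, hAmem, ?_, ?_, ?_⟩, fun z hz hzA => ⟨hmem z hz hzA, ?_⟩⟩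
  · exact hs.mono (hU ▸ Set.inter_subset_left)
  · intro x v hxv
    rw [hU] at hxv
    exact hxv.2
  · intro x v hxv r hr
    rw [hA] at hxv
    have := S.homogeneous _ _ (S.subset_Abar hxv.2) r hr
    rw [coordL_eq, coordL_eq]
    refine Eq.trans (congrArg S.L (tangentBundle_ext rfl ?_)) this
    exact (mfderiv (𝓡 4) (𝓡 4) e.symm x).map_smul r v
  -- A vector of `S.Abar` is a limit of vectors of `S.A`, and `liftTo e` is continuous there.
  · have hc := contMDiffOn_liftTo e.open_source (contMDiffOn_of_mem_maximalAtlas he)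
    have hcz : ContinuousAt (liftTo e) z :=
      hc.continuousOn.continuousAt ((isOpen_proj_preimage e.open_source).mem_nhds hz)
    rw [mem_closure_iff_frequently]
    refine hcz.frequently ?_
    refine ((mem_closure_iff_frequently.1 hzA.1).and_eventually
      ((isOpen_proj_preimage e.open_source).mem_nhds hz)).mono fun y hy => ?_
    rw [hA]
    refine ⟨e.map_source hy.2, ?_⟩
    rw [Set.mem_preimage, liftFrom_liftTo he hy.2]
    exact hy.1

end FinslerSpacetime

/-! ### Families of curves along the `x⁰`-lines -/

lemma fderiv_fderiv_comm {F : E4 → E4} {x : E4} (hF : ContDiffAt ℝ ∞ F x) (a b : E4) :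
    fderiv ℝ (fun y => fderiv ℝ F y a) x b = fderiv ℝ (fun y => fderiv ℝ F y b) x a := by
  have h1 : DifferentiableAt ℝ (fderiv ℝ F) x :=
    (hF.fderiv_right (m := 1) (by norm_cast)).differentiableAt (by simp)
  have hs : IsSymmSndFDerivAt ℝ F x := hF.isSymmSndFDerivAt (by simp; norm_cast)
  have key : ∀ c d : E4, fderiv ℝ (fun y => fderiv ℝ F y c) x d = fderiv ℝ (fderiv ℝ F) x d c := by
    intro c d
    rw [fderiv_clm_apply h1 (by fun_prop)]
    simp
  rw [key, key, hs.eq]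

lemma ContDiffAt.fderiv_apply_const {F : E4 → E4} {x : E4} (hF : ContDiffAt ℝ ∞ F x) (a : E4) :
    ContDiffAt ℝ ∞ (fun y => fderiv ℝ F y a) x :=
  (hF.fderiv_right (m := ∞) (by simp)).clm_apply contDiffAt_const

namespace FinslerSpacetime

lemma line_apply_zero (z : E4) (s : ℝ) : line z s 0 = s := by
  simp [line, basisVec_apply]

lemma line_self (z : E4) : line z (z 0) = z := by simp [line]

lemma contDiff_line (z : E4) : ContDiff ℝ ∞ (line z) := by
  unfold line
  fun_prop

lemma hasDerivAt_line (z : E4) (s : ℝ) : HasDerivAt (line z) (basisVec 0) s := by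
  have : HasDerivAt (fun s : ℝ => z + (s - z 0) • basisVec 0) ((1 : ℝ) • basisVec 0) s :=
    (((hasDerivAt_id s).sub_const (z 0)).smul_const (basisVec 0)).const_add z
  rw [one_smul] at this
  exact this

lemma hasDerivAt_comp_line {F : E4 → E4} {z : E4} {s : ℝ} (hF : ContDiffAt ℝ ∞ F (line z s)) :
    HasDerivAt (fun r => F (line z r)) (fderiv ℝ F (line z s) (basisVec 0)) s :=
  (hF.differentiableAt (by simp)).hasFDerivAt.comp_hasDerivAt s (hasDerivAt_line z s)

lemma contDiffAt_comp_line {F : E4 → E4} {z : E4} {s : ℝ} (hF : ContDiffAt ℝ ∞ F (line z s)) :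
    ContDiffAt ℝ ∞ (fun r => F (line z r)) s :=
  ContDiffAt.comp s hF (contDiff_line z).contDiffAt

section LineCalculus

variable {F : E4 → E4} {V : Set E4} {z : E4} {s : ℝ}

lemma eventually_line_mem (hV : IsOpen V) (hs : line z s ∈ V) : ∀ᶠ r in 𝓝 s, line z r ∈ V :=
  (contDiff_line z).continuous.continuousAt.eventually (hV.mem_nhds hs)

lemma deriv_comp_line (hV : IsOpen V) (hF : ContDiffOn ℝ ∞ F V) (hs : line z s ∈ V) :
    deriv (fun r => F (line z r)) s = fderiv ℝ F (line z s) (basisVec 0) :=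
  (hasDerivAt_comp_line (hF.contDiffAt (hV.mem_nhds hs))).deriv

lemma deriv_comp_line_eventuallyEq (hV : IsOpen V) (hF : ContDiffOn ℝ ∞ F V)
    (hs : line z s ∈ V) : deriv (fun r => F (line z r)) =ᶠ[𝓝 s]
      fun r => fderiv ℝ F (line z r) (basisVec 0) := by
  filter_upwards [eventually_line_mem hV hs] with r hr using deriv_comp_line hV hF hr

lemma deriv_deriv_comp_line (hV : IsOpen V) (hF : ContDiffOn ℝ ∞ F V) (hs : line z s ∈ V) :
    deriv (deriv (fun r => F (line z r))) s
      = fderiv ℝ (fun y => fderiv ℝ F y (basisVec 0)) (line z s) (basisVec 0) := by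
  rw [(deriv_comp_line_eventuallyEq hV hF hs).deriv_eq]
  exact (hasDerivAt_comp_line
    ((hF.contDiffAt (hV.mem_nhds hs)).fderiv_apply_const (basisVec 0))).deriv

end LineCalculus

end FinslerSpacetime

namespace LocalFinsler.IsChartFinsler

open FinslerSpacetime

variable {ℓ : E4 → E4 → ℝ} {U A : Set (E4 × E4)} {ψ : E4 → E4} {V : Set E4} {z : E4} {s : ℝ}

/-- If the `x⁰`-lines of `ψ` are geodesics, then the derivatives of `ψ` satisfy the linearized
geodesic equation along these lines. -/
lemma linearized_of_variation (H : IsChartFinsler ℓ U A) (hV : IsOpen V)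
    (hψ : ContDiffOn ℝ ∞ ψ V)
    (hU : ∀ y ∈ V, (ψ y, fderiv ℝ ψ y (basisVec 0)) ∈ U)
    (hgeo : ∀ y ∈ V, fderiv ℝ (fun y => fderiv ℝ ψ y (basisVec 0)) y (basisVec 0)
      = - sprayVec ℓ (ψ y, fderiv ℝ ψ y (basisVec 0)))
    (hs : line z s ∈ V) (w : E4) :
    deriv (deriv (fun r => fderiv ℝ ψ (line z r) w)) s
      = - fderiv ℝ (sprayVec ℓ)
        (ψ (line z s), deriv (fun r => ψ (line z r)) s)
        (fderiv ℝ ψ (line z s) w, deriv (fun r => fderiv ℝ ψ (line z r) w) s) := by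
  have hat : ∀ y ∈ V, ContDiffAt ℝ ∞ ψ y := fun y hy => hψ.contDiffAt (hV.mem_nhds hy)
  have hD : ∀ a, ContDiffOn ℝ ∞ (fun y => fderiv ℝ ψ y a) V := fun a y hy =>
    ((hat y hy).fderiv_apply_const a).contDiffWithinAt
  rw [deriv_deriv_comp_line hV (hD w) hs, deriv_comp_line hV (hD w) hs, deriv_comp_line hV hψ hs]
  -- Derivatives are commuted until `w` acts last. The geodesic equation holds on an open set and
  -- can then be differentiated in the direction `w`.
  have h1 : (fun y => fderiv ℝ (fun y => fderiv ℝ ψ y w) y (basisVec 0)) =ᶠ[𝓝 (line z s)]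
      fun y => fderiv ℝ (fun y => fderiv ℝ ψ y (basisVec 0)) y w := by
    filter_upwards [hV.mem_nhds hs] with y hy using fderiv_fderiv_comm (hat y hy) _ _
  have h2 : (fun y => fderiv ℝ (fun y => fderiv ℝ ψ y (basisVec 0)) y (basisVec 0))
      =ᶠ[𝓝 (line z s)] fun y => - sprayVec ℓ (ψ y, fderiv ℝ ψ y (basisVec 0)) := by
    filter_upwards [hV.mem_nhds hs] with y hy using hgeo y hy
  rw [h1.fderiv_eq, fderiv_fderiv_comm ((hat _ hs).fderiv_apply_const _), h2.fderiv_eq,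
    fderiv_fderiv_comm (hat _ hs) w]
  have hS : HasFDerivAt (sprayVec ℓ)
      (fderiv ℝ (sprayVec ℓ) (ψ (line z s), fderiv ℝ ψ (line z s) (basisVec 0)))
      (ψ (line z s), fderiv ℝ ψ (line z s) (basisVec 0)) :=
    ((H.contDiffOn_sprayVec.contDiffAt (H.isOpen_dom.mem_nhds (hU _ hs))).differentiableAt
      (by simp)).hasFDerivAt
  have hψ' := ((hat _ hs).differentiableAt (by simp)).hasFDerivAt
  have hD' := (((hat _ hs).fderiv_apply_const (basisVec 0)).differentiableAt
    (by simp)).hasFDerivAt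
  have h3 := (hS.comp (line z s) (hψ'.prodMk hD')).neg
  have h4 : fderiv ℝ (fun y => - sprayVec ℓ (ψ y, fderiv ℝ ψ y (basisVec 0))) (line z s) = _ :=
    h3.fderiv
  rw [h4]
  rfl

/-- The vertical derivatives of `Γ` do not contribute, so `2 Γ^i_mk v^k v^m` remains: Euler's
relation for a function of degree two. -/
lemma fderiv_sprayVec_dir (H : IsChartFinsler ℓ U A) {y v : E4} (h : (y, v) ∈ U ∩ closure A) :
    fderiv ℝ (sprayVec ℓ) (y, v) (0, v) = (2 : ℝ) • sprayVec ℓ (y, v) := by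
  ext i
  rw [H.fderiv_sprayVec_apply_of_closure h]
  simp only [PiLp.zero_apply, mul_zero, Finset.sum_const_zero, zero_add, PiLp.smul_apply,
    smul_eq_mul, sprayVec, spray_eq_sum, mul_assoc, ← Finset.mul_sum]

/-- The tangential field `(s - b) x'` satisfies the linearized geodesic equation. -/
lemma linearized_tangential (H : IsChartFinsler ℓ U A) {x : ℝ → E4} {b : ℝ}
    (hx : ContDiffAt ℝ ∞ x s) (h : (x s, deriv x s) ∈ U ∩ closure A)
    (hgeo : ∀ᶠ r in 𝓝 s, deriv (deriv x) r = - sprayVec ℓ (x r, deriv x r)) :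
    deriv (deriv (fun r => (r - b) • deriv x r)) s
      = - fderiv ℝ (sprayVec ℓ) (x s, deriv x s)
        ((s - b) • deriv x s, deriv (fun r => (r - b) • deriv x r) s) := by
  have hx' := hx.deriv_smooth
  have hid : ∀ r : ℝ, HasDerivAt (fun r : ℝ => r - b) 1 r := fun r => (hasDerivAt_id r).sub_const b
  have h1 : deriv (fun r => (r - b) • deriv x r) =ᶠ[𝓝 s]
      fun r => (r - b) • deriv (deriv x) r + (1 : ℝ) • deriv x r := by
    filter_upwards [hx'.eventually_hasDerivAt] with r hr using ((hid r).smul hr).deriv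
  have h2 : HasDerivAt (fun r => (r - b) • deriv (deriv x) r + (1 : ℝ) • deriv x r)
      (((s - b) • deriv (deriv (deriv x)) s + (1 : ℝ) • deriv (deriv x) s)
        + (1 : ℝ) • deriv (deriv x) s) s :=
    ((hid s).smul hx'.hasDerivAt_deriv).add (hx.hasDerivAt_deriv.const_smul (1 : ℝ))
  have h3 : deriv (deriv (deriv x)) s
      = - fderiv ℝ (sprayVec ℓ) (x s, deriv x s) (deriv x s, deriv (deriv x) s) := by
    have hS : HasFDerivAt (sprayVec ℓ) (fderiv ℝ (sprayVec ℓ) (x s, deriv x s))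
        (x s, deriv x s) :=
      ((H.contDiffOn_sprayVec.contDiffAt (H.isOpen_dom.mem_nhds h.1)).differentiableAt
        (by simp)).hasFDerivAt
    have h4 : HasDerivAt (fun r => - sprayVec ℓ (x r, deriv x r))
        (- fderiv ℝ (sprayVec ℓ) (x s, deriv x s) (deriv x s, deriv (deriv x) s)) s :=
      (hS.comp_hasDerivAt s (hx.eventually_hasDerivAt.self_of_nhds.prodMk
        hx.hasDerivAt_deriv)).neg
    rw [Filter.EventuallyEq.deriv_eq hgeo, h4.deriv]
  rw [h1.deriv_eq, h2.deriv, h1.self_of_nhds]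
  -- Under minus the linearized spray, the first summand gives `(s - b) x'''`, by differentiating
  -- the geodesic equation, and the second gives `2 x''`, by homogeneity.
  have h5 : (((s - b) • deriv x s, (s - b) • deriv (deriv x) s + (1 : ℝ) • deriv x s) : E4 × E4)
      = (s - b) • (deriv x s, deriv (deriv x) s) + (0, deriv x s) := by
    simp
  rw [h5, map_add, map_smul, H.fderiv_sprayVec_dir h, h3, hgeo.self_of_nhds]
  module

end LocalFinsler.IsChartFinsler

namespace LocalFinsler.IsChartFinsler

open FinslerSpacetime

variable {ℓ : E4 → E4 → ℝ} {U A : Set (E4 × E4)} {ψ : E4 → E4} {V : Set E4}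

/-- If `ψ` is a local diffeomorphism, `∂_0 ψ` is null and its momentum has constant components in
the frame of `ψ`, then the `x⁰`-lines of `ψ` are geodesics. -/
lemma geodesic_of_null_frame (H : IsChartFinsler ℓ U A) (hV : IsOpen V) (hψ : ContDiffOn ℝ ∞ ψ V)
    (hU : ∀ y ∈ V, (ψ y, fderiv ℝ ψ y (basisVec 0)) ∈ U ∩ closure A)
    (hnull : ∀ y ∈ V, ℓ (ψ y) (fderiv ℝ ψ y (basisVec 0)) = 0) (c : Fin 4 → ℝ)
    (hframe : ∀ y ∈ V, ∀ i, ∑ l, dDir ℓ (ψ y) (fderiv ℝ ψ y (basisVec 0)) l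
      * fderiv ℝ ψ y (basisVec i) l = c i)
    {y : E4} (hy : y ∈ V) (hsurj : Function.Surjective (fderiv ℝ ψ y)) :
    fderiv ℝ (fun y => fderiv ℝ ψ y (basisVec 0)) y (basisVec 0)
      = - sprayVec ℓ (ψ y, fderiv ℝ ψ y (basisVec 0)) := by
  have hy' : line y (y 0) ∈ V := by rwa [line_self]
  have hat : ContDiffAt ℝ ∞ ψ y := hψ.contDiffAt (hV.mem_nhds hy)
  have hx : ContDiffAt ℝ ∞ (fun r => ψ (line y r)) (y 0) :=
    contDiffAt_comp_line (by rwa [line_self])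
  have hd := deriv_comp_line hV hψ hy'
  have hdd := deriv_deriv_comp_line hV hψ hy'
  have hev := deriv_comp_line_eventuallyEq hV hψ hy'
  rw [line_self] at hd hdd
  have hK : (ψ (line y (y 0)), deriv (fun r => ψ (line y r)) (y 0)) ∈ U ∩ closure A := by
    rw [hd, line_self]; exact hU y hy
  have hgeo := H.geodesic_of_euler_lagrange hx hK
  rw [hd, hdd, line_self] at hgeo
  refine hgeo fun l => ?_
  have hEL : ∀ l, HasDerivAt (fun r => dDir ℓ (ψ (line y r)) (fderiv ℝ ψ (line y r) (basisVec 0)) l)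
      (deriv (fun r => dDir ℓ (ψ (line y r)) (deriv (fun r => ψ (line y r)) r) l) (y 0)) (y 0) :=
    fun l => by
      have h1 := (H.euler_lagrange hx hK l).differentiableAt.hasDerivAt
      refine h1.congr_of_eventuallyEq ?_
      filter_upwards [hev] with r hr
      rw [hr]
  -- The Euler--Lagrange defect vanishes on the frame. `h3` expresses constancy of the momentum
  -- components along the line; `h4` and `h8` express nullity, differentiated in the direction
  -- `∂_i`. The second derivatives of `ψ` in the two agree by symmetry and subtract out.
  have hzero : ∀ i, ∑ l, (deriv (fun r => dDir ℓ (ψ (line y r))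
      (deriv (fun r => ψ (line y r)) r) l) (y 0)
      - dPos ℓ (ψ y) (fderiv ℝ ψ y (basisVec 0)) l) * fderiv ℝ ψ y (basisVec i) l = 0 := by
    intro i
    have h1 : HasDerivAt (fun r => ∑ l, dDir ℓ (ψ (line y r))
        (fderiv ℝ ψ (line y r) (basisVec 0)) l * fderiv ℝ ψ (line y r) (basisVec i) l)
        (∑ l, (deriv (fun r => dDir ℓ (ψ (line y r)) (deriv (fun r => ψ (line y r)) r) l) (y 0)
            * fderiv ℝ ψ (line y (y 0)) (basisVec i) l
          + dDir ℓ (ψ (line y (y 0))) (fderiv ℝ ψ (line y (y 0)) (basisVec 0)) l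
            * fderiv ℝ (fun y => fderiv ℝ ψ y (basisVec i)) (line y (y 0)) (basisVec 0) l))
        (y 0) := by
      refine HasDerivAt.fun_sum fun l _ => (hEL l).mul (hasDerivAt_E4.1 ?_ l)
      exact hasDerivAt_comp_line (F := fun y => fderiv ℝ ψ y (basisVec i))
        (by rw [line_self]; exact hat.fderiv_apply_const _)
    have h2 : HasDerivAt (fun r => ∑ l, dDir ℓ (ψ (line y r))
        (fderiv ℝ ψ (line y r) (basisVec 0)) l * fderiv ℝ ψ (line y r) (basisVec i) l) 0 (y 0) := by
      refine (hasDerivAt_const (y 0) (c i)).congr_of_eventuallyEq ?_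
      filter_upwards [eventually_line_mem hV hy'] with r hr using hframe _ hr i
    have h3 := h1.unique h2
    rw [line_self] at h3
    have hline : HasDerivAt (fun t : ℝ => y + t • basisVec i) (basisVec i) 0 := by
      have : HasDerivAt (fun t : ℝ => y + t • basisVec i) ((1 : ℝ) • basisVec i) 0 :=
        ((hasDerivAt_id (0 : ℝ)).smul_const (basisVec i)).const_add y
      rwa [one_smul] at this
    have hy0 : y + (0 : ℝ) • basisVec i = y := by simp
    have h4 : HasDerivAt (fun t : ℝ => ℓ (ψ (y + t • basisVec i))
        (fderiv ℝ ψ (y + t • basisVec i) (basisVec 0)))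
        (∑ m, dPos ℓ (ψ y) (fderiv ℝ ψ y (basisVec 0)) m * fderiv ℝ ψ y (basisVec i) m
        + ∑ m, dDir ℓ (ψ y) (fderiv ℝ ψ y (basisVec 0)) m
          * fderiv ℝ (fun y => fderiv ℝ ψ y (basisVec 0)) y (basisVec i) m) 0 := by
      have h5 : HasDerivAt (fun t : ℝ => ψ (y + t • basisVec i)) (fderiv ℝ ψ y (basisVec i)) 0 :=
        HasFDerivAt.comp_hasDerivAt (0 : ℝ)
          (by rw [hy0]; exact (hat.differentiableAt (by simp)).hasFDerivAt) hline
      have h6 : HasDerivAt (fun t : ℝ => fderiv ℝ ψ (y + t • basisVec i) (basisVec 0))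
          (fderiv ℝ (fun y => fderiv ℝ ψ y (basisVec 0)) y (basisVec i)) 0 :=
        HasFDerivAt.comp_hasDerivAt (l := fun y => fderiv ℝ ψ y (basisVec 0)) (0 : ℝ)
          (by
            rw [hy0]
            exact ((hat.fderiv_apply_const _).differentiableAt (by simp)).hasFDerivAt) hline
      have h7 := H.smooth.hasDerivAt_comp H.isOpen_dom (by rw [hy0]; exact (hU y hy).1) h5 h6
      rw [hy0] at h7
      exact h7
    have h8 : HasDerivAt (fun t : ℝ => ℓ (ψ (y + t • basisVec i))
        (fderiv ℝ ψ (y + t • basisVec i) (basisVec 0))) 0 0 := by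
      refine (hasDerivAt_const (0 : ℝ) (0 : ℝ)).congr_of_eventuallyEq ?_
      have : ∀ᶠ t in 𝓝 (0 : ℝ), y + t • basisVec i ∈ V :=
        hline.continuousAt.eventually (hV.mem_nhds (by simpa using hy))
      filter_upwards [this] with t ht using hnull _ ht
    have h9 := h4.unique h8
    rw [Finset.sum_add_distrib, fderiv_fderiv_comm hat (basisVec i)] at h3
    simp only [sub_mul, Finset.sum_sub_distrib]
    linarith
  -- Every coordinate vector is a combination of the frame vectors, so the defect vanishes in each
  -- component.
  obtain ⟨u, hu⟩ := hsurj (basisVec l)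
  rw [← sub_eq_zero]
  have h1 : ∀ w : E4, ∑ l, (deriv (fun r => dDir ℓ (ψ (line y r))
      (deriv (fun r => ψ (line y r)) r) l) (y 0)
      - dPos ℓ (ψ y) (fderiv ℝ ψ y (basisVec 0)) l) * fderiv ℝ ψ y w l = 0 := by
    intro w
    have h2 := map_eq_sum_basisVec (fderiv ℝ ψ y).toLinearMap w
    simp only [ContinuousLinearMap.coe_coe] at h2
    rw [h2]
    have : ∀ l, (∑ i, w i • fderiv ℝ ψ y (basisVec i)) l
        = ∑ i, w i * fderiv ℝ ψ y (basisVec i) l := fun l => by simp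
    simp only [this, Finset.mul_sum]
    rw [Finset.sum_comm]
    refine Finset.sum_eq_zero fun i _ => ?_
    rw [← mul_zero (w i), ← hzero i, Finset.mul_sum]
    exact Finset.sum_congr rfl fun l _ => by ring
  have h2 := h1 u
  rw [hu] at h2
  simpa [basisVec_apply] using h2

/-- On the cone, `g_v(v,w)` is half the momentum applied to `w`. -/
lemma matrixForm_dir (H : IsChartFinsler ℓ U A) {x v : E4} (h : (x, v) ∈ U ∩ closure A) (w : E4) :
    matrixForm (metric ℓ x v) v w = (1 / 2) * ∑ l, dDir ℓ x v l * w l := by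
  rw [matrixForm_apply, Finset.sum_comm, Finset.mul_sum]
  refine Finset.sum_congr rfl fun l _ => ?_
  rw [← mul_assoc, ← H.metric_mul_dir h, Finset.sum_mul]
  exact Finset.sum_congr rfl fun k _ => by rw [H.metric_symm h.1 k l]

end LocalFinsler.IsChartFinsler

/-! ### The continued coordinates and their geodesics -/

namespace FinslerSpacetime

variable {M : Type*} [TopologicalSpace M] [ChartedSpace E4 M] [IsManifold (𝓡 4) ∞ M]
  {S : FinslerSpacetime M} {e φ : OpenPartialHomeomorph M E4} {W : Set E4} {Φ : E4 → M}
  {f : M → ℝ} {N : ∀ q : M, TangentSpace (𝓡 4) q}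

lemma isOpen_chartDom (hW : IsOpen W) (hΦ : ContMDiffOn (𝓡 4) (𝓡 4) ∞ Φ W) :
    IsOpen (W ∩ Φ ⁻¹' e.source) :=
  hΦ.continuousOn.isOpen_inter_preimage hW e.open_source

lemma contDiffOn_chart (he : e ∈ IsManifold.maximalAtlas (𝓡 4) ∞ M)
    (hΦ : ContMDiffOn (𝓡 4) (𝓡 4) ∞ Φ W) :
    ContDiffOn ℝ ∞ (fun x => e (Φ x)) (W ∩ Φ ⁻¹' e.source) := by
  rw [← contMDiffOn_iff_contDiffOn]
  exact (contMDiffOn_of_mem_maximalAtlas he).comp (hΦ.mono Set.inter_subset_left)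
    fun x hx => hx.2

lemma mfderiv_chart_comp (he : e ∈ IsManifold.maximalAtlas (𝓡 4) ∞ M) (hW : IsOpen W)
    (hΦ : ContMDiffOn (𝓡 4) (𝓡 4) ∞ Φ W) {x : E4} (hx : x ∈ W) (hxe : Φ x ∈ e.source) (v : E4) :
    mfderiv (𝓡 4) (𝓡 4) e (Φ x) (mfderiv (𝓡 4) (𝓡 4) Φ x v)
      = fderiv ℝ (fun y => e (Φ y)) x v := by
  have h1 : MDifferentiableAt (𝓡 4) (𝓡 4) e (Φ x) :=
    (mdifferentiable_of_mem_maximalAtlas he).mdifferentiableAt hxe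
  have h2 : MDifferentiableAt (𝓡 4) (𝓡 4) Φ x :=
    (hΦ.contMDiffAt (hW.mem_nhds hx)).mdifferentiableAt (by simp)
  have h3 := mfderiv_comp x h1 h2
  rw [← mfderiv_eq_fderiv]
  exact (congrArg (fun T => T v) h3).symm

lemma velocity_comp_line (hW : IsOpen W) (hΦ : ContMDiffOn (𝓡 4) (𝓡 4) ∞ Φ W) {z : E4} {s : ℝ}
    (hs : line z s ∈ W) :
    velocity (fun r => Φ (line z r)) s = coordVec Φ (line z s) 0 := by
  have h1 : MDifferentiableAt (𝓡 4) (𝓡 4) Φ (line z s) :=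
    (hΦ.contMDiffAt (hW.mem_nhds hs)).mdifferentiableAt (by simp)
  have h2 : MDifferentiableAt 𝓘(ℝ, ℝ) (𝓡 4) (line z) s :=
    (hasDerivAt_line z s).differentiableAt.mdifferentiableAt
  have h3 := mfderiv_comp s h1 h2
  have h4 : mfderiv 𝓘(ℝ, ℝ) (𝓡 4) (line z) s (1 : ℝ) = basisVec 0 := by
    rw [mfderiv_eq_fderiv]
    exact (hasDerivAt_line z s).deriv
  have h5 : velocity (fun r => Φ (line z r)) s
      = mfderiv (𝓡 4) (𝓡 4) Φ (line z s) (mfderiv 𝓘(ℝ, ℝ) (𝓡 4) (line z) s (1 : ℝ)) :=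
    congrArg (fun T => T (1 : ℝ)) h3
  rw [h5, h4]
  rfl

lemma liftFrom_eq_symm (hΦ : S.IsContinuation φ W Φ) {x : E4} (hx : x ∈ φ.target) (v : E4) :
    liftFrom Φ (x, v) = liftFrom φ.symm (x, v) := by
  have h1 : Φ =ᶠ[𝓝 x] φ.symm := by
    filter_upwards [φ.open_target.mem_nhds hx] with y hy using hΦ.eq_symm y hy
  refine tangentBundle_ext (hΦ.eq_symm x hx) ?_
  exact congrArg (fun T : E4 →L[ℝ] E4 => T v) h1.mfderiv_eq

lemma normal_eq (hφ : S.IsLightlikeChart f N φ) (hΦ : S.IsContinuation φ W Φ) {x : E4}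
    (hx : x ∈ φ.target) : N (Φ x) = coordVec Φ x 0 := by
  have h1 : (⟨Φ x, coordVec Φ x 0⟩ : TangentBundle (𝓡 4) M)
      = ⟨φ.symm x, coordVec φ.symm x 0⟩ := liftFrom_eq_symm hΦ hx (basisVec 0)
  rw [← hφ.N_eq x hx] at h1
  have h2 : (⟨Φ x, N (Φ x)⟩ : TangentBundle (𝓡 4) M) = ⟨φ.symm x, N (φ.symm x)⟩ := by
    rw [hΦ.eq_symm x hx]
  have h3 := h2.trans h1.symm
  exact eq_of_heq (Bundle.TotalSpace.mk.inj h3).2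

/-- The components `g_N(∂_i, ∂_j)` read in a chart. -/
lemma gram_eq (he : e ∈ IsManifold.maximalAtlas (𝓡 4) ∞ M) (hW : IsOpen W)
    (hΦ : ContMDiffOn (𝓡 4) (𝓡 4) ∞ Φ W) {x : E4} (hx : x ∈ W) (hxe : Φ x ∈ e.source)
    (i j : Fin 4) : S.gram Φ x i j = fundTensor (S.coordL e (e (Φ x)))
      (fderiv ℝ (fun y => e (Φ y)) x (basisVec 0)) (fderiv ℝ (fun y => e (Φ y)) x (basisVec i))
      (fderiv ℝ (fun y => e (Φ y)) x (basisVec j)) := by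
  rw [gram, S.g_eq_fundTensor_coordL he hxe]
  simp only [coordVec, mfderiv_chart_comp he hW hΦ hx hxe]

lemma gram_eq_symm (hΦ : S.IsContinuation φ W Φ) {x : E4} (hx : x ∈ φ.target) (i j : Fin 4) :
    S.gram Φ x i j = S.gram φ.symm x i j := by
  have h1 : Φ =ᶠ[𝓝 x] φ.symm := by
    filter_upwards [φ.open_target.mem_nhds hx] with y hy using hΦ.eq_symm y hy
  have h2 : ∀ i, (coordVec Φ x i : E4) = coordVec φ.symm x i := fun i =>
    congrArg (fun T : E4 →L[ℝ] E4 => T (basisVec i)) h1.mfderiv_eq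
  have h3 : ∀ (q q' : M) (v u w : E4), q = q' → S.g (p := q) v u w = S.g (p := q') v u w := by
    rintro q q' v u w rfl
    rfl
  have h4 := h3 (Φ x) (φ.symm x) (coordVec Φ x 0) (coordVec Φ x i) (coordVec Φ x j)
    (hΦ.eq_symm x hx)
  rw [gram, gram]
  refine h4.trans ?_
  congr 1
  · exact h2 0
  · exact h2 i
  · exact h2 j

lemma gram_target (hφ : S.IsLightlikeChart f N φ) (hΦ : S.IsContinuation φ W Φ) {x : E4}
    (hx : x ∈ φ.target) (i : Fin 4) : S.gram Φ x 0 i = if i = 1 then 1 else 0 := by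
  rw [gram_eq_symm hΦ hx]
  fin_cases i
  · simpa using hφ.gram_00 x hx
  · simpa using hφ.gram_01 x hx
  · simpa using hφ.gram_02 x hx
  · simpa using hφ.gram_03 x hx

lemma coordVec_mem_Abar_of_target (hφ : S.IsLightlikeChart f N φ) (hΦ : S.IsContinuation φ W Φ)
    {x : E4} (hx : x ∈ φ.target) :
    (⟨Φ x, coordVec Φ x 0⟩ : TangentBundle (𝓡 4) M) ∈ S.Abar := by
  rw [← normal_eq hφ hΦ hx]
  refine hφ.admissible _ ?_
  rw [hΦ.eq_symm x hx]
  exact φ.map_target hx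

lemma fderiv_chart_bijective (hφ : S.IsLightlikeChart f N φ) (hΦ : S.IsContinuation φ W Φ)
    (he : e ∈ IsManifold.maximalAtlas (𝓡 4) ∞ M) {x : E4} (hx : x ∈ φ.target)
    (hxe : Φ x ∈ e.source) : Function.Bijective (fderiv ℝ (fun y => e (Φ y)) x) := by
  have hxW := hΦ.target_subset hx
  have h1 : Function.Bijective (mfderiv (𝓡 4) (𝓡 4) e (Φ x)) :=
    (mdifferentiable_of_mem_maximalAtlas he).mfderiv_bijective hxe
  have h2 : Function.Bijective (mfderiv (𝓡 4) (𝓡 4) φ.symm x) :=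
    (mdifferentiable_of_mem_maximalAtlas hφ.mem_atlas).symm.mfderiv_bijective hx
  have h3 : Φ =ᶠ[𝓝 x] φ.symm := by
    filter_upwards [φ.open_target.mem_nhds hx] with y hy using hΦ.eq_symm y hy
  have h4 : (mfderiv (𝓡 4) (𝓡 4) Φ x : E4 →L[ℝ] E4) = mfderiv (𝓡 4) (𝓡 4) φ.symm x :=
    h3.mfderiv_eq
  have h5 : (fderiv ℝ (fun y => e (Φ y)) x : E4 → E4)
      = fun v => (mfderiv (𝓡 4) (𝓡 4) e (Φ x) : E4 →L[ℝ] E4)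
        ((mfderiv (𝓡 4) (𝓡 4) φ.symm x : E4 →L[ℝ] E4) v) := by
    funext v
    rw [← h4]
    exact (mfderiv_chart_comp he hΦ.isOpen hΦ.smooth hxW hxe v).symm
  rw [h5]
  exact h1.comp h2

end FinslerSpacetime

namespace FinslerSpacetime

variable {M : Type*} [TopologicalSpace M] [ChartedSpace E4 M] [IsManifold (𝓡 4) ∞ M]
  {S : FinslerSpacetime M} {e φ : OpenPartialHomeomorph M E4} {W : Set E4} {Φ : E4 → M}
  {f : M → ℝ} {N : ∀ q : M, TangentSpace (𝓡 4) q}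

/-- Inside the range this is the admissibility of `N`; outside it is part of the assumed geodesic
condition. -/
lemma coordVec_mem_Abar (hφ : S.IsLightlikeChart f N φ) (hΦ : S.IsContinuation φ W Φ)
    {x : E4} (hx : x ∈ W) : (⟨Φ x, coordVec Φ x 0⟩ : TangentBundle (𝓡 4) M) ∈ S.Abar := by
  by_cases hxt : x ∈ φ.target
  · exact coordVec_mem_Abar_of_target hφ hΦ hxt
  · have h1 := (hΦ.geodesic x ⟨hx, hxt⟩).1
    have hx' : line x (x 0) ∈ W := by rwa [line_self]
    rw [velocity_comp_line hΦ.isOpen hΦ.smooth hx'] at h1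
    have h2 : (⟨Φ (line x (x 0)), coordVec Φ (line x (x 0)) 0⟩ : TangentBundle (𝓡 4) M)
        = ⟨Φ x, coordVec Φ x 0⟩ := by rw [line_self]
    rw [← h2]
    exact h1

lemma covDeriv_chart_line (he : e ∈ IsManifold.maximalAtlas (𝓡 4) ∞ M)
    (hΦ : S.IsContinuation φ W Φ) {z : E4} {s : ℝ} (hs : line z s ∈ W ∩ Φ ⁻¹' e.source) :
    covDeriv (S.coordL e) (fun r => e (Φ (line z r))) (deriv fun r => e (Φ (line z r)))
      (deriv fun r => e (Φ (line z r))) s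
    = fderiv ℝ (fun y => fderiv ℝ (fun y => e (Φ y)) y (basisVec 0)) (line z s) (basisVec 0)
      + sprayVec (S.coordL e) (e (Φ (line z s)),
        fderiv ℝ (fun y => e (Φ y)) (line z s) (basisVec 0)) := by
  have hV := isOpen_chartDom (e := e) hΦ.isOpen hΦ.smooth
  have hψ := contDiffOn_chart he hΦ.smooth
  rw [covDeriv_velocity, deriv_deriv_comp_line (F := fun y => e (Φ y)) hV hψ hs,
    deriv_comp_line (F := fun y => e (Φ y)) hV hψ hs]

/-- In a chart, the `x⁰`-lines of the continuation satisfy the geodesic equation. -/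
theorem exists_chart_geodesics (hφ : S.IsLightlikeChart f N φ) (hΦ : S.IsContinuation φ W Φ)
    (he : e ∈ IsManifold.maximalAtlas (𝓡 4) ∞ M) :
    ∃ U A : Set (E4 × E4), IsChartFinsler (S.coordL e) U A ∧
      (∀ z : TangentBundle (𝓡 4) M, z.1 ∈ e.source → z ∈ S.Abar → liftTo e z ∈ U ∩ closure A) ∧
      (∀ x ∈ W ∩ Φ ⁻¹' e.source,
        (e (Φ x), fderiv ℝ (fun y => e (Φ y)) x (basisVec 0)) ∈ U ∩ closure A) ∧
      ∀ x ∈ W ∩ Φ ⁻¹' e.source,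
        fderiv ℝ (fun y => fderiv ℝ (fun y => e (Φ y)) y (basisVec 0)) x (basisVec 0)
          = - sprayVec (S.coordL e) (e (Φ x), fderiv ℝ (fun y => e (Φ y)) x (basisVec 0)) := by
  obtain ⟨U, A, H, hlift⟩ := S.exists_isChartFinsler he
  have hV := isOpen_chartDom (e := e) hΦ.isOpen hΦ.smooth
  have hψ := contDiffOn_chart he hΦ.smooth
  have hmem : ∀ x ∈ W ∩ Φ ⁻¹' e.source,
      (e (Φ x), fderiv ℝ (fun y => e (Φ y)) x (basisVec 0)) ∈ U ∩ closure A := by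
    intro x hx
    have h1 := hlift ⟨Φ x, coordVec Φ x 0⟩ hx.2 (coordVec_mem_Abar hφ hΦ hx.1)
    have h2 : liftTo e ⟨Φ x, coordVec Φ x 0⟩
        = (e (Φ x), fderiv ℝ (fun y => e (Φ y)) x (basisVec 0)) :=
      Prod.ext rfl (mfderiv_chart_comp he hΦ.isOpen hΦ.smooth hx.1 hx.2 _)
    rwa [h2] at h1
  refine ⟨U, A, H, hlift, hmem, fun x hx => ?_⟩
  by_cases hxt : x ∈ φ.target
  · have hV' : IsOpen ((W ∩ Φ ⁻¹' e.source) ∩ φ.target) := hV.inter φ.open_target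
    -- The momentum is `2 g_N(N, ·)`, so its components in the frame are twice the first row
    -- `(0,1,0,0)`.
    refine H.geodesic_of_null_frame hV' (hψ.mono Set.inter_subset_left)
      (fun y hy => hmem y hy.1) (fun y hy => ?_) (fun i => if i = 1 then 2 else 0)
      (fun y hy i => ?_) ⟨hx, hxt⟩ (fderiv_chart_bijective hφ hΦ he hxt hx.2).2
    · rw [← mfderiv_chart_comp he hΦ.isOpen hΦ.smooth hy.1.1 hy.1.2, S.coordL_mfderiv he hy.1.2]
      have h1 := normal_eq hφ hΦ hy.2
      rw [coordVec] at h1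
      rw [← h1]
      refine hφ.lightlike _ ?_
      rw [hΦ.eq_symm y hy.2]
      exact φ.map_target hy.2
    · have h1 := gram_eq (S := S) he hΦ.isOpen hΦ.smooth hy.1.1 hy.1.2 0 i
      rw [H.smooth.fundTensor_eq H.isOpen_dom (hmem y hy.1).1, H.matrixForm_dir (hmem y hy.1),
        gram_target hφ hΦ hy.2] at h1
      split_ifs at h1 ⊢ <;> linarith
  · have h1 := (hΦ.geodesic x ⟨hx.1, hxt⟩).2 e he (by
      show Φ (line x (x 0)) ∈ e.source
      rw [line_self]
      exact hx.2)
    rw [covDeriv_chart_line he hΦ (by rwa [line_self]), line_self] at h1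
    exact eq_neg_of_add_eq_zero_left h1

lemma isGeodesicAt_line (hφ : S.IsLightlikeChart f N φ) (hΦ : S.IsContinuation φ W Φ)
    {z : E4} {s : ℝ} (hs : line z s ∈ W) : S.IsGeodesicAt (fun r => Φ (line z r)) s := by
  refine ⟨?_, fun e he hse => ?_⟩
  · rw [velocity_comp_line hΦ.isOpen hΦ.smooth hs]
    exact coordVec_mem_Abar hφ hΦ hs
  · obtain ⟨U, A, H, -, -, hgeo⟩ := exists_chart_geodesics hφ hΦ he
    rw [covDeriv_chart_line he hΦ ⟨hs, hse⟩, hgeo _ ⟨hs, hse⟩, neg_add_cancel]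

/-! ### Jacobi fields read in a chart -/

/-- At time `s`, the vector field with chart expression `X` along the line through `z` solves the
linearized geodesic equation. -/
def IsLinearizedSolution (S : FinslerSpacetime M) (e : OpenPartialHomeomorph M E4) (Φ : E4 → M)
    (z : E4) (X : ℝ → E4) (s : ℝ) : Prop :=
  deriv (deriv X) s = - fderiv ℝ (sprayVec (S.coordL e))
    (e (Φ (line z s)), deriv (fun r => e (Φ (line z r))) s) (X s, deriv X s)

lemma contDiffAt_chart_line (he : e ∈ IsManifold.maximalAtlas (𝓡 4) ∞ M)
    (hΦ : S.IsContinuation φ W Φ) {z : E4} {s : ℝ} (hs : line z s ∈ W ∩ Φ ⁻¹' e.source) :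
    ContDiffAt ℝ ∞ (fun r => e (Φ (line z r))) s :=
  contDiffAt_comp_line (F := fun y => e (Φ y)) ((contDiffOn_chart he hΦ.smooth).contDiffAt
    ((isOpen_chartDom hΦ.isOpen hΦ.smooth).mem_nhds hs))

lemma contDiffAt_chart_field (he : e ∈ IsManifold.maximalAtlas (𝓡 4) ∞ M) {γ : ℝ → M}
    {I : Set ℝ} (hI : IsOpen I) {J : ∀ s, TangentSpace (𝓡 4) (γ s)}
    (hJ : ContMDiffOn 𝓘(ℝ, ℝ) (𝓡 4).tangent ∞ (fun s => (⟨γ s, J s⟩ : TangentBundle (𝓡 4) M)) I)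
    {s : ℝ} (hs : s ∈ I) (hse : γ s ∈ e.source) :
    ContDiffAt ℝ ∞ (fun r => (mfderiv (𝓡 4) (𝓡 4) e (γ r) (J r) : E4)) s := by
  have h1 : ContMDiffAt (𝓡 4).tangent 𝓘(ℝ, E4 × E4) ∞ (liftTo e)
      (⟨γ s, J s⟩ : TangentBundle (𝓡 4) M) :=
    (contMDiffOn_liftTo e.open_source (contMDiffOn_of_mem_maximalAtlas he)).contMDiffAt
      ((isOpen_proj_preimage e.open_source).mem_nhds hse)
  have h2 := ContMDiffAt.comp s h1 (hJ.contMDiffAt (hI.mem_nhds hs))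
  exact (contMDiffAt_iff_contDiffAt.1 h2).snd

lemma jacobi_iff_linearized (hφ : S.IsLightlikeChart f N φ) (hΦ : S.IsContinuation φ W Φ)
    (he : e ∈ IsManifold.maximalAtlas (𝓡 4) ∞ M) {z : E4} {s : ℝ}
    (hs : line z s ∈ W ∩ Φ ⁻¹' e.source) {X : ℝ → E4} (hX : ContDiffAt ℝ ∞ X s) :
    covDeriv (S.coordL e) (fun r => e (Φ (line z r))) (deriv fun r => e (Φ (line z r)))
        (covDeriv (S.coordL e) (fun r => e (Φ (line z r))) (deriv fun r => e (Φ (line z r))) X) s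
      = - curvVec (S.coordL e) (e (Φ (line z s))) (deriv (fun r => e (Φ (line z r))) s)
        (X s) (deriv (fun r => e (Φ (line z r))) s) (deriv (fun r => e (Φ (line z r))) s)
    ↔ S.IsLinearizedSolution e Φ z X s := by
  obtain ⟨U, A, H, -, hmem, hgeo⟩ := exists_chart_geodesics hφ hΦ he
  have hV := isOpen_chartDom (e := e) hΦ.isOpen hΦ.smooth
  have hψ := contDiffOn_chart he hΦ.smooth
  have hd := deriv_comp_line (F := fun y => e (Φ y)) hV hψ hs
  have hdd := deriv_deriv_comp_line (F := fun y => e (Φ y)) hV hψ hs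
  refine H.jacobi_iff (x := fun r => e (Φ (line z r))) (contDiffAt_chart_line he hΦ hs) hX ?_ ?_
  · rw [hd]; exact hmem _ hs
  · rw [hd, hdd]; exact hgeo _ hs

lemma IsLinearizedSolution.congr {z : E4} {s : ℝ} {X Y : ℝ → E4}
    (h : S.IsLinearizedSolution e Φ z X s) (hXY : Y =ᶠ[𝓝 s] X) :
    S.IsLinearizedSolution e Φ z Y s := by
  rw [IsLinearizedSolution, hXY.deriv.deriv_eq, hXY.deriv_eq, hXY.self_of_nhds]
  exact h

lemma IsLinearizedSolution.add {z : E4} {s : ℝ} {X Y : ℝ → E4} (hX : ContDiffAt ℝ ∞ X s)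
    (hY : ContDiffAt ℝ ∞ Y s) (h : S.IsLinearizedSolution e Φ z X s)
    (h' : S.IsLinearizedSolution e Φ z Y s) :
    S.IsLinearizedSolution e Φ z (fun r => X r + Y r) s := by
  have h1 : deriv (fun r => X r + Y r) =ᶠ[𝓝 s] fun r => deriv X r + deriv Y r := by
    filter_upwards [hX.eventually_hasDerivAt, hY.eventually_hasDerivAt] with r h1 h2
      using (h1.add h2).deriv
  have h2 : deriv (fun r => deriv X r + deriv Y r) s = deriv (deriv X) s + deriv (deriv Y) s :=
    (hX.hasDerivAt_deriv.add hY.hasDerivAt_deriv).deriv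
  rw [IsLinearizedSolution, h1.deriv_eq, h1.self_of_nhds, h2, h, h', ← Prod.mk_add_mk, map_add,
    neg_add]

lemma IsLinearizedSolution.const_smul {z : E4} {s : ℝ} {X : ℝ → E4} (c : ℝ)
    (hX : ContDiffAt ℝ ∞ X s) (h : S.IsLinearizedSolution e Φ z X s) :
    S.IsLinearizedSolution e Φ z (fun r => c • X r) s := by
  have h1 : deriv (fun r => c • X r) =ᶠ[𝓝 s] fun r => c • deriv X r := by
    filter_upwards [hX.eventually_hasDerivAt] with r h1 using (h1.const_smul c).deriv
  have h2 : deriv (fun r => c • deriv X r) s = c • deriv (deriv X) s :=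
    (hX.hasDerivAt_deriv.const_smul c).deriv
  rw [IsLinearizedSolution, h1.deriv_eq, h1.self_of_nhds, h2, h, ← Prod.smul_mk, map_smul,
    smul_neg]

/-- The field along the line through `z` induced by a variation of the line in the direction `w`
and a reparametrization. -/
def variationField (Φ : E4 → M) (z w : E4) (c b s : ℝ) : TangentSpace (𝓡 4) (Φ (line z s)) :=
  mfderiv (𝓡 4) (𝓡 4) Φ (line z s) (w + (c * (s - b)) • basisVec 0)

lemma chart_variationField (he : e ∈ IsManifold.maximalAtlas (𝓡 4) ∞ M)
    (hΦ : S.IsContinuation φ W Φ) {z : E4} {s : ℝ} (hs : line z s ∈ W ∩ Φ ⁻¹' e.source)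
    (w : E4) (c b : ℝ) :
    mfderiv (𝓡 4) (𝓡 4) e (Φ (line z s)) (variationField Φ z w c b s)
      = fderiv ℝ (fun y => e (Φ y)) (line z s) w
        + c • ((s - b) • deriv (fun r => e (Φ (line z r))) s) := by
  rw [variationField, mfderiv_chart_comp he hΦ.isOpen hΦ.smooth hs.1 hs.2, map_add, map_smul,
    deriv_comp_line (F := fun y => e (Φ y)) (isOpen_chartDom hΦ.isOpen hΦ.smooth)
      (contDiffOn_chart he hΦ.smooth) hs, mul_smul]

lemma contMDiffOn_variationField (hΦ : S.IsContinuation φ W Φ) {z : E4} {I : Set ℝ}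
    (hI : ∀ s ∈ I, line z s ∈ W) (w : E4) (c b : ℝ) :
    ContMDiffOn 𝓘(ℝ, ℝ) (𝓡 4).tangent ∞
      (fun s => (⟨Φ (line z s), variationField Φ z w c b s⟩ : TangentBundle (𝓡 4) M)) I := by
  have h1 : ContDiff ℝ ∞ (fun s : ℝ => (line z s, w + (c * (s - b)) • basisVec 0)) := by
    refine (contDiff_line z).prodMk ?_
    fun_prop
  exact (contMDiffOn_liftFrom hΦ.isOpen hΦ.smooth).comp h1.contMDiff.contMDiffOn hI

lemma isLinearizedSolution_variationField (hφ : S.IsLightlikeChart f N φ)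
    (hΦ : S.IsContinuation φ W Φ) (he : e ∈ IsManifold.maximalAtlas (𝓡 4) ∞ M) {z : E4} {s : ℝ}
    (hs : line z s ∈ W ∩ Φ ⁻¹' e.source) (w : E4) (c b : ℝ) :
    S.IsLinearizedSolution e Φ z
      (fun r => mfderiv (𝓡 4) (𝓡 4) e (Φ (line z r)) (variationField Φ z w c b r)) s := by
  obtain ⟨U, A, H, -, hmem, hgeo⟩ := exists_chart_geodesics hφ hΦ he
  have hV := isOpen_chartDom (e := e) hΦ.isOpen hΦ.smooth
  have hψ := contDiffOn_chart he hΦ.smooth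
  have hx := contDiffAt_chart_line he hΦ hs
  have hev : (fun r => (mfderiv (𝓡 4) (𝓡 4) e (Φ (line z r)) (variationField Φ z w c b r) : E4))
      =ᶠ[𝓝 s] fun r => fderiv ℝ (fun y => e (Φ y)) (line z r) w
        + c • ((r - b) • deriv (fun r => e (Φ (line z r))) r) := by
    filter_upwards [eventually_line_mem hV hs] with r hr using chart_variationField he hΦ hr w c b
  refine IsLinearizedSolution.congr ?_ hev
  have hs1 : ContDiffAt ℝ ∞ (fun r => fderiv ℝ (fun y => e (Φ y)) (line z r) w) s :=
    contDiffAt_comp_line (F := fun y => fderiv ℝ (fun y => e (Φ y)) y w)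
      ((hψ.contDiffAt (hV.mem_nhds hs)).fderiv_apply_const w)
  have hs2 : ContDiffAt ℝ ∞ (fun r => (r - b) • deriv (fun r => e (Φ (line z r))) r) s :=
    (contDiffAt_id.sub contDiffAt_const).smul hx.deriv_smooth
  refine IsLinearizedSolution.add hs1 (hs2.const_smul c) ?_ (IsLinearizedSolution.const_smul c hs2 ?_)
  · exact H.linearized_of_variation (ψ := fun y => e (Φ y)) hV hψ (fun y hy => (hmem y hy).1) hgeo hs w
  · refine H.linearized_tangential (x := fun r => e (Φ (line z r))) hx ?_ ?_
    · rw [deriv_comp_line (F := fun y => e (Φ y)) hV hψ hs]; exact hmem _ hs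
    · filter_upwards [eventually_line_mem hV hs] with r hr
      rw [deriv_deriv_comp_line (F := fun y => e (Φ y)) hV hψ hr,
        deriv_comp_line (F := fun y => e (Φ y)) hV hψ hr]
      exact hgeo _ hr

lemma isJacobiField_variationField (hφ : S.IsLightlikeChart f N φ)
    (hΦ : S.IsContinuation φ W Φ) {z : E4} {I : Set ℝ} (hIo : IsOpen I)
    (hI : ∀ s ∈ I, line z s ∈ W) (w : E4) (c b : ℝ) :
    S.IsJacobiField (fun s => Φ (line z s)) I (variationField Φ z w c b) := by
  have hs := contMDiffOn_variationField hΦ hI w c b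
  refine ⟨hs, fun e he s hsI hse => ?_⟩
  exact (jacobi_iff_linearized hφ hΦ he ⟨hI s hsI, hse⟩
    (contDiffAt_chart_field he hIo hs hsI hse)).2
    (isLinearizedSolution_variationField hφ hΦ he ⟨hI s hsI, hse⟩ w c b)

end FinslerSpacetime

/-- A function with vanishing second derivative on an interval is affine. -/
lemma affine_of_deriv_deriv_eq_zero {F : ℝ → ℝ} {I : Set ℝ} (hI : IsOpen I)
    (hI' : I.OrdConnected)
    (hF : ∀ s ∈ I, DifferentiableAt ℝ F s ∧ HasDerivAt (deriv F) 0 s) {b s : ℝ} (hb : b ∈ I)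
    (hs : s ∈ I) : F s = F b + deriv F b * (s - b) := by
  have hpre : IsPreconnected I := hI'.isPreconnected
  have h1 : ∀ r ∈ I, deriv F r = deriv F b := fun r hr =>
    hI.is_const_of_deriv_eq_zero hpre
      (fun r hr => (hF r hr).2.differentiableAt.differentiableWithinAt)
      (fun r hr => (hF r hr).2.deriv) hr hb
  have h2 : ∀ r ∈ I, HasDerivAt (fun r => F r - deriv F b * (r - b)) 0 r := fun r hr => by
    have h3 : HasDerivAt (fun r => deriv F b * (r - b)) (deriv F b * 1) r :=
      ((hasDerivAt_id r).sub_const b).const_mul _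
    have h4 := (hF r hr).1.hasDerivAt.sub h3
    rw [h1 r hr, mul_one, sub_self] at h4
    exact h4
  have h3 := hI.is_const_of_deriv_eq_zero hpre
    (fun r hr => (h2 r hr).differentiableAt.differentiableWithinAt)
    (fun r hr => (h2 r hr).deriv) hs hb
  simp only [sub_self, mul_zero, sub_zero] at h3
  linarith

/-! ### Uniqueness of Jacobi fields and the affine law for `g_N(N, J)` -/

namespace FinslerSpacetime

variable {M : Type*} [TopologicalSpace M] [ChartedSpace E4 M] [IsManifold (𝓡 4) ∞ M]
  {S : FinslerSpacetime M} {e φ : OpenPartialHomeomorph M E4} {W : Set E4} {Φ : E4 → M}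
  {f : M → ℝ} {N : ∀ q : M, TangentSpace (𝓡 4) q} {z : E4} {I : Set ℝ}
  {J K : ∀ s, TangentSpace (𝓡 4) (Φ (line z s))}

/-- The components of a tangent vector in the chart `e`. -/
def chartVec (e : OpenPartialHomeomorph M E4) {q : M} (u : TangentSpace (𝓡 4) q) : E4 :=
  mfderiv (𝓡 4) (𝓡 4) e q u

lemma IsJacobiField.isLinearizedSolution (hφ : S.IsLightlikeChart f N φ)
    (hΦ : S.IsContinuation φ W Φ) (he : e ∈ IsManifold.maximalAtlas (𝓡 4) ∞ M) (hIo : IsOpen I)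
    (hI : ∀ s ∈ I, line z s ∈ W) (hJ : S.IsJacobiField (fun s => Φ (line z s)) I J) {s : ℝ}
    (hs : s ∈ I) (hse : Φ (line z s) ∈ e.source) :
    S.IsLinearizedSolution e Φ z (fun r => mfderiv (𝓡 4) (𝓡 4) e (Φ (line z r)) (J r)) s :=
  (jacobi_iff_linearized hφ hΦ he ⟨hI s hs, hse⟩
    (contDiffAt_chart_field he hIo hJ.1 hs hse)).1 (hJ.2 e he s hs hse)

lemma eventually_mem_chart (hΦ : S.IsContinuation φ W Φ) (hIo : IsOpen I)
    (hI : ∀ s ∈ I, line z s ∈ W) {s : ℝ} (hs : s ∈ I) (hse : Φ (line z s) ∈ e.source) :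
    ∀ᶠ r in 𝓝 s, r ∈ I ∧ Φ (line z r) ∈ e.source := by
  filter_upwards [hIo.mem_nhds hs, eventually_line_mem
    (isOpen_chartDom (e := e) hΦ.isOpen hΦ.smooth) ⟨hI s hs, hse⟩] with r h1 h2 using ⟨h1, h2.2⟩

lemma mfderiv_chart_injective (he : e ∈ IsManifold.maximalAtlas (𝓡 4) ∞ M) {q : M}
    (hq : q ∈ e.source) : Function.Injective (mfderiv (𝓡 4) (𝓡 4) e q) :=
  (mdifferentiable_of_mem_maximalAtlas he).mfderiv_injective hq

/-- The difference, read in the chart, solves a linear equation with zero initial data; the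
differential of the chart is injective. -/
lemma jacobi_eventually_eq (hφ : S.IsLightlikeChart f N φ) (hΦ : S.IsContinuation φ W Φ)
    (he : e ∈ IsManifold.maximalAtlas (𝓡 4) ∞ M) (hIo : IsOpen I) (hI : ∀ s ∈ I, line z s ∈ W)
    (hJ : S.IsJacobiField (fun s => Φ (line z s)) I J)
    (hK : S.IsJacobiField (fun s => Φ (line z s)) I K) {s : ℝ} (hs : s ∈ I)
    (hse : Φ (line z s) ∈ e.source)
    (h0 : chartVec e (J s)
      = chartVec e (K s))
    (h1 : deriv (fun r => chartVec e (J r)) s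
      = deriv (fun r => chartVec e (K r)) s) :
    ∀ᶠ r in 𝓝 s, J r = K r := by
  obtain ⟨U, A, H, -, hmem, -⟩ := exists_chart_geodesics hφ hΦ he
  have hV := isOpen_chartDom (e := e) hΦ.isOpen hΦ.smooth
  have hψ := contDiffOn_chart he hΦ.smooth
  have hJs : ∀ r ∈ I, Φ (line z r) ∈ e.source → ContDiffAt ℝ ∞
      (fun r => chartVec e (J r)) r := fun r hr hre =>
    contDiffAt_chart_field he hIo hJ.1 hr hre
  have hKs : ∀ r ∈ I, Φ (line z r) ∈ e.source → ContDiffAt ℝ ∞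
      (fun r => (-1 : ℝ) • chartVec e (K r)) r := fun r hr hre =>
    (contDiffAt_chart_field he hIo hK.1 hr hre).const_smul _
  have hev := eventually_mem_chart hΦ hIo hI hs hse
  have huniq := H.linearized_unique (x := fun r => e (Φ (line z r)))
    (X := fun r => chartVec e (J r)
      + (-1 : ℝ) • chartVec e (K r))
    (contDiffAt_chart_line he hΦ ⟨hI s hs, hse⟩) ((hJs s hs hse).add (hKs s hs hse))
    (by
      rw [deriv_comp_line (F := fun y => e (Φ y)) hV hψ ⟨hI s hs, hse⟩]
      exact (hmem _ ⟨hI s hs, hse⟩).1)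
    (by
      filter_upwards [hev] with r hr
      exact IsLinearizedSolution.add (hJs r hr.1 hr.2) (hKs r hr.1 hr.2)
        (hJ.isLinearizedSolution hφ hΦ he hIo hI hr.1 hr.2)
        (IsLinearizedSolution.const_smul (-1) (contDiffAt_chart_field he hIo hK.1 hr.1 hr.2)
          (hK.isLinearizedSolution hφ hΦ he hIo hI hr.1 hr.2)))
    (by simp only [h0]; module)
    (by
      have h2 := ((hJs s hs hse).eventually_hasDerivAt.self_of_nhds.add
        (hKs s hs hse).eventually_hasDerivAt.self_of_nhds).deriv
      refine h2.trans ?_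
      have h3 : deriv (fun r => (-1 : ℝ) • chartVec e (K r)) s
          = (-1 : ℝ) • deriv (fun r => chartVec e (K r)) s :=
        ((contDiffAt_chart_field he hIo hK.1 hs
          hse).eventually_hasDerivAt.self_of_nhds.const_smul (-1 : ℝ)).deriv
      rw [h1, h3]
      module)
  filter_upwards [huniq, hev] with r hr hr'
  refine mfderiv_chart_injective he hr'.2 ?_
  have h4 : chartVec e (J r)
      - chartVec e (K r) = 0 := by
    rw [← hr]; module
  exact sub_eq_zero.1 h4

/-- A Jacobi field is determined by its initial data in a chart. -/
theorem jacobi_unique (hφ : S.IsLightlikeChart f N φ) (hΦ : S.IsContinuation φ W Φ)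
    (he : e ∈ IsManifold.maximalAtlas (𝓡 4) ∞ M) (hIo : IsOpen I) (hI' : I.OrdConnected)
    (hI : ∀ s ∈ I, line z s ∈ W)
    (hJ : S.IsJacobiField (fun s => Φ (line z s)) I J)
    (hK : S.IsJacobiField (fun s => Φ (line z s)) I K) {b : ℝ} (hb : b ∈ I)
    (hbe : Φ (line z b) ∈ e.source)
    (h0 : chartVec e (J b)
      = chartVec e (K b))
    (h1 : deriv (fun r => chartVec e (J r)) b
      = deriv (fun r => chartVec e (K r)) b)
    {s : ℝ} (hs : s ∈ I) : J s = K s := by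
  have hopen : IsOpen {s | ∀ᶠ r in 𝓝 s, J r = K r} := isOpen_setOfPred_eventually_nhds
  have hsub : I ⊆ {s | ∀ᶠ r in 𝓝 s, J r = K r} := by
    -- The times near which the fields agree form an open set. At a limit point in `I`, values and
    -- derivatives agree by continuity in a chart there, so the local uniqueness applies again and
    -- connectedness gives all of `I`.
    refine hI'.isPreconnected.subset_of_closure_inter_subset hopen
      ⟨b, hb, jacobi_eventually_eq hφ hΦ he hIo hI hJ hK hb hbe h0 h1⟩ ?_
    rintro s ⟨hsc, hsI⟩
    have hce := IsManifold.chart_mem_maximalAtlas (I := 𝓡 4) (n := ∞) (Φ (line z s))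
    have hse := mem_chart_source E4 (Φ (line z s))
    have hJs : ContDiffAt ℝ ∞ (fun r => chartVec (chartAt E4 (Φ (line z s))) (J r)) s :=
      contDiffAt_chart_field hce hIo hJ.1 hsI hse
    have hKs : ContDiffAt ℝ ∞ (fun r => chartVec (chartAt E4 (Φ (line z s))) (K r)) s :=
      contDiffAt_chart_field hce hIo hK.1 hsI hse
    have hfreq := mem_closure_iff_frequently.1 hsc
    refine jacobi_eventually_eq hφ hΦ hce hIo hI hJ hK hsI hse ?_ ?_
    · refine tendsto_nhds_unique_of_frequently_eq hJs.continuousAt.tendsto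
        hKs.continuousAt.tendsto (hfreq.mono fun r hr => ?_)
      rw [hr.self_of_nhds]
    · refine tendsto_nhds_unique_of_frequently_eq hJs.deriv_smooth.continuousAt.tendsto
        hKs.deriv_smooth.continuousAt.tendsto (hfreq.mono fun r hr => ?_)
      refine Filter.EventuallyEq.deriv_eq ?_
      filter_upwards [hr] with t ht
      rw [ht]
  exact (hsub hs).self_of_nhds

/-- `g_N(N, u)` in terms of the momentum in a chart. -/
lemma g_self_chart (hΦ : S.IsContinuation φ W Φ)
    (he : e ∈ IsManifold.maximalAtlas (𝓡 4) ∞ M) {U A : Set (E4 × E4)}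
    (H : IsChartFinsler (S.coordL e) U A)
    (hmem : ∀ x ∈ W ∩ Φ ⁻¹' e.source,
        (e (Φ x), fderiv ℝ (fun y => e (Φ y)) x (basisVec 0)) ∈ U ∩ closure A)
    {s : ℝ} (hs : line z s ∈ W ∩ Φ ⁻¹' e.source) (u : TangentSpace (𝓡 4) (Φ (line z s))) :
    S.g (coordVec Φ (line z s) 0) (coordVec Φ (line z s) 0) u
      = (1 / 2) * ∑ l, dDir (S.coordL e) (e (Φ (line z s)))
        (deriv (fun r => e (Φ (line z r))) s) l
        * chartVec e u l := by
  rw [S.g_eq_fundTensor_coordL he hs.2, deriv_comp_line (F := fun y => e (Φ y))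
    (isOpen_chartDom hΦ.isOpen hΦ.smooth) (contDiffOn_chart he hΦ.smooth) hs, coordVec,
    mfderiv_chart_comp he hΦ.isOpen hΦ.smooth hs.1 hs.2]
  exact (H.smooth.fundTensor_eq H.isOpen_dom (hmem _ hs).1 _ (chartVec e u)).trans
    (H.matrixForm_dir (hmem _ hs) _)

/-- For a Jacobi field `J` along a geodesic, `g_γ'(γ', J)` is affine. -/
theorem IsJacobiField.affine (hφ : S.IsLightlikeChart f N φ) (hΦ : S.IsContinuation φ W Φ)
    (hIo : IsOpen I) (hI' : I.OrdConnected) (hI : ∀ s ∈ I, line z s ∈ W)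
    (hJ : S.IsJacobiField (fun s => Φ (line z s)) I J) {b s : ℝ} (hb : b ∈ I) (hs : s ∈ I) :
    S.g (coordVec Φ (line z s) 0) (coordVec Φ (line z s) 0) (J s)
      = S.g (coordVec Φ (line z b) 0) (coordVec Φ (line z b) 0) (J b)
        + deriv (fun r => S.g (coordVec Φ (line z r) 0) (coordVec Φ (line z r) 0) (J r)) b
          * (s - b) := by
  refine affine_of_deriv_deriv_eq_zero
    (F := fun r => S.g (coordVec Φ (line z r) 0) (coordVec Φ (line z r) 0) (J r)) hIo hI'
    (fun s hs => ?_) hb hs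
  have he := IsManifold.chart_mem_maximalAtlas (I := 𝓡 4) (n := ∞) (Φ (line z s))
  have hse := mem_chart_source E4 (Φ (line z s))
  generalize chartAt E4 (Φ (line z s)) = e at he hse
  obtain ⟨U, A, H, -, hmem, hgeo⟩ := exists_chart_geodesics hφ hΦ he
  have hV := isOpen_chartDom (e := e) hΦ.isOpen hΦ.smooth
  have hψ := contDiffOn_chart he hΦ.smooth
  have hev := eventually_mem_chart hΦ hIo hI hs hse
  -- The first derivative is required at all nearby times because it is differentiated once more.
  -- The factor `1/2` appears because the momentum is twice `g_N(N, ·)`.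
  have hderiv : ∀ r ∈ I, Φ (line z r) ∈ e.source →
      HasDerivAt (fun r => S.g (coordVec Φ (line z r) 0) (coordVec Φ (line z r) 0) (J r))
        ((1 / 2) * fderiv ℝ (Function.uncurry (S.coordL e))
          (e (Φ (line z r)), deriv (fun r => e (Φ (line z r))) r)
          (chartVec e (J r),
            deriv (fun r => chartVec e (J r)) r)) r := by
    intro r hr hre
    have hVr : line z r ∈ W ∩ Φ ⁻¹' e.source := ⟨hI r hr, hre⟩
    have h1 := H.hasDerivAt_momentum (x := fun r => e (Φ (line z r)))
      (contDiffAt_chart_line he hΦ hVr) (contDiffAt_chart_field he hIo hJ.1 hr hre)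
      (by rw [deriv_comp_line (F := fun y => e (Φ y)) hV hψ hVr]; exact hmem _ hVr)
      (by
        rw [deriv_deriv_comp_line (F := fun y => e (Φ y)) hV hψ hVr,
          deriv_comp_line (F := fun y => e (Φ y)) hV hψ hVr]
        exact hgeo _ hVr)
    refine (h1.const_mul (1 / 2)).congr_of_eventuallyEq ?_
    filter_upwards [eventually_line_mem hV hVr] with t ht using
      g_self_chart hΦ he H hmem ht (J t)
  refine ⟨(hderiv s hs hse).differentiableAt, ?_⟩
  have hVs : line z s ∈ W ∩ Φ ⁻¹' e.source := ⟨hI s hs, hse⟩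
  have h2 := H.hasDerivAt_fderiv_momentum (x := fun r => e (Φ (line z r)))
      (contDiffAt_chart_line he hΦ hVs) (contDiffAt_chart_field he hIo hJ.1 hs hse)
      (by rw [deriv_comp_line (F := fun y => e (Φ y)) hV hψ hVs]; exact hmem _ hVs)
      (by
        rw [deriv_deriv_comp_line (F := fun y => e (Φ y)) hV hψ hVs,
          deriv_comp_line (F := fun y => e (Φ y)) hV hψ hVs]
        exact hgeo _ hVs)
      (hJ.isLinearizedSolution hφ hΦ he hIo hI hs hse)
  have h3 := h2.const_mul (1 / 2)
  rw [mul_zero] at h3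
  refine h3.congr_of_eventuallyEq ?_
  filter_upwards [hev] with r hr using (hderiv r hr.1 hr.2).deriv

/-- The first row of the matrix `g_ij(N)` is `(0,1,0,0)` along the continued geodesic. -/
theorem gram_line (hφ : S.IsLightlikeChart f N φ) (hΦ : S.IsContinuation φ W Φ)
    (hIo : IsOpen I) (hI' : I.OrdConnected) (hI : ∀ s ∈ I, line z s ∈ W) {b s : ℝ} (hb : b ∈ I)
    (hbφ : line z b ∈ φ.target) (hs : s ∈ I) (i : Fin 4) :
    S.gram Φ (line z s) 0 i = if i = 1 then 1 else 0 := by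
  -- `∂_i` is itself a variation field, so `g_N(N, ∂_i)` is affine along the line. It is constant
  -- near `b`, hence everywhere.
  have hJ := isJacobiField_variationField hφ hΦ hIo hI (basisVec i) 0 0
  have h1 := hJ.affine hφ hΦ hIo hI' hI hb hs
  have h2 : ∀ r, variationField Φ z (basisVec i) 0 0 r = coordVec Φ (line z r) i := fun r => by
    simp [variationField, coordVec]
  simp only [h2] at h1
  have h3 : (fun r => S.gram Φ (line z r) 0 i) =ᶠ[𝓝 b] fun _ => if i = 1 then 1 else 0 := by
    filter_upwards [eventually_line_mem φ.open_target hbφ] with r hr using gram_target hφ hΦ hr i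
  have h4 : deriv (fun r => S.gram Φ (line z r) 0 i) b = 0 := by
    rw [h3.deriv_eq, deriv_const]
  have h5 : S.gram Φ (line z s) 0 i = S.gram Φ (line z b) 0 i
    + deriv (fun r => S.gram Φ (line z r) 0 i) b * (s - b) := h1
  rw [h5, h4, gram_target hφ hΦ hbφ i, zero_mul, add_zero]

end FinslerSpacetime

namespace FinslerSpacetime

variable {M : Type*} [TopologicalSpace M] [ChartedSpace E4 M] [IsManifold (𝓡 4) ∞ M]
  {S : FinslerSpacetime M} {e φ : OpenPartialHomeomorph M E4} {W : Set E4} {Φ : E4 → M}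
  {f : M → ℝ} {N : ∀ q : M, TangentSpace (𝓡 4) q} {z : E4} {I : Set ℝ}

/-! ### The degeneracy of the coordinate vectors -/

lemma chartVec_mfderiv (he : e ∈ IsManifold.maximalAtlas (𝓡 4) ∞ M)
    (hΦ : S.IsContinuation φ W Φ) {x : E4} (hx : x ∈ W ∩ Φ ⁻¹' e.source) (v : E4) :
    chartVec e (mfderiv (𝓡 4) (𝓡 4) Φ x v) = fderiv ℝ (fun y => e (Φ y)) x v :=
  mfderiv_chart_comp he hΦ.isOpen hΦ.smooth hx.1 hx.2 v

lemma chartVec_eq_zero (he : e ∈ IsManifold.maximalAtlas (𝓡 4) ∞ M) {q : M} (hq : q ∈ e.source)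
    {u : TangentSpace (𝓡 4) q} : chartVec e u = 0 ↔ u = 0 :=
  ⟨fun h => mfderiv_chart_injective he hq (h.trans (map_zero (mfderiv (𝓡 4) (𝓡 4) e q)).symm),
    fun h => h ▸ map_zero (mfderiv (𝓡 4) (𝓡 4) e q)⟩

lemma fderiv_eq_zero_iff (he : e ∈ IsManifold.maximalAtlas (𝓡 4) ∞ M)
    (hΦ : S.IsContinuation φ W Φ) {x : E4} (hx : x ∈ W ∩ Φ ⁻¹' e.source) (v : E4) :
    fderiv ℝ (fun y => e (Φ y)) x v = 0 ↔ mfderiv (𝓡 4) (𝓡 4) Φ x v = 0 := by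
  rw [← chartVec_mfderiv he hΦ hx, chartVec_eq_zero he hx.2]

lemma mfderiv_eq_zero_of_target (hφ : S.IsLightlikeChart f N φ) (hΦ : S.IsContinuation φ W Φ)
    {x : E4} (hx : x ∈ φ.target) {v : E4} (h : mfderiv (𝓡 4) (𝓡 4) Φ x v = 0) : v = 0 := by
  have hxs : Φ x ∈ φ.source := by rw [hΦ.eq_symm x hx]; exact φ.map_target hx
  refine (fderiv_chart_bijective hφ hΦ hφ.mem_atlas hx hxs).1 ?_
  rw [(fderiv_eq_zero_iff hφ.mem_atlas hΦ ⟨hΦ.target_subset hx, hxs⟩ v).2 h, map_zero]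

/-- In a chart, `g_N` is a Lorentzian bilinear form. -/
lemma exists_lorentz_form (hφ : S.IsLightlikeChart f N φ) (hΦ : S.IsContinuation φ W Φ)
    (he : e ∈ IsManifold.maximalAtlas (𝓡 4) ∞ M) {x : E4} (hx : x ∈ W ∩ Φ ⁻¹' e.source) :
    ∃ G : E4 →ₗ[ℝ] E4 →ₗ[ℝ] ℝ, (∀ u w, fundTensor (S.coordL e (e (Φ x)))
        (fderiv ℝ (fun y => e (Φ y)) x (basisVec 0)) u w = G u w) ∧
      ∃ B : Module.Basis (Fin 4) ℝ E4, ∀ i j,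
        G (B i) (B j) = if i = j then (if i = 0 then 1 else -1) else 0 := by
  obtain ⟨U, A, H, -, hmem, -⟩ := exists_chart_geodesics hφ hΦ he
  have h1 := H.smooth.fundTensor_eq H.isOpen_dom (hmem x hx).1
  refine ⟨_, h1, ?_⟩
  obtain ⟨B, hB⟩ := S.exists_basis_coordL he (z := ⟨Φ x, coordVec Φ x 0⟩) hx.2
    (coordVec_mem_Abar hφ hΦ hx.1)
  refine ⟨B, fun i j => ?_⟩
  have h2 : (liftTo e ⟨Φ x, coordVec Φ x 0⟩).2 = fderiv ℝ (fun y => e (Φ y)) x (basisVec 0) :=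
    chartVec_mfderiv he hΦ hx _
  rw [← h1, ← hB i j, h2]
  rfl

/-- `Δ` vanishes exactly where a combination of `∂_2` and `∂_3` is a multiple of `∂_0`. -/
theorem delta_eq_zero_iff (hφ : S.IsLightlikeChart f N φ) (hΦ : S.IsContinuation φ W Φ) {x : E4}
    (hx : x ∈ W) (h0 : S.gram Φ x 0 0 = 0) (h2 : S.gram Φ x 0 2 = 0) (h3 : S.gram Φ x 0 3 = 0) :
    S.Delta Φ x = 0 ↔ ∃ a b μ : ℝ, (a ≠ 0 ∨ b ≠ 0) ∧
      mfderiv (𝓡 4) (𝓡 4) Φ x (a • basisVec 2 + b • basisVec 3 - μ • basisVec 0) = 0 := by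
  have he := IsManifold.chart_mem_maximalAtlas (I := 𝓡 4) (n := ∞) (Φ x)
  have hxe := mem_chart_source E4 (Φ x)
  generalize chartAt E4 (Φ x) = e at he hxe
  obtain ⟨G, hG, B, hB⟩ := exists_lorentz_form hφ hΦ he ⟨hx, hxe⟩
  have hgram : ∀ i j, S.gram Φ x i j = G (fderiv ℝ (fun y => e (Φ y)) x (basisVec i))
      (fderiv ℝ (fun y => e (Φ y)) x (basisVec j)) := fun i j => by
    rw [gram_eq he hΦ.isOpen hΦ.smooth hx hxe, hG]
  have hn : fderiv ℝ (fun y => e (Φ y)) x (basisVec 0) ≠ 0 := fun h =>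
    (coordVec_mem_Abar hφ hΦ hx).2 ((fderiv_eq_zero_iff he hΦ ⟨hx, hxe⟩ _).1 h)
  rw [hgram] at h0 h2 h3
  obtain ⟨hpos, hker⟩ := lorentz_null_orthogonal hB hn h0 h2 h3
  have hiff : ∀ a b μ : ℝ,
      mfderiv (𝓡 4) (𝓡 4) Φ x (a • basisVec 2 + b • basisVec 3 - μ • basisVec 0) = 0 ↔
      a • fderiv ℝ (fun y => e (Φ y)) x (basisVec 2) + b • fderiv ℝ (fun y => e (Φ y)) x (basisVec 3)
        = μ • fderiv ℝ (fun y => e (Φ y)) x (basisVec 0) := fun a b μ => by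
    rw [← fderiv_eq_zero_iff he hΦ ⟨hx, hxe⟩, map_sub, map_add, map_smul, map_smul, map_smul,
      sub_eq_zero]
  simp only [hiff]
  rw [Delta, Matrix.det_fin_two_of, hgram, hgram, hgram, hgram, Real.sqrt_eq_zero hpos]
  refine ⟨hker, ?_⟩
  rintro ⟨a, b, μ, hab, h⟩
  -- Pairing the relation with a vector orthogonal to `N` removes the multiple of `N`. For `∂_2` and
  -- `∂_3` this gives a linear system with a nontrivial solution, whose determinant must vanish.
  have hX : ∀ Y, G (fderiv ℝ (fun y => e (Φ y)) x (basisVec 0)) Y = 0 →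
      a * G (fderiv ℝ (fun y => e (Φ y)) x (basisVec 2)) Y
        + b * G (fderiv ℝ (fun y => e (Φ y)) x (basisVec 3)) Y = 0 := fun Y hY => by
    have := congrArg (fun T => G T Y) h
    simpa [hY] using this
  have hX2 := hX _ h2
  have hX3 := hX _ h3
  rcases hab with ha | hb
  · refine (mul_eq_zero.1 (?_ : a * _ = 0)).resolve_left ha
    linear_combination G (fderiv ℝ (fun y => e (Φ y)) x (basisVec 3))
      (fderiv ℝ (fun y => e (Φ y)) x (basisVec 3)) * hX2
      - G (fderiv ℝ (fun y => e (Φ y)) x (basisVec 3))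
      (fderiv ℝ (fun y => e (Φ y)) x (basisVec 2)) * hX3
  · refine (mul_eq_zero.1 (?_ : b * _ = 0)).resolve_left hb
    linear_combination G (fderiv ℝ (fun y => e (Φ y)) x (basisVec 2))
      (fderiv ℝ (fun y => e (Φ y)) x (basisVec 2)) * hX3
      - G (fderiv ℝ (fun y => e (Φ y)) x (basisVec 2))
      (fderiv ℝ (fun y => e (Φ y)) x (basisVec 3)) * hX2

lemma delta_ne_zero_of_target (hφ : S.IsLightlikeChart f N φ) (hΦ : S.IsContinuation φ W Φ)
    {x : E4} (hx : x ∈ φ.target) : S.Delta Φ x ≠ 0 := by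
  have hg := gram_target hφ hΦ hx
  rw [Ne, delta_eq_zero_iff hφ hΦ (hΦ.target_subset hx) (by simpa using hg 0) (by simpa using hg 2)
    (by simpa using hg 3)]
  rintro ⟨a, b, μ, hab, h⟩
  have h1 := mfderiv_eq_zero_of_target hφ hΦ hx h
  have h2 := congrArg (fun v : E4 => v 2) h1
  have h3 := congrArg (fun v : E4 => v 3) h1
  simp [basisVec_apply] at h2 h3
  simp [h2, h3] at hab

/-! ### The lightlike chart -/

lemma mem_source_of_target (hΦ : S.IsContinuation φ W Φ) {x : E4} (hx : x ∈ φ.target) :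
    x ∈ W ∩ Φ ⁻¹' φ.source :=
  ⟨hΦ.target_subset hx, by rw [Set.mem_preimage, hΦ.eq_symm x hx]; exact φ.map_target hx⟩

lemma chart_apply_target (hΦ : S.IsContinuation φ W Φ) {x : E4} (hx : x ∈ φ.target) :
    φ (Φ x) = x := by
  rw [hΦ.eq_symm x hx, φ.right_inv hx]

lemma fderiv_chart_target (hΦ : S.IsContinuation φ W Φ) {x : E4} (hx : x ∈ φ.target) (v : E4) :
    fderiv ℝ (fun y => φ (Φ y)) x v = v := by
  have h1 : (fun y => φ (Φ y)) =ᶠ[𝓝 x] id := by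
    filter_upwards [φ.open_target.mem_nhds hx] with y hy using chart_apply_target hΦ hy
  rw [h1.fderiv_eq, fderiv_id]
  rfl

lemma fderiv_fderiv_chart_target (hΦ : S.IsContinuation φ W Φ) {x : E4} (hx : x ∈ φ.target)
    (v w : E4) : fderiv ℝ (fun y => fderiv ℝ (fun y => φ (Φ y)) y v) x w = 0 := by
  have h1 : (fun y => fderiv ℝ (fun y => φ (Φ y)) y v) =ᶠ[𝓝 x] fun _ => v := by
    filter_upwards [φ.open_target.mem_nhds hx] with y hy using fderiv_chart_target hΦ hy v
  rw [h1.fderiv_eq]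
  simp

lemma eq_continuation_of_mem_source (hΦ : S.IsContinuation φ W Φ) {q : M} (hq : q ∈ φ.source) :
    Φ (φ q) = q := by
  rw [hΦ.eq_symm _ (φ.map_source hq), φ.left_inv hq]

/-- In the lightlike chart, `g_N(N, w)` is the component `w¹`. -/
lemma g_normal_eq (hφ : S.IsLightlikeChart f N φ) (hΦ : S.IsContinuation φ W Φ) {x : E4}
    (hx : x ∈ φ.target) (w : TangentSpace (𝓡 4) (Φ x)) :
    S.g (coordVec Φ x 0) (coordVec Φ x 0) w = chartVec φ w 1 := by
  have hxs := mem_source_of_target hΦ hx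
  obtain ⟨G, hG, -⟩ := exists_lorentz_form hφ hΦ hφ.mem_atlas hxs
  have h1 : S.g (coordVec Φ x 0) (coordVec Φ x 0) w = G (basisVec 0) (chartVec φ w) := by
    have h2 := hG (basisVec 0) (chartVec φ w)
    rw [← h2, S.g_eq_fundTensor_coordL hφ.mem_atlas hxs.2, coordVec,
      mfderiv_chart_comp hφ.mem_atlas hΦ.isOpen hΦ.smooth hxs.1 hxs.2, fderiv_chart_target hΦ hx]
    rfl
  have h3 : ∀ i, G (basisVec 0) (basisVec i) = if i = 1 then 1 else 0 := fun i => by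
    rw [← gram_target hφ hΦ hx i, gram_eq hφ.mem_atlas hΦ.isOpen hΦ.smooth hxs.1 hxs.2, hG]
    simp only [fderiv_chart_target hΦ hx]
  rw [h1, map_eq_sum_basisVec (G (basisVec 0))]
  simp [h3]

/-! ### Curves in the slices -/

lemma IsCurveIn.apply_zero {P : Set M} {q : M} {u : TangentSpace (𝓡 4) q} {α : ℝ → M}
    (hα : IsCurveIn P q u α) : α 0 = q :=
  congrArg (fun z : TangentBundle (𝓡 4) M => z.1) hα.2.2

lemma IsCurveIn.hasDerivAt_chart (he : e ∈ IsManifold.maximalAtlas (𝓡 4) ∞ M) {P : Set M} {q : M}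
    (hq : q ∈ e.source) {u : TangentSpace (𝓡 4) q} {α : ℝ → M} (hα : IsCurveIn P q u α) :
    HasDerivAt (fun r => e (α r)) (chartVec e u) 0 := by
  have hq0 : α 0 ∈ e.source := by rwa [hα.apply_zero]
  have h1 : MDifferentiableAt (𝓡 4) (𝓡 4) e (α 0) :=
    (mdifferentiable_of_mem_maximalAtlas he).mdifferentiableAt hq0
  have h2 : MDifferentiableAt 𝓘(ℝ, ℝ) (𝓡 4) α 0 := hα.1.mdifferentiableAt (by simp)
  have h3 := (h1.comp (0 : ℝ) h2).differentiableAt.hasDerivAt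
  refine h3.congr_deriv ?_
  have h4 : (liftTo e ⟨α 0, velocity α 0⟩).2 = (liftTo e ⟨q, u⟩).2 := by rw [hα.2.2]
  refine Eq.trans ?_ h4
  have h5 := mfderiv_comp (0 : ℝ) h1 h2
  rw [mfderiv_eq_fderiv] at h5
  exact congrArg (fun T => T (1 : ℝ)) h5

/-- The coordinates `x⁰` and `x¹` are constant along a curve in the slice. -/
lemma chartVec_of_tangentTo (hφ : S.IsLightlikeChart f N φ) {b c : ℝ} {q : M} (hq : q ∈ φ.source)
    {w : TangentSpace (𝓡 4) q} (hw : w ∈ tangentTo (slice φ b c) q) :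
    chartVec φ w 0 = 0 ∧ chartVec φ w 1 = 0 := by
  obtain ⟨α, hα⟩ := hw
  have h1 := hasDerivAt_E4.1 (hα.hasDerivAt_chart hφ.mem_atlas hq)
  constructor
  · refine (h1 0).unique ((hasDerivAt_const (0 : ℝ) b).congr_of_eventuallyEq ?_)
    filter_upwards [hα.2.1] with r hr using hr.2.1
  · refine (h1 1).unique ((hasDerivAt_const (0 : ℝ) c).congr_of_eventuallyEq ?_)
    filter_upwards [hα.2.1] with r hr using hr.2.2

lemma g_normal_of_tangentTo (hφ : S.IsLightlikeChart f N φ) (hΦ : S.IsContinuation φ W Φ)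
    {b c : ℝ} {q : M} (hq : q ∈ φ.source) {w : TangentSpace (𝓡 4) q}
    (hw : w ∈ tangentTo (slice φ b c) q) : S.g (N q) (N q) w = 0 := by
  obtain ⟨x, hx, rfl⟩ : ∃ x ∈ φ.target, Φ x = q :=
    ⟨φ q, φ.map_source hq, eq_continuation_of_mem_source hΦ hq⟩
  rw [normal_eq hφ hΦ hx, g_normal_eq hφ hΦ hx]
  exact (chartVec_of_tangentTo hφ hq hw).2

/-- The curve `t ↦ Φ(x + t v)` stays in the slice for small `t`, since `v` does not move `x⁰` and
`x¹`. -/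
lemma mem_tangentTo_slice (hΦ : S.IsContinuation φ W Φ) {x : E4} (hx : x ∈ φ.target) {v : E4}
    (h0 : v 0 = 0) (h1 : v 1 = 0) {b c : ℝ} (hb : x 0 = b) (hc : x 1 = c) :
    mfderiv (𝓡 4) (𝓡 4) Φ x v ∈ tangentTo (slice φ b c) (Φ x) := by
  have hline : HasDerivAt (fun t : ℝ => x + t • v) v 0 := by
    have : HasDerivAt (fun t : ℝ => x + t • v) ((1 : ℝ) • v) 0 :=
      ((hasDerivAt_id (0 : ℝ)).smul_const v).const_add x
    rwa [one_smul] at this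
  have hx0 : x + (0 : ℝ) • v = x := by simp
  have hs : ContDiff ℝ ∞ (fun t : ℝ => x + t • v) := by fun_prop
  have hΦx : ContMDiffAt (𝓡 4) (𝓡 4) ∞ Φ (x + (0 : ℝ) • v) := by
    rw [hx0]
    exact hΦ.smooth.contMDiffAt (hΦ.isOpen.mem_nhds (hΦ.target_subset hx))
  refine ⟨fun t => Φ (x + t • v), ?_, ?_, ?_⟩
  · exact ContMDiffAt.comp (0 : ℝ) hΦx hs.contDiffAt.contMDiffAt
  · have : ∀ᶠ t in 𝓝 (0 : ℝ), x + t • v ∈ φ.target :=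
      hline.continuousAt.eventually (φ.open_target.mem_nhds (by simpa using hx))
    filter_upwards [this] with t ht
    refine ⟨(mem_source_of_target hΦ ht).2, ?_⟩
    rw [chart_apply_target hΦ ht]
    simp [h0, h1, hb, hc]
  · refine tangentBundle_ext (congrArg Φ hx0) ?_
    have h3 := mfderiv_comp (0 : ℝ) (hΦx.mdifferentiableAt (by simp))
      hline.differentiableAt.mdifferentiableAt
    have h4 : mfderiv 𝓘(ℝ, ℝ) (𝓡 4) (fun t : ℝ => x + t • v) 0 (1 : ℝ) = v := by
      rw [mfderiv_eq_fderiv]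
      exact hline.deriv
    have h5 : velocity (fun t : ℝ => Φ (x + t • v)) 0 = mfderiv (𝓡 4) (𝓡 4) Φ (x + (0 : ℝ) • v)
        (mfderiv 𝓘(ℝ, ℝ) (𝓡 4) (fun t : ℝ => x + t • v) 0 (1 : ℝ)) :=
      congrArg (fun T => T (1 : ℝ)) h3
    rw [h5, h4]
    have h6 : ∀ y, y = x → (mfderiv (𝓡 4) (𝓡 4) Φ y v : E4) = mfderiv (𝓡 4) (𝓡 4) Φ x v := by
      rintro y rfl
      rfl
    exact h6 _ hx0

end FinslerSpacetime

/-! ### Jacobi fields of the slice -/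

namespace FinslerSpacetime

variable {M : Type*} [TopologicalSpace M] [ChartedSpace E4 M] [IsManifold (𝓡 4) ∞ M]
  {S : FinslerSpacetime M} {e φ : OpenPartialHomeomorph M E4} {W : Set E4} {Φ : E4 → M}
  {f : M → ℝ} {N : ∀ q : M, TangentSpace (𝓡 4) q} {z : E4} {I : Set ℝ}

/-- Along a curve in the slice `N` is `∂_0 Φ` at the points `φ(α r)`, so by the chain rule only the
initial velocity of `α` matters. -/
lemma IsCurveIn.hasDerivAt_normal (hφ : S.IsLightlikeChart f N φ) (hΦ : S.IsContinuation φ W Φ)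
    (he : e ∈ IsManifold.maximalAtlas (𝓡 4) ∞ M) {p : E4} (hp : p ∈ φ.target)
    (hpe : Φ p ∈ e.source) {b c : ℝ} {u : TangentSpace (𝓡 4) (Φ p)} {α : ℝ → M}
    (hα : IsCurveIn (slice φ b c) (Φ p) u α) :
    (fun r => chartVec e (N (α r))) =ᶠ[𝓝 0]
        (fun r => fderiv ℝ (fun y => e (Φ y)) (φ (α r)) (basisVec 0)) ∧
      HasDerivAt (fun r => chartVec e (N (α r)))
        (fderiv ℝ (fun y => fderiv ℝ (fun y => e (Φ y)) y (basisVec 0)) p (chartVec φ u)) 0 := by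
  have hps := mem_source_of_target hΦ hp
  have hV := isOpen_chartDom (e := e) hΦ.isOpen hΦ.smooth
  have hψ := contDiffOn_chart he hΦ.smooth
  have hd := hα.hasDerivAt_chart hφ.mem_atlas hps.2
  have hα0 : φ (α 0) = p := by rw [hα.apply_zero, chart_apply_target hΦ hp]
  have hev : (fun r => chartVec e (N (α r))) =ᶠ[𝓝 0]
      fun r => fderiv ℝ (fun y => e (Φ y)) (φ (α r)) (basisVec 0) := by
    have h1 : ∀ᶠ r in 𝓝 (0 : ℝ), φ (α r) ∈ W ∩ Φ ⁻¹' e.source :=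
      hd.continuousAt.eventually (hV.mem_nhds (by
        show φ (α 0) ∈ _
        rw [hα0]
        exact ⟨hps.1, hpe⟩))
    filter_upwards [hα.2.1, h1] with r hr hr'
    have h2 := φ.map_source hr.1
    have h3 := chartVec_mfderiv he hΦ hr' (basisVec 0)
    rw [← h3]
    have h4 : ∀ q q' : M, q = q' → chartVec e (N q) = chartVec e (N q') := by
      rintro q _ rfl
      rfl
    rw [h4 _ _ (eq_continuation_of_mem_source hΦ hr.1).symm, normal_eq hφ hΦ h2]
    rfl
  refine ⟨hev, HasDerivAt.congr_of_eventuallyEq ?_ hev⟩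
  refine HasFDerivAt.comp_hasDerivAt (l := fun y => fderiv ℝ (fun y => e (Φ y)) y (basisVec 0))
    (0 : ℝ) ?_ hd
  rw [hα0]
  exact (((hψ.contDiffAt (hV.mem_nhds ⟨hps.1, hpe⟩)).fderiv_apply_const _).differentiableAt
    (by simp)).hasFDerivAt

/-- Comparison of the covariant derivative of a field along the geodesic with the covariant
derivative of `N` in the direction of its value. -/
lemma covDeriv_eq_add (hφ : S.IsLightlikeChart f N φ) (hΦ : S.IsContinuation φ W Φ)
    (he : e ∈ IsManifold.maximalAtlas (𝓡 4) ∞ M) {b : ℝ} (hb : line z b ∈ φ.target)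
    (hbe : Φ (line z b) ∈ e.source) {b' c : ℝ} {J : ∀ s, TangentSpace (𝓡 4) (Φ (line z s))}
    {α : ℝ → M} (hα : IsCurveIn (slice φ b' c) (Φ (line z b)) (J b) α) :
    covDeriv (S.coordL e) (fun r => e (Φ (line z r))) (deriv fun r => e (Φ (line z r)))
        (fun r => chartVec e (J r)) b
      = covDeriv (S.coordL e) (fun r => e (α r)) (fun r => chartVec e (N (α r)))
        (fun r => chartVec e (N (α r))) 0
      + (deriv (fun r => chartVec e (J r)) b
        - fderiv ℝ (fun y => fderiv ℝ (fun y => e (Φ y)) y (basisVec 0)) (line z b)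
          (chartVec φ (J b))) := by
  obtain ⟨U, A, H, -, hmem, -⟩ := exists_chart_geodesics hφ hΦ he
  have hV := isOpen_chartDom (e := e) hΦ.isOpen hΦ.smooth
  have hψ := contDiffOn_chart he hΦ.smooth
  have hbV : line z b ∈ W ∩ Φ ⁻¹' e.source := ⟨hΦ.target_subset hb, hbe⟩
  obtain ⟨hN, hN'⟩ := hα.hasDerivAt_normal hφ hΦ he hb hbe
  have hα0 : φ (α 0) = line z b := by rw [hα.apply_zero, chart_apply_target hΦ hb]
  have hN0 := hN.self_of_nhds
  simp only [hα0] at hN0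
  ext i
  simp only [covDeriv, PiLp.add_apply, PiLp.sub_apply]
  rw [hN0, hN'.deriv, (hα.hasDerivAt_chart he hbe).deriv, hα.apply_zero,
    deriv_comp_line (F := fun y => e (Φ y)) hV hψ hbV]
  -- Torsion-freeness: the Christoffel terms for `J` differentiated along `N` and for `N`
  -- differentiated along `J` coincide.
  have hsum : ∑ j, ∑ k, christoffel (S.coordL e) (e (Φ (line z b)))
        (fderiv ℝ (fun y => e (Φ y)) (line z b) (basisVec 0)) i j k
        * fderiv ℝ (fun y => e (Φ y)) (line z b) (basisVec 0) j * chartVec e (J b) k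
      = ∑ j, ∑ k, christoffel (S.coordL e) (e (Φ (line z b)))
        (fderiv ℝ (fun y => e (Φ y)) (line z b) (basisVec 0)) i j k
        * chartVec e (J b) j * fderiv ℝ (fun y => e (Φ y)) (line z b) (basisVec 0) k := by
    rw [Finset.sum_comm]
    refine Finset.sum_congr rfl fun j _ => Finset.sum_congr rfl fun k _ => ?_
    rw [H.christoffel_symm (hmem _ hbV).1 i k j]
    ring
  rw [hsum]
  ring

/-- At `s = b` the tangential part contributes only `c N`. By symmetry of second derivatives, the
first term is the derivative of `∂_0 Φ` in the direction `w`, which is what `covDeriv_eq_add`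
subtracts. -/
lemma hasDerivAt_chart_variationField (he : e ∈ IsManifold.maximalAtlas (𝓡 4) ∞ M)
    (hΦ : S.IsContinuation φ W Φ) {b : ℝ} (hb : line z b ∈ W ∩ Φ ⁻¹' e.source) (w : E4) (c : ℝ) :
    HasDerivAt (fun r => chartVec e (variationField Φ z w c b r))
      (fderiv ℝ (fun y => fderiv ℝ (fun y => e (Φ y)) y (basisVec 0)) (line z b) w
        + c • fderiv ℝ (fun y => e (Φ y)) (line z b) (basisVec 0)) b := by
  have hV := isOpen_chartDom (e := e) hΦ.isOpen hΦ.smooth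
  have hψ := contDiffOn_chart he hΦ.smooth
  have hat := hψ.contDiffAt (hV.mem_nhds hb)
  have hev : (fun r => chartVec e (variationField Φ z w c b r)) =ᶠ[𝓝 b]
      fun r => fderiv ℝ (fun y => e (Φ y)) (line z r) w
        + c • ((r - b) • deriv (fun r => e (Φ (line z r))) r) := by
    filter_upwards [eventually_line_mem hV hb] with r hr using chart_variationField he hΦ hr w c b
  refine HasDerivAt.congr_of_eventuallyEq ?_ hev
  have h1 := hasDerivAt_comp_line (F := fun y => fderiv ℝ (fun y => e (Φ y)) y w)
    (hat.fderiv_apply_const w)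
  have h2 := ((hasDerivAt_id b).sub_const b).smul (contDiffAt_chart_line he hΦ hb).hasDerivAt_deriv
  refine (h1.add (h2.const_smul c)).congr_deriv ?_
  rw [fderiv_fderiv_comm hat w, deriv_comp_line (F := fun y => e (Φ y)) hV hψ hb]
  simp

lemma chartVec_variationField_base (hφ : S.IsLightlikeChart f N φ) (hΦ : S.IsContinuation φ W Φ)
    {b : ℝ} (hb : line z b ∈ φ.target) (w : E4) (c : ℝ) :
    chartVec φ (variationField Φ z w c b b) = w := by
  have h1 := chart_variationField hφ.mem_atlas hΦ (mem_source_of_target hΦ hb) w c b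
  rw [sub_self, zero_smul, smul_zero, add_zero, fderiv_chart_target hΦ hb] at h1
  exact h1

/-- A variation field whose initial value is tangent to the slice is a Jacobi field of the slice. -/
theorem isSubmanifoldJacobiField_variationField (hφ : S.IsLightlikeChart f N φ)
    (hΦ : S.IsContinuation φ W Φ) (hIo : IsOpen I) (hI : ∀ s ∈ I, line z s ∈ W) {b : ℝ}
    (hb : line z b ∈ φ.target) {w : E4} (hw0 : w 0 = 0) (hw1 : w 1 = 0) (c : ℝ) :
    S.IsSubmanifoldJacobiField (slice φ b (z 1)) N (fun s => Φ (line z s)) I b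
      (variationField Φ z w c b) := by
  have hbs := mem_source_of_target hΦ hb
  refine ⟨isJacobiField_variationField hφ hΦ hIo hI w c b, ?_, ?_⟩
  · have h1 : variationField Φ z w c b b = mfderiv (𝓡 4) (𝓡 4) Φ (line z b) w := by
      simp [variationField]
    rw [h1]
    exact mem_tangentTo_slice hΦ hb hw0 hw1 (line_apply_zero z b) (by simp [line, basisVec_apply])
  · intro e he hbe α hα u hu
    have hbV : line z b ∈ W ∩ Φ ⁻¹' e.source := ⟨hbs.1, hbe⟩
    obtain ⟨G, hG, B, hB⟩ := exists_lorentz_form hφ hΦ he hbV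
    have h1 := covDeriv_eq_add hφ hΦ he hb hbe hα
    rw [(hasDerivAt_chart_variationField he hΦ hbV w c).deriv,
      chartVec_variationField_base hφ hΦ hb, add_sub_cancel_left] at h1
    -- By `h1` the two covariant derivatives differ by `c N`, so orthogonality of `N` to the slice
    -- is all that is required.
    have h2 : G (fderiv ℝ (fun y => e (Φ y)) (line z b) (basisVec 0)) (chartVec e u) = 0 := by
      have h3 := g_normal_of_tangentTo hφ hΦ hbs.2 hu
      rw [normal_eq hφ hΦ hb, S.g_eq_fundTensor_coordL he hbe, coordVec,
        mfderiv_chart_comp he hΦ.isOpen hΦ.smooth hbV.1 hbV.2] at h3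
      exact (hG _ _).symm.trans h3
    have hd := deriv_comp_line (F := fun y => e (Φ y)) (isOpen_chartDom (e := e) hΦ.isOpen hΦ.smooth)
      (contDiffOn_chart he hΦ.smooth) hbV
    rw [hd]
    refine (hG _ (chartVec e u)).trans (Eq.trans ?_ (hG _ (chartVec e u)).symm)
    refine (congrArg (fun X => G X (chartVec e u)) h1).trans ?_
    simp only [map_add, map_smul, LinearMap.add_apply, LinearMap.smul_apply, h2, smul_zero, add_zero]
    rfl

/-- A Jacobi field of the slice which vanishes at some other time is a variation field. -/
theorem IsSubmanifoldJacobiField.eq_variationField (hφ : S.IsLightlikeChart f N φ)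
    (hΦ : S.IsContinuation φ W Φ) (hIo : IsOpen I) (hI' : I.OrdConnected)
    (hI : ∀ s ∈ I, line z s ∈ W) {b : ℝ} (hb : b ∈ I) (hbφ : line z b ∈ φ.target)
    {J : ∀ s, TangentSpace (𝓡 4) (Φ (line z s))}
    (hJ : S.IsSubmanifoldJacobiField (slice φ b (z 1)) N (fun s => Φ (line z s)) I b J)
    {t : ℝ} (ht : t ∈ I) (htb : t ≠ b) (hJt : J t = 0) :
    ∃ (w : E4) (c : ℝ), w 0 = 0 ∧ w 1 = 0 ∧ ∀ s ∈ I, J s = variationField Φ z w c b s := by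
  obtain ⟨hJac, ⟨α, hα⟩, htan⟩ := hJ
  have hbs := mem_source_of_target hΦ hbφ
  obtain ⟨hw0, hw1⟩ := chartVec_of_tangentTo hφ hbs.2 ⟨α, hα⟩
  obtain ⟨G, hG, B, hB⟩ := exists_lorentz_form hφ hΦ hφ.mem_atlas hbs
  simp only [fderiv_chart_target hΦ hbφ] at hG
  have hJs : ContDiffAt ℝ ∞ (fun r => chartVec φ (J r)) b :=
    contDiffAt_chart_field hφ.mem_atlas hIo hJac.1 hb hbs.2
  have hJd := hJs.eventually_hasDerivAt.self_of_nhds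
  obtain ⟨d, hd⟩ : ∃ d, d = deriv (fun r => chartVec φ (J r)) b := ⟨_, rfl⟩
  rw [← hd] at hJd
  -- `g_N(N, J)` is affine and vanishes at `b` and at `t ≠ b`, so its slope is zero. Near `b` this
  -- function is the component `J¹` in the lightlike chart.
  have hd1 : d 1 = 0 := by
    have h1 := hJac.affine hφ hΦ hIo hI' hI hb ht
    have h2 : (fun r => S.g (coordVec Φ (line z r) 0) (coordVec Φ (line z r) 0) (J r)) =ᶠ[𝓝 b]
        fun r => chartVec φ (J r) 1 := by
      filter_upwards [eventually_line_mem φ.open_target hbφ] with r hr using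
        g_normal_eq hφ hΦ hr (J r)
    have hte := mem_chart_source E4 (Φ (line z t))
    have h3 : S.g (coordVec Φ (line z t) 0) (coordVec Φ (line z t) 0) (J t) = 0 := by
      have he := IsManifold.chart_mem_maximalAtlas (I := 𝓡 4) (n := ∞) (Φ (line z t))
      obtain ⟨G', hG', -⟩ := exists_lorentz_form hφ hΦ he ⟨hI t ht, hte⟩
      rw [hJt, S.g_eq_fundTensor_coordL he hte, coordVec,
        mfderiv_chart_comp he hΦ.isOpen hΦ.smooth (hI t ht) hte, map_zero]
      exact (hG' _ 0).trans (map_zero _)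
    rw [h3, h2.deriv_eq, (hasDerivAt_E4.1 hJd 1).deriv, g_normal_eq hφ hΦ hbφ, hw1, zero_add] at h1
    exact (mul_eq_zero.1 h1.symm).resolve_right (sub_ne_zero.2 htb)
  have hG0 : ∀ i, G (basisVec 0) (basisVec i) = if i = 1 then 1 else 0 := fun i => by
    rw [← gram_target hφ hΦ hbφ i, gram_eq hφ.mem_atlas hΦ.isOpen hΦ.smooth hbs.1 hbs.2, ← hG]
    simp only [fderiv_chart_target hΦ hbφ]
  -- In the lightlike chart `N` has constant components, so `d` is exactly the difference of the two
  -- covariant derivatives, and the tangential condition makes it orthogonal to the slice.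
  have hdv : ∀ v : E4, v 0 = 0 → v 1 = 0 → G d v = 0 := by
    intro v hv0 hv1
    have h1 := htan φ hφ.mem_atlas hbs.2 α hα _ (mem_tangentTo_slice hΦ hbφ hv0 hv1
      (line_apply_zero z b) (by simp [line, basisVec_apply]))
    have h2 := covDeriv_eq_add hφ hΦ hφ.mem_atlas hbφ hbs.2 hα
    rw [fderiv_fderiv_chart_target hΦ hbφ, sub_zero, ← hd] at h2
    have h3 := chartVec_mfderiv hφ.mem_atlas hΦ hbs v
    rw [fderiv_chart_target hΦ hbφ] at h3
    have h4 := deriv_comp_line (F := fun y => φ (Φ y))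
      (isOpen_chartDom (e := φ) hΦ.isOpen hΦ.smooth) (contDiffOn_chart hφ.mem_atlas hΦ.smooth) hbs
    rw [fderiv_chart_target hΦ hbφ] at h4
    rw [h4] at h1
    have h5 := (hG _ _).symm.trans (h1.trans (hG _ _))
    have h6 : G (covDeriv (S.coordL φ) (fun r => φ (Φ (line z r)))
          (deriv fun r => φ (Φ (line z r))) (fun r => chartVec φ (J r)) b)
          (chartVec φ (mfderiv (𝓡 4) (𝓡 4) Φ (line z b) v))
        = G (covDeriv (S.coordL φ) (fun r => φ (α r)) (fun r => chartVec φ (N (α r)))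
          (fun r => chartVec φ (N (α r))) 0)
          (chartVec φ (mfderiv (𝓡 4) (𝓡 4) Φ (line z b) v)) := h5
    rw [h2, h3, map_add, LinearMap.add_apply] at h6
    linarith
  have hGd : ∀ v, G d v = d 0 * G (basisVec 0) v + d 2 * G (basisVec 2) v
      + d 3 * G (basisVec 3) v := fun v => by
    have := map_eq_sum_basisVec (G.flip v) d
    simpa [Fin.sum_univ_four, hd1] using this
  have h2 := hdv (basisVec 2) (by simp [basisVec_apply]) (by simp [basisVec_apply])
  have h3 := hdv (basisVec 3) (by simp [basisVec_apply]) (by simp [basisVec_apply])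
  rw [hGd, hG0] at h2 h3
  -- As `∂_0` is orthogonal to `∂_2` and `∂_3`, what remains is a homogeneous system for `d 2` and
  -- `d 3` with matrix `h`, nondegenerate on the range of the coordinates.
  have hdet : G (basisVec 2) (basisVec 2) * G (basisVec 3) (basisVec 3)
      - G (basisVec 2) (basisVec 3) * G (basisVec 3) (basisVec 2) ≠ 0 := by
    have h4 := delta_ne_zero_of_target hφ hΦ hbφ
    rw [Delta, Matrix.det_fin_two_of] at h4
    simp only [gram_eq hφ.mem_atlas hΦ.isOpen hΦ.smooth hbs.1 hbs.2,
      fderiv_chart_target hΦ hbφ, hG] at h4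
    intro h5
    rw [h5, Real.sqrt_zero] at h4
    exact h4 rfl
  have hd2 : d 2 = 0 := by
    refine (mul_eq_zero.1 (?_ : d 2 * _ = 0)).resolve_right hdet
    simp at h2 h3
    linear_combination G (basisVec 3) (basisVec 3) * h2 - G (basisVec 3) (basisVec 2) * h3
  have hd3 : d 3 = 0 := by
    refine (mul_eq_zero.1 (?_ : d 3 * _ = 0)).resolve_right hdet
    simp at h2 h3
    linear_combination G (basisVec 2) (basisVec 2) * h3 - G (basisVec 2) (basisVec 3) * h2
  have hd0 : d = d 0 • basisVec 0 := by
    ext i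
    fin_cases i <;> simp [basisVec_apply, hd1, hd2, hd3]
  -- Since `d` is a multiple of `N`, the variation field with `w = J(b)` and `c = d 0` has the same
  -- initial data as `J`.
  refine ⟨chartVec φ (J b), d 0, hw0, hw1, fun s hs => ?_⟩
  refine jacobi_unique hφ hΦ hφ.mem_atlas hIo hI' hI hJac
    (isJacobiField_variationField hφ hΦ hIo hI _ _ _) hb hbs.2 ?_ ?_ hs
  · rw [chartVec_variationField_base hφ hΦ hbφ]
  · rw [(hasDerivAt_chart_variationField hφ.mem_atlas hΦ hbs _ _).deriv,
      fderiv_fderiv_chart_target hΦ hbφ, fderiv_chart_target hΦ hbφ, zero_add, ← hd0, hd]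

end FinslerSpacetime

end

/-! ### The focal point criterion -/

open FinslerSpacetime

theorem mainTheorem6 {M : Type*} [TopologicalSpace M] [T2Space M] [SecondCountableTopology M]
    [ConnectedSpace M] [ChartedSpace E4 M] [IsManifold (𝓡 4) ∞ M]
    (S : FinslerSpacetime M)
    (f : M → ℝ) (N : ∀ q : M, TangentSpace (𝓡 4) q)
    (φ : OpenPartialHomeomorph M E4) (hφ : S.IsLightlikeChart f N φ)
    (W : Set E4) (Φ : E4 → M) (hΦ : S.IsContinuation φ W Φ)
    (b c : ℝ) (z : E4) (hzc : z 1 = c)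
    (I : Set ℝ) (hI : IsOpen I) (hI' : I.OrdConnected) (hb : b ∈ I) (hz : z 0 ∈ I)
    (hIW : ∀ s ∈ I, FinslerSpacetime.line z s ∈ W)
    (hbφ : FinslerSpacetime.line z b ∈ φ.target) :
    S.IsFocalPoint (FinslerSpacetime.slice φ b c) N
        (fun s => Φ (FinslerSpacetime.line z s)) I b (z 0)
      ↔ S.Delta Φ z = 0 := by
  subst hzc
  have hzW : z ∈ W := by simpa only [line_self] using hIW _ hz
  have hgram := gram_line hφ hΦ hI hI' hIW hb hbφ hz
  rw [line_self] at hgram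
  rw [delta_eq_zero_iff hφ hΦ hzW (by simpa using hgram 0) (by simpa using hgram 2)
    (by simpa using hgram 3)]
  have hbs := mem_source_of_target hΦ hbφ
  constructor
  · rintro ⟨-, -, -, -, htb, J, hJ, ⟨s, hs, hJs⟩, hJt⟩
    obtain ⟨w, k, hw0, hw1, hJw⟩ := hJ.eq_variationField hφ hΦ hI hI' hIW hb hbφ hz htb hJt
    have h1 : mfderiv (𝓡 4) (𝓡 4) Φ z (w + (k * (z 0 - b)) • basisVec 0) = 0 := by
      have h2 : variationField Φ z w k b (z 0) = 0 := (hJw _ hz).symm.trans hJt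
      rw [variationField] at h2
      have h3 : ∀ y, y = z →
          mfderiv (𝓡 4) (𝓡 4) Φ y (w + (k * (z 0 - b)) • basisVec 0) = 0 →
          mfderiv (𝓡 4) (𝓡 4) Φ z (w + (k * (z 0 - b)) • basisVec 0) = 0 := by
        rintro y rfl h
        exact h
      exact h3 _ (line_self z) h2
    have hw : w = w 2 • basisVec 2 + w 3 • basisVec 3 := by
      ext i
      fin_cases i <;> simp [basisVec_apply, hw0, hw1]
    refine ⟨w 2, w 3, -(k * (z 0 - b)), ?_, by rwa [← hw, neg_smul, sub_neg_eq_add]⟩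
    -- Without a part along `∂_2, ∂_3` the field is `k (s - b) N`. As `t ≠ b` and `N ≠ 0`, its
    -- vanishing at `t` forces `k = 0`, and then it vanishes identically.
    by_contra! h0
    rw [h0.1, h0.2, zero_smul, zero_smul, zero_add] at hw
    rw [hw, zero_add] at h1
    have h4 : (k * (z 0 - b)) • coordVec Φ z 0 = 0 :=
      (map_smul (mfderiv (𝓡 4) (𝓡 4) Φ z) _ _).symm.trans h1
    have hk : k * (z 0 - b) = 0 :=
      (smul_eq_zero.1 h4).resolve_right (coordVec_mem_Abar hφ hΦ hzW).2
    have hk0 : k = 0 := (mul_eq_zero.1 hk).resolve_right (sub_ne_zero.2 htb)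
    refine hJs ((hJw s hs).trans ?_)
    rw [variationField, hw, hk0, zero_mul, zero_smul, zero_add]
    exact map_zero (mfderiv (𝓡 4) (𝓡 4) Φ (line z s))
  · rintro ⟨a₂, a₃, μ, ha, h0⟩
    -- At time `b` the line is in the range of the coordinates, where `Δ` does not vanish.
    have htb : z 0 ≠ b := by
      rintro rfl
      rw [line_self] at hbφ
      refine delta_ne_zero_of_target hφ hΦ hbφ ?_
      exact (delta_eq_zero_iff hφ hΦ hzW (by simpa using hgram 0) (by simpa using hgram 2)
        (by simpa using hgram 3)).2 ⟨a₂, a₃, μ, ha, h0⟩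
    -- The coefficient `-μ / (t - b)` makes the tangential part equal to `-μ N` at time `t`, where
    -- the field becomes the vanishing combination `h0`. At time `b` it is nonzero because `dΦ` is
    -- injective there.
    refine ⟨fun s hs => isGeodesicAt_line hφ hΦ (hIW s hs), ⟨hbs.2, ?_⟩, ?_,
      fun q hq w hw => g_normal_of_tangentTo hφ hΦ hq.1 hw, htb,
      variationField Φ z (a₂ • basisVec 2 + a₃ • basisVec 3) (-μ / (z 0 - b)) b,
      isSubmanifoldJacobiField_variationField hφ hΦ hI hIW hbφ (by simp [basisVec_apply])
        (by simp [basisVec_apply]) _, ⟨b, hb, fun h => ?_⟩, ?_⟩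
    · rw [chart_apply_target hΦ hbφ]
      exact ⟨line_apply_zero z b, by simp [line, basisVec_apply]⟩
    · rw [velocity_comp_line hΦ.isOpen hΦ.smooth hbs.1]
      exact (normal_eq hφ hΦ hbφ).symm
    · have h1 := mfderiv_eq_zero_of_target hφ hΦ hbφ h
      have h2 := congrArg (fun v : E4 => v 2) h1
      have h3 := congrArg (fun v : E4 => v 3) h1
      simp [basisVec_apply] at h2 h3
      simp [h2, h3] at ha
    · rw [variationField, line_self, div_mul_cancel₀ _ (sub_ne_zero.2 htb), neg_smul,
        ← sub_eq_add_neg]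
      exact h0
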